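/- Let $n\ge 3$, let $U\subset\mathbb R^n$ be a connected coordinate domain, and let $g$, $\tilde g=\Omega_0^2 g$ ($\Omega_0>0$ smooth) be two conformally related smooth (pseudo-)Riemannian metrics on $U$, each of constant sectional curvature. On each of them let a second-order (properly) superintegrable system be given that is of Wilczynski type, non-degenerate and abundant. For the metric $g$ this means: there is a smooth tensor field $T_{ij}{}^k$, symmetric and trace-free in $i,j$ (the structure tensor), such that the potentials of the system are the solutions $V$ on $U$ of $$V_{,ij}=T_{ij}{}^kV_{,k}+\tfrac1n\,g_{ij}\,\Delta V,$$ these form a linear space $\mathcal V$ of dimension $n+2$, and there is a linear space $\mathcal K$ of dimension $\tfrac{n(n+1)}2$ of symmetric tensor fields $K^{ij}$ (Killing tensors) such that for all $V\in\mathcal V$, $K\in\mathcal K$ there is a function $W$ for which $K^{ij}p_ip_j+W$ Poisson commutes with $H=g^{ij}p_ip_j+V$. The same is required of $\tilde g,\tilde T,\tilde{\mathcal V},\tilde{\mathcal K}$. Let $B$ be a structure function of the first system, i.e. a smooth function with $$T_{ijk}=\bigl(B_{,(ijk)}\bigr)_\circ+\frac1{n+2}\Bigl(g_{ik}w_j+g_{jk}w_i-\frac2n\,g_{ij}w_k\Bigr),\qquad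 w_j=(\Delta B)_{,j}+\frac{2(n+1)}{n(n-1)}\,R\,B_{,j},$$ where $R$ is the scalar curvature, $(ijk)$ denotes total symmetrisation (with factor $\frac16$) and $\circ$ the totally trace-free part; let $\tilde B$ be a structure function of the second system. Consider the conformal densities of weight $2$ given in local coordinates by $\mathbf b=B\,|\det g|^{-1/n}$ and $\tilde{\mathbf b}=\tilde B\,|\det\tilde g|^{-1/n}$. Suppose that $\mathbf b=\tilde{\mathbf b}$ on $U$. Exclude only the case in which both systems are trivial ($T\equiv0$ and $\tilde T\equiv0$, the harmonic oscillator) while $\tilde g$ is not a constant multiple of $g$. Then the two systems are Stäckel (conformally) equivalent: there is a smooth function $\Omega>0$ on $U$ such that - the Hamiltonians correspond by $\tilde H=\Omega^{-2}H$, i.e. $\tilde g^{ij}=\Omega^{-2}g^{ij}$ and $\tilde{\mathcal V}=\Omega^{-2}\mathcal V$; - the trace-free parts of the tensors in $\mathcal K$ (with respect to $g$) and in $\tilde{\mathcal K}$ (with respect to $\tilde g$), with upper indices, span the same linear space; - $\Omega^2$ belongs to $\mathcal V$; in particular for every $K\in\mathcal K$ the Hamiltonian $g^{ij}p_ip_j+\Omega^2$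 has an integral $K^{ij}p_ip_j+W$. -/

import Mathlib

open scoped ContDiff

noncomputable section

namespace Superintegrable

/-! Geometry and mechanics in a coordinate domain `U` of `ℝⁿ`.  A covariant 2-tensor field is a
matrix-valued function.  Derivatives are only ever used at points of the open set `U`. -/

/-- Coordinate space. -/
abbrev Coord (n : ℕ) : Type := Fin n → ℝ

variable {n : ℕ}

/-- The partial derivative `∂ᵢ f` at `x`. -/
def pd (i : Fin n) (f : Coord n → ℝ) (x : Coord n) : ℝ :=
  fderiv ℝ f x (Pi.single i 1)

/-- `g` is a smooth pseudo-Riemannian metric on `U` (any signature, Riemannian included). -/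
structure IsMetricOn (g : Coord n → Matrix (Fin n) (Fin n) ℝ) (U : Set (Coord n)) : Prop where
  smooth : ∀ i j, ContDiffOn ℝ ∞ (fun x => g x i j) U
  symm : ∀ x ∈ U, (g x).IsSymm
  nondeg : ∀ x ∈ U, (g x).det ≠ 0

/-- Christoffel symbol `Γᵏᵢⱼ` of the Levi-Civita connection. -/
def christoffel (g : Coord n → Matrix (Fin n) (Fin n) ℝ) (k i j : Fin n) (x : Coord n) : ℝ :=
  (1 / 2) * ∑ l, (g x)⁻¹ k l *
    (pd i (fun y => g y j l) x + pd j (fun y => g y i l) x - pd l (fun y => g y i j) x)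

/-- Curvature `Rˡₖᵢⱼ`, defined by `R(∂ᵢ, ∂ⱼ) ∂ₖ = ∑ₗ Rˡₖᵢⱼ ∂ₗ`. -/
def riemann (g : Coord n → Matrix (Fin n) (Fin n) ℝ) (l k i j : Fin n) (x : Coord n) : ℝ :=
  pd i (christoffel g l j k) x - pd j (christoffel g l i k) x
    + ∑ m, (christoffel g l i m x * christoffel g m j k x
        - christoffel g l j m x * christoffel g m i k x)

/-- Scalar curvature (equal to `n (n - 1)` on the unit sphere). -/
def scalarCurv (g : Coord n → Matrix (Fin n) (Fin n) ℝ) (x : Coord n) : ℝ :=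
  ∑ k, ∑ j, (g x)⁻¹ k j * ∑ i, riemann g i k i j x

/-- Constant sectional curvature `κ` on `U`:
`R(X, Y) Z = κ (g(Y, Z) X - g(X, Z) Y)`. -/
def HasConstantCurvature (g : Coord n → Matrix (Fin n) (Fin n) ℝ) (U : Set (Coord n)) : Prop :=
  ∃ κ : ℝ, ∀ x ∈ U, ∀ l k i j : Fin n,
    riemann g l k i j x =
      κ * ((if l = i then 1 else 0) * g x j k - (if l = j then 1 else 0) * g x i k)

/-- Second covariant derivative `f_{,ij}` of a function. -/
def hess (g : Coord n → Matrix (Fin n) (Fin n) ℝ) (f : Coord n → ℝ) (i j : Fin n)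
    (x : Coord n) : ℝ :=
  pd j (pd i f) x - ∑ k, christoffel g k i j x * pd k f x

/-- Laplace-Beltrami operator `Δ f = gⁱʲ f_{,ij}`. -/
def lap (g : Coord n → Matrix (Fin n) (Fin n) ℝ) (f : Coord n → ℝ) (x : Coord n) : ℝ :=
  ∑ i, ∑ j, (g x)⁻¹ i j * hess g f i j x

/-- Third covariant derivative `f_{,ijk}` (`k` is the last index of differentiation). -/
def third (g : Coord n → Matrix (Fin n) (Fin n) ℝ) (f : Coord n → ℝ) (i j k : Fin n)
    (x : Coord n) : ℝ :=
  pd k (hess g f i j) x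
    - ∑ m, (christoffel g m k i x * hess g f m j x + christoffel g m k j x * hess g f i m x)

/-- Total symmetrisation of a 3-tensor, `1/6` times the sum over all permutations of indices. -/
def symmetrize (A : Fin n → Fin n → Fin n → ℝ) (i j k : Fin n) : ℝ :=
  (1 / 6) * (A i j k + A j k i + A k i j + A j i k + A i k j + A k j i)

/-- Completely trace-free part, with respect to the bilinear form `G`, of a totally symmetric
3-tensor. -/
def tracefree3 (G : Matrix (Fin n) (Fin n) ℝ) (A : Fin n → Fin n → Fin n → ℝ)
    (i j k : Fin n) : ℝ :=
  let a : Fin n → ℝ := fun c => ∑ p, ∑ q, G⁻¹ p q * A p q c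
  A i j k - (1 / ((n : ℝ) + 2)) * (G i j * a k + G j k * a i + G k i * a j)

/-- Canonical Poisson bracket of functions of positions `q` and momenta `p`. -/
def poisson (F H : Coord n → Coord n → ℝ) (q p : Coord n) : ℝ :=
  ∑ i, (pd i (fun q' => F q' p) q * pd i (H q) p - pd i (fun q' => H q' p) q * pd i (F q) p)

/-- The function `Kⁱʲ(q) pᵢ pⱼ + W(q)` on phase space; `K` has upper indices. -/
def quadraticObservable (K : Coord n → Matrix (Fin n) (Fin n) ℝ) (W : Coord n → ℝ)
    (q p : Coord n) : ℝ :=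
  (∑ i, ∑ j, K q i j * p i * p j) + W q

/-- The natural Hamiltonian `gⁱʲ(q) pᵢ pⱼ + V(q)`. -/
def hamiltonian (g : Coord n → Matrix (Fin n) (Fin n) ℝ) (V : Coord n → ℝ) :
    Coord n → Coord n → ℝ :=
  quadraticObservable (fun q => (g q)⁻¹) V

/-- `F` is an integral of the motion for `H` over `U`. -/
def IsIntegralOfMotion (U : Set (Coord n)) (F H : Coord n → Coord n → ℝ) : Prop :=
  ∀ q ∈ U, ∀ p, poisson F H q p = 0

/-- `K` is the quadratic part of a second-order integral `Kⁱʲpᵢpⱼ + W` of the natural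
Hamiltonian with metric `g` and potential `V`. -/
def AdmitsIntegral (U : Set (Coord n)) (g : Coord n → Matrix (Fin n) (Fin n) ℝ)
    (V : Coord n → ℝ) (K : Coord n → Matrix (Fin n) (Fin n) ℝ) : Prop :=
  ∃ W : Coord n → ℝ, ContDiffOn ℝ ∞ W U ∧
    IsIntegralOfMotion U (quadraticObservable K W) (hamiltonian g V)

/-- A second-order (properly) superintegrable system on the coordinate domain `U`: a metric, a
linear family of potentials, and a linear space of associated Killing tensors (as contravariant
tensors), each of which is the quadratic part of an integral for every potential of the family.
Functions and tensors on `U` are represented by their extension by zero, so that the vector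
spaces below are spaces of functions and tensor fields on `U`.  The number of integrals is
prescribed by the predicate `IsAbundant`. -/
structure System (n : ℕ) (U : Set (Coord n)) where
  g : Coord n → Matrix (Fin n) (Fin n) ℝ
  isMetric : IsMetricOn g U
  potentials : Submodule ℝ (Coord n → ℝ)
  killing : Submodule ℝ (Coord n → Matrix (Fin n) (Fin n) ℝ)
  potentials_smooth : ∀ V ∈ potentials, ContDiffOn ℝ ∞ V U
  potentials_zero : ∀ V ∈ potentials, ∀ x ∉ U, V x = 0
  killing_smooth : ∀ K ∈ killing, ∀ i j, ContDiffOn ℝ ∞ (fun x => K x i j) U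
  killing_symm : ∀ K ∈ killing, ∀ x ∈ U, (K x).IsSymm
  killing_zero : ∀ K ∈ killing, ∀ x ∉ U, K x = 0
  integral : ∀ V ∈ potentials, ∀ K ∈ killing, AdmitsIntegral U g V K

/-- `T x i j k` are the components `Tᵢⱼᵏ` of a smooth tensor field on `U`, symmetric and trace-free
in its two lower indices. -/
structure IsStructureTensor (g : Coord n → Matrix (Fin n) (Fin n) ℝ)
    (T : Coord n → Fin n → Fin n → Fin n → ℝ) (U : Set (Coord n)) : Prop where
  smooth : ∀ i j k, ContDiffOn ℝ ∞ (fun x => T x i j k) U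
  symm : ∀ x ∈ U, ∀ i j k, T x i j k = T x j i k
  tracefree : ∀ x ∈ U, ∀ k, ∑ i, ∑ j, (g x)⁻¹ i j * T x i j k = 0

/-- The Wilczynski equation `V_{,ij} = Tᵢⱼᵏ V_{,k} + (1/n) gᵢⱼ ΔV` on `U`. -/
def Wilczynski (g : Coord n → Matrix (Fin n) (Fin n) ℝ)
    (T : Coord n → Fin n → Fin n → Fin n → ℝ) (U : Set (Coord n)) (V : Coord n → ℝ) : Prop :=
  ∀ x ∈ U, ∀ i j,
    hess g V i j x = (∑ k, T x i j k * pd k V x) + (1 / (n : ℝ)) * g x i j * lap g V x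

/-- The system is of Wilczynski type with structure tensor `T` and non-degenerate: its potentials
are the solutions on `U` of the Wilczynski equation, and they form a space of dimension `n + 2`. -/
structure System.IsNondegenerate {U : Set (Coord n)} (S : System n U)
    (T : Coord n → Fin n → Fin n → Fin n → ℝ) : Prop where
  tensor : IsStructureTensor S.g T U
  potentials_eq : (S.potentials : Set (Coord n → ℝ)) =
    {V | ContDiffOn ℝ ∞ V U ∧ (∀ x ∉ U, V x = 0) ∧ Wilczynski S.g T U V}
  finrank_eq : Module.finrank ℝ S.potentials = n + 2

/-- An abundant system with structure tensor `T`: non-degenerate, with `n (n + 1) / 2` linearly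
independent associated Killing tensors. -/
structure System.IsAbundant {U : Set (Coord n)} (S : System n U)
    (T : Coord n → Fin n → Fin n → Fin n → ℝ) : Prop where
  nondegenerate : S.IsNondegenerate T
  finrank_eq : Module.finrank ℝ S.killing = n * (n + 1) / 2

/-- `B` is a structure function for the structure tensor `T` on the metric `g`: with
`Tᵢⱼₖ = ∑ₗ Tᵢⱼˡ gₗₖ` and `wⱼ = (ΔB)_{,j} + 2 (n + 1) / (n (n - 1)) R B_{,j}`,
`Tᵢⱼₖ = (B_{,(ijk)})_∘ + (1 / (n + 2)) (gᵢₖ wⱼ + gⱼₖ wᵢ - (2 / n) gᵢⱼ wₖ)`. -/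
def IsStructureFunction (g : Coord n → Matrix (Fin n) (Fin n) ℝ)
    (T : Coord n → Fin n → Fin n → Fin n → ℝ) (U : Set (Coord n)) (B : Coord n → ℝ) : Prop :=
  ContDiffOn ℝ ∞ B U ∧ ∀ x ∈ U, ∀ i j k,
    let w : Fin n → ℝ := fun c =>
      pd c (lap g B) x
        + 2 * ((n : ℝ) + 1) / ((n : ℝ) * ((n : ℝ) - 1)) * scalarCurv g x * pd c B x
    ∑ l, T x i j l * g x l k =
      tracefree3 (g x) (symmetrize (fun a b c => third g B a b c x)) i j k
        + (1 / ((n : ℝ) + 2)) *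
          (g x i k * w j + g x j k * w i - (2 / (n : ℝ)) * g x i j * w k)

/-- Local expression `B |det g|^{-1/n}` of the conformal density of weight 2 defined by the
function `B` on the metric `g`. -/
def density (g : Coord n → Matrix (Fin n) (Fin n) ℝ) (B : Coord n → ℝ) (x : Coord n) : ℝ :=
  B x * |(g x).det| ^ (-(1 / (n : ℝ)))

/-- The metrics `g` and `g'` represent the same conformal structure on `U`. -/
def SameConformalClass (U : Set (Coord n)) (g g' : Coord n → Matrix (Fin n) (Fin n) ℝ) : Prop :=
  ∃ Ω : Coord n → ℝ, ContDiffOn ℝ ∞ Ω U ∧ (∀ x ∈ U, 0 < Ω x) ∧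
    ∀ x ∈ U, g' x = (Ω x ^ 2) • g x

/-- Trace-free part `Kⁱʲ - (1/n) (gₐ_b Kᵃᵇ) gⁱʲ` of a contravariant 2-tensor field. -/
def tracefreePart (g K : Coord n → Matrix (Fin n) (Fin n) ℝ) (x : Coord n) :
    Matrix (Fin n) (Fin n) ℝ :=
  K x - ((1 / (n : ℝ)) * ∑ a, ∑ b, g x a b * K x a b) • (g x)⁻¹

/-- The systems are conformally equivalent with rescaling function `Ω`: the Hamiltonians of the
second family are the functions `Ω⁻² H` with `H` in the first family, and the trace-free parts of
the Killing tensors, with upper indices, span the same linear space. -/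
structure ConformallyEquivalentVia {U : Set (Coord n)} (S S' : System n U)
    (Ω : Coord n → ℝ) : Prop where
  smooth : ContDiffOn ℝ ∞ Ω U
  pos : ∀ x ∈ U, 0 < Ω x
  hamiltonian_fwd : ∀ V ∈ S.potentials, ∃ V' ∈ S'.potentials, ∀ q ∈ U, ∀ p,
    hamiltonian S'.g V' q p = (Ω q ^ 2)⁻¹ * hamiltonian S.g V q p
  hamiltonian_bwd : ∀ V' ∈ S'.potentials, ∃ V ∈ S.potentials, ∀ q ∈ U, ∀ p,
    hamiltonian S'.g V' q p = (Ω q ^ 2)⁻¹ * hamiltonian S.g V q p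
  span_eq : Submodule.span ℝ (tracefreePart S.g '' (S.killing : Set _)) =
    Submodule.span ℝ (tracefreePart S'.g '' (S'.killing : Set _))

/-- The systems are Stäckel equivalent: they are conformally equivalent, with a rescaling function
`Ω` such that `Ω²` (on `U`) is one of the potentials of the first system; in particular the
Hamiltonian with metric `g` and potential `Ω²` admits the integrals of the system. -/
def StackelEquivalent {U : Set (Coord n)} (S S' : System n U) : Prop :=
  ∃ Ω : Coord n → ℝ, ConformallyEquivalentVia S S' Ω ∧
    U.indicator (fun x => Ω x ^ 2) ∈ S.potentials ∧
    ∀ K ∈ S.killing, AdmitsIntegral U S.g (fun x => Ω x ^ 2) K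

end Superintegrable

end

open scoped ContDiff

noncomputable section

namespace Superintegrable

open scoped Matrix Topology
open Filter

/-! ### Calculus of scalar, vector and matrix fields in coordinates -/

section Calculus

variable {n : ℕ}

/-! Write g' = Ω² g, φ = log Ω, ⟨·,·⟩ = g, and T_a for the endomorphism b ↦ T(a, b). Everything is
reduced to orthogonal pairs of vectors: the Wilczynski equation says exactly that Hess V(a, k) =
dV(T_a k) whenever a ⊥ k, since a bilinear form vanishing on such pairs is a multiple of the metric.
The target is the pair of identities t' - t = -3 dφ for the trace covectors of T and T', and dφ(T_a
k) = 3 dφ(a) dφ(k) for a ⊥ k. Given these, V' solves the second Wilczynski equation if and only if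
Ω² V' solves the first (`ConformalPair.wilczynski_iff`).

Equality of the densities means B' = Ω² B. Since n ≥ 3 and both curvatures are constant, Hess φ = dφ
⊗ dφ + c g (`ConformalOn.hess_log`). With this, the diagonal of the third covariant derivative of Ω²
B for g' equals Ω² times that of B for g, modulo multiples of the metric. So the trace-free cubic
parts agree up to the factor Ω², and T' - T is a pure trace term in e = t' - t
(`ConformalOn.endForm_eq`).

The remaining input is integrability. The equations for (V, dV, ΔV) close up, so the n + 2
dimensional space of potentials realises every value of dV and ΔV at a point. Hence the
Bertrand-Darboux equations hold for every covector; combined with the Killing equation they express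
∇K linearly in K (`System.IsNondegenerate.killingEq`). A Killing tensor is then determined by its
value at one point, and abundance says that every symmetric value occurs. Rank-one values k ⊗ k turn
the Ricci identity for K into conditions on T alone: (i) T_a T_c k = T_c T_a k for a, c ⊥ k, when
combined with the integrability of the potentials (`System.IsAbundant.commutator_eq_zero`); (ii)
3⟨v, (∇_v T)_v z⟩ - ⟨v, T_v T_v z⟩ - (1 + 2/n) t(v) ⟨v, T_v z⟩ = 0 for z ⊥ v
(`System.IsAbundant.covEnd_identity`).

Comparing (ii) for the two systems gives, with u = t' - t + 3 dφ and S the cubic part of T, the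
relation 3 u(v) S(z,v,v) + u(z) S(v,v,v) ∈ ⟨v,v⟩ · (bilinear in z, v) for z ⊥ v. Algebra forces u =
0 or S = 0 (`cubic_eq_zero_of_orthogonal`). If u ≠ 0 at a point, S vanishes nearby, hence so do both
structure tensors by (i), and they then vanish on all of U
(`System.IsAbundant.eq_zero_of_eventually`): the Killing tensors are parallel near the point, which
forces flatness, and on a flat space parallelism of a Killing tensor propagates. The two systems
would be trivial, so by hypothesis g' is a constant multiple of g and u = 0 after all. With e = -3
dφ known, comparing (i) for T and T' gives the second identity.

Since constants are potentials of the second system, Ω² is a potential of the first. If Z is the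
scalar part of the integral belonging to K and Ω², the Stäckel transform K - (Z/Ω²) g⁻¹ admits
integrals for all potentials of the second system, and so lies in its Killing space because that
space has the largest possible dimension. The transform does not change the trace-free part, and the
argument is symmetric in the two systems. -/

/-- Directional derivative of a function in the constant direction `v`. -/
def dd (v : Coord n) (f : Coord n → ℝ) (x : Coord n) : ℝ := fderiv ℝ f x v

/-- Coordinate differential of a function. -/
def grad (f : Coord n → ℝ) (x : Coord n) : Coord n := fun i => pd i f x

/-- Directional derivative of a vector field. -/
def vdd (v : Coord n) (w : Coord n → Coord n) (x : Coord n) : Coord n :=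
  fun i => dd v (fun y => w y i) x

/-- Directional derivative of a matrix field. -/
def mdd (v : Coord n) (A : Coord n → Matrix (Fin n) (Fin n) ℝ) (x : Coord n) :
    Matrix (Fin n) (Fin n) ℝ :=
  Matrix.of fun i j => dd v (fun y => A y i j) x

/-- Smoothness of a matrix field at a point. -/
def SmoothMat (A : Coord n → Matrix (Fin n) (Fin n) ℝ) (x : Coord n) : Prop :=
  ∀ i j, ContDiffAt ℝ ∞ (fun y => A y i j) x

/-- Smoothness of a vector field at a point. -/
def SmoothVec (w : Coord n → Coord n) (x : Coord n) : Prop :=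
  ∀ i, ContDiffAt ℝ ∞ (fun y => w y i) x

variable {f h : Coord n → ℝ} {v : Coord n} {x : Coord n} {a b : Coord n → Coord n}
  {A B : Coord n → Matrix (Fin n) (Fin n) ℝ}

theorem smooth_differentiableAt (hf : ContDiffAt ℝ ∞ f x) : DifferentiableAt ℝ f x :=
  hf.differentiableAt (by simp)

theorem dd_eq_sum (v : Coord n) (f : Coord n → ℝ) (x : Coord n) :
    dd v f x = v ⬝ᵥ grad f x := by
  unfold dd grad pd
  conv_lhs => rw [pi_eq_sum_univ' v, map_sum]
  simp only [map_smul, smul_eq_mul, dotProduct]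

theorem pd_eq_dd (i : Fin n) (f : Coord n → ℝ) (x : Coord n) :
    pd i f x = dd (Pi.single i 1) f x := rfl

theorem dd_congr {f h : Coord n → ℝ} (hfh : f =ᶠ[𝓝 x] h) : dd v f x = dd v h x := by
  unfold dd
  rw [hfh.fderiv_eq]

theorem dd_add (hf : ContDiffAt ℝ ∞ f x) (hh : ContDiffAt ℝ ∞ h x) :
    dd v (fun y => f y + h y) x = dd v f x + dd v h x := by
  unfold dd
  rw [fderiv_fun_add (smooth_differentiableAt hf) (smooth_differentiableAt hh)]
  rfl

theorem dd_sub (hf : ContDiffAt ℝ ∞ f x) (hh : ContDiffAt ℝ ∞ h x) :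
    dd v (fun y => f y - h y) x = dd v f x - dd v h x := by
  unfold dd
  rw [fderiv_fun_sub (smooth_differentiableAt hf) (smooth_differentiableAt hh)]
  rfl

theorem dd_const (c : ℝ) : dd v (fun _ => c) x = 0 := by
  unfold dd
  simp

theorem dd_mul (hf : ContDiffAt ℝ ∞ f x) (hh : ContDiffAt ℝ ∞ h x) :
    dd v (fun y => f y * h y) x = dd v f x * h x + f x * dd v h x := by
  unfold dd
  rw [fderiv_fun_mul (smooth_differentiableAt hf) (smooth_differentiableAt hh)]
  simp only [add_apply, smul_apply, smul_eq_mul]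
  ring

theorem dd_const_mul (c : ℝ) (hf : ContDiffAt ℝ ∞ f x) :
    dd v (fun y => c * f y) x = c * dd v f x := by
  rw [dd_mul contDiffAt_const hf, dd_const]
  ring

theorem dd_sum {ι : Type*} (s : Finset ι) {F : ι → Coord n → ℝ}
    (hF : ∀ i ∈ s, ContDiffAt ℝ ∞ (F i) x) :
    dd v (fun y => ∑ i ∈ s, F i y) x = ∑ i ∈ s, dd v (F i) x := by
  unfold dd
  rw [fderiv_fun_sum fun i hi => smooth_differentiableAt (hF i hi)]
  simp

theorem dd_vadd (a b : Coord n) : dd (a + b) f x = dd a f x + dd b f x := by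
  unfold dd
  simp

theorem dd_vsub (a b : Coord n) : dd (a - b) f x = dd a f x - dd b f x := by
  unfold dd
  simp

theorem dd_vsmul (r : ℝ) (a : Coord n) : dd (r • a) f x = r * dd a f x := by
  unfold dd
  simp

theorem smooth_dd (hf : ContDiffAt ℝ ∞ f x) : ContDiffAt ℝ ∞ (dd v f) x := by
  unfold dd
  exact (hf.fderiv_right (m := ∞) (by simp)).clm_apply contDiffAt_const

theorem dd_comm (hf : ContDiffAt ℝ ∞ f x) (a b : Coord n) :
    dd b (dd a f) x = dd a (dd b f) x := by
  have h1 : DifferentiableAt ℝ (fderiv ℝ f) x :=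
    (hf.fderiv_right (m := ∞) (by simp)).differentiableAt (by simp)
  have h2 : IsSymmSndFDerivAt ℝ f x := hf.isSymmSndFDerivAt
    (by rw [minSmoothness_of_isRCLikeNormedField]; exact WithTop.coe_le_coe.2 le_top)
  have key : ∀ a b : Coord n, dd b (dd a f) x = fderiv ℝ (fderiv ℝ f) x b a := by
    intro a b
    unfold dd
    rw [fderiv_clm_apply h1 (differentiableAt_const a)]
    simp
  rw [key, key]
  exact h2 b a

theorem smoothVec_grad (hf : ContDiffAt ℝ ∞ f x) : SmoothVec (grad f) x :=
  fun _ => smooth_dd hf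

theorem smooth_dot (ha : SmoothVec a x) (hb : SmoothVec b x) :
    ContDiffAt ℝ ∞ (fun y => a y ⬝ᵥ b y) x := by
  unfold dotProduct
  exact ContDiffAt.sum fun i _ => (ha i).mul (hb i)

theorem smoothVec_const (c : Coord n) : SmoothVec (fun _ => c) x := fun _ => contDiffAt_const

theorem smoothMat_const (c : Matrix (Fin n) (Fin n) ℝ) : SmoothMat (fun _ => c) x :=
  fun _ _ => contDiffAt_const

theorem smoothVec_mulVec (hA : SmoothMat A x) (hb : SmoothVec b x) :
    SmoothVec (fun y => A y *ᵥ b y) x := fun i => by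
  simp only [Matrix.mulVec, dotProduct]
  exact ContDiffAt.sum fun j _ => (hA i j).mul (hb j)

theorem smoothMat_mul (hA : SmoothMat A x) (hB : SmoothMat B x) :
    SmoothMat (fun y => A y * B y) x := fun i j => by
  simp only [Matrix.mul_apply]
  exact ContDiffAt.sum fun k _ => (hA i k).mul (hB k j)

theorem smoothMat_add (hA : SmoothMat A x) (hB : SmoothMat B x) :
    SmoothMat (fun y => A y + B y) x := fun i j => (hA i j).add (hB i j)

theorem smoothMat_sub (hA : SmoothMat A x) (hB : SmoothMat B x) :
    SmoothMat (fun y => A y - B y) x := fun i j => (hA i j).sub (hB i j)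

theorem smoothMat_smul (hf : ContDiffAt ℝ ∞ f x) (hA : SmoothMat A x) :
    SmoothMat (fun y => f y • A y) x := fun i j => hf.mul (hA i j)

theorem smoothVec_smul (hf : ContDiffAt ℝ ∞ f x) (ha : SmoothVec a x) :
    SmoothVec (fun y => f y • a y) x := fun i => hf.mul (ha i)

theorem smoothVec_add (ha : SmoothVec a x) (hb : SmoothVec b x) :
    SmoothVec (fun y => a y + b y) x := fun i => (ha i).add (hb i)

theorem smoothVec_sub (ha : SmoothVec a x) (hb : SmoothVec b x) :
    SmoothVec (fun y => a y - b y) x := fun i => (ha i).sub (hb i)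

theorem smoothMat_transpose (hA : SmoothMat A x) : SmoothMat (fun y => (A y)ᵀ) x :=
  fun i j => hA j i

theorem smoothMat_mdd (hA : SmoothMat A x) : SmoothMat (mdd v A) x := fun i j => smooth_dd (hA i j)

theorem dd_dot (ha : SmoothVec a x) (hb : SmoothVec b x) :
    dd v (fun y => a y ⬝ᵥ b y) x = vdd v a x ⬝ᵥ b x + a x ⬝ᵥ vdd v b x := by
  simp only [dotProduct, vdd]
  rw [dd_sum _ fun i _ => (ha i).mul (hb i), ← Finset.sum_add_distrib]
  exact Finset.sum_congr rfl fun i _ => dd_mul (ha i) (hb i)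

theorem vdd_const (c : Coord n) : vdd v (fun _ => c) x = 0 := by
  ext i
  exact dd_const _

theorem mdd_const (c : Matrix (Fin n) (Fin n) ℝ) : mdd v (fun _ => c) x = 0 := by
  ext i j
  exact dd_const _

theorem vdd_mulVec (hA : SmoothMat A x) (hb : SmoothVec b x) :
    vdd v (fun y => A y *ᵥ b y) x = mdd v A x *ᵥ b x + A x *ᵥ vdd v b x := by
  ext i
  exact dd_dot (a := fun y => A y i) (hA i) hb

theorem mdd_mul (hA : SmoothMat A x) (hB : SmoothMat B x) :
    mdd v (fun y => A y * B y) x = mdd v A x * B x + A x * mdd v B x := by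
  ext i j
  exact dd_dot (a := fun y => A y i) (b := fun y k => B y k j) (hA i) (fun k => hB k j)

theorem mdd_add (hA : SmoothMat A x) (hB : SmoothMat B x) :
    mdd v (fun y => A y + B y) x = mdd v A x + mdd v B x := by
  ext i j
  exact dd_add (hA i j) (hB i j)

theorem mdd_sub (hA : SmoothMat A x) (hB : SmoothMat B x) :
    mdd v (fun y => A y - B y) x = mdd v A x - mdd v B x := by
  ext i j
  exact dd_sub (hA i j) (hB i j)

theorem mdd_smul (hf : ContDiffAt ℝ ∞ f x) (hA : SmoothMat A x) :
    mdd v (fun y => f y • A y) x = dd v f x • A x + f x • mdd v A x := by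
  ext i j
  exact dd_mul hf (hA i j)

theorem vdd_smul (hf : ContDiffAt ℝ ∞ f x) (ha : SmoothVec a x) :
    vdd v (fun y => f y • a y) x = dd v f x • a x + f x • vdd v a x := by
  ext i
  exact dd_mul hf (ha i)

theorem vdd_add (ha : SmoothVec a x) (hb : SmoothVec b x) :
    vdd v (fun y => a y + b y) x = vdd v a x + vdd v b x := by
  ext i
  exact dd_add (ha i) (hb i)

theorem mdd_transpose : mdd v (fun y => (A y)ᵀ) x = (mdd v A x)ᵀ := rfl

theorem mdd_congr (h : A =ᶠ[𝓝 x] B) : mdd v A x = mdd v B x := by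
  ext i j
  exact dd_congr (h.mono fun y hy => by simp only [hy])

theorem vdd_congr (h : a =ᶠ[𝓝 x] b) : vdd v a x = vdd v b x := by
  ext i
  exact dd_congr (h.mono fun y hy => by simp only [hy])

theorem mdd_comm (hA : SmoothMat A x) (v w : Coord n) :
    mdd w (mdd v A) x = mdd v (mdd w A) x := by
  ext i j
  exact dd_comm (hA i j) v w

theorem vdd_comm (ha : SmoothVec a x) (v w : Coord n) :
    vdd w (vdd v a) x = vdd v (vdd w a) x := by
  ext i
  exact dd_comm (ha i) v w

theorem vdd_grad (hf : ContDiffAt ℝ ∞ f x) (c v : Coord n) :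
    c ⬝ᵥ vdd v (grad f) x = dd v (dd c f) x := by
  have h1 : dd c f = fun y => c ⬝ᵥ grad f y := by
    ext y
    exact dd_eq_sum c f y
  rw [h1, dd_dot (smoothVec_const c) (smoothVec_grad hf), vdd_const, zero_dotProduct, zero_add]

theorem smooth_det (hA : SmoothMat A x) : ContDiffAt ℝ ∞ (fun y => (A y).det) x := by
  simp only [Matrix.det_apply]
  refine ContDiffAt.sum fun σ _ => ?_
  exact (contDiffAt_prod fun i _ => hA _ _).const_smul _

theorem smoothMat_inv (hA : SmoothMat A x) (hdet : (A x).det ≠ 0) :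
    SmoothMat (fun y => (A y)⁻¹) x := by
  intro i j
  simp only [Matrix.inv_def, Ring.inverse_eq_inv', Matrix.smul_apply, smul_eq_mul,
    Matrix.adjugate_apply]
  refine ((smooth_det hA).inv hdet).mul (smooth_det ?_)
  intro k l
  simp only [Matrix.updateRow_apply]
  split_ifs
  · exact contDiffAt_const
  · exact hA k l

/-- Derivative of the inverse of a matrix field. -/
theorem mdd_inv (hA : SmoothMat A x) (hdet : ∀ᶠ y in 𝓝 x, (A y).det ≠ 0) :
    mdd v (fun y => (A y)⁻¹) x = -((A x)⁻¹ * mdd v A x * (A x)⁻¹) := by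
  have hi := smoothMat_inv hA hdet.self_of_nhds
  have hx : IsUnit (A x).det := isUnit_iff_ne_zero.2 hdet.self_of_nhds
  have h1 : mdd v (fun y => A y * (A y)⁻¹) x = 0 := by
    rw [mdd_congr (B := fun _ => 1), mdd_const]
    exact hdet.mono fun y hy => Matrix.mul_nonsing_inv _ (isUnit_iff_ne_zero.2 hy)
  rw [mdd_mul hA hi] at h1
  have h2 : (A x)⁻¹ * (mdd v A x * (A x)⁻¹ + A x * mdd v (fun y => (A y)⁻¹) x) = 0 := by
    rw [h1, mul_zero]
  rw [mul_add, ← mul_assoc, ← mul_assoc, Matrix.nonsing_inv_mul _ hx, one_mul] at h2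
  exact eq_neg_of_add_eq_zero_right h2

end Calculus

/-! ### Unique continuation for closed first-order linear systems -/

section UniqueContinuation

variable {n : ℕ}

/-- Grönwall's inequality along the segments issuing from `x` inside a small ball. -/
theorem eventually_eq_zero_of_deriv_bound {ι : Type*} [Fintype ι] {f : ι → Coord n → ℝ}
    {x : Coord n} {C : ℝ} (hf : ∀ᶠ y in 𝓝 x, ∀ i, DifferentiableAt ℝ (f i) y)
    (h : ∀ᶠ y in 𝓝 x, ∀ a i, |pd a (f i) y| ≤ C * ‖fun j => f j y‖)
    (h0 : ∀ i, f i x = 0) : ∀ᶠ y in 𝓝 x, ∀ i, f i y = 0 := by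
  obtain ⟨r, hr, hball⟩ := Metric.eventually_nhds_iff_ball.1 (hf.and h)
  refine Metric.eventually_nhds_iff_ball.2 ⟨r, hr, fun y hy => ?_⟩
  have hseg : ∀ s ∈ Set.Icc (0 : ℝ) 1, x + s • (y - x) ∈ Metric.ball x r := by
    intro s hs
    rw [Metric.mem_ball, dist_eq_norm] at hy ⊢
    rw [add_sub_cancel_left, norm_smul, Real.norm_eq_abs, abs_of_nonneg hs.1]
    exact lt_of_le_of_lt (mul_le_of_le_one_left (norm_nonneg _) hs.2) hy
  have hder : ∀ s ∈ Set.Icc (0 : ℝ) 1, HasDerivAt (fun s : ℝ => fun i => f i (x + s • (y - x)))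
      (fun i => dd (y - x) (f i) (x + s • (y - x))) s := by
    intro s hs
    rw [hasDerivAt_pi]
    intro i
    have h1 : HasDerivAt (fun s : ℝ => x + s • (y - x)) (y - x) s := by
      simpa using ((hasDerivAt_id s).smul_const (y - x)).const_add x
    exact ((hball _ (hseg s hs)).1 i).hasFDerivAt.comp_hasDerivAt s h1
  have key := eq_zero_of_abs_deriv_le_mul_abs_self_of_eq_zero_right
    (f := fun s : ℝ => fun i => f i (x + s • (y - x)))
    (f' := fun s : ℝ => fun i => dd (y - x) (f i) (x + s • (y - x)))
    -- The derivative along the segment is ∑ₐ (y - x)ₐ ∂ₐ f, whence this Lipschitz constant.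
    (K := (∑ a, |(y - x) a|) * C) (a := 0) (b := 1)
    (fun s hs => (hder s hs).continuousAt.continuousWithinAt)
    (fun s hs => (hder s (Set.Ico_subset_Icc_self hs)).hasDerivWithinAt)
    (by ext i; simp [h0]) ?_ 1 (by simp)
  · intro i
    have := congrFun key i
    simpa using this
  · intro s hs
    have hs' := Set.Ico_subset_Icc_self hs
    by_cases hι : Nonempty ι
    · refine (pi_norm_le_iff_of_nonempty _).2 fun i => ?_
      rw [dd_eq_sum, Real.norm_eq_abs, dotProduct, Finset.sum_mul, Finset.sum_mul]
      refine (Finset.abs_sum_le_sum_abs _ _).trans (Finset.sum_le_sum fun a _ => ?_)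
      rw [abs_mul, mul_assoc]
      exact mul_le_mul_of_nonneg_left ((hball _ (hseg s hs')).2 a i) (abs_nonneg _)
    · rw [not_nonempty_iff] at hι
      simp [Subsingleton.elim _ (0 : ι → ℝ)]

/-- The interior of the common zero set is nonempty by the local statement. It is also closed
relative to `U`: a limit point in `U` is a zero by continuity, hence has a neighbourhood of zeros.
Connectedness finishes. -/
theorem eq_zero_of_deriv_bound {ι : Type*} [Fintype ι] {U : Set (Coord n)} (hU : IsOpen U)
    (hUc : IsConnected U) {f : ι → Coord n → ℝ}
    (hf : ∀ i, ∀ x ∈ U, DifferentiableAt ℝ (f i) x)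
    (h : ∀ x ∈ U, ∃ C, ∀ᶠ y in 𝓝 x, ∀ a i, |pd a (f i) y| ≤ C * ‖fun j => f j y‖)
    {x₀ : Coord n} (hx₀ : x₀ ∈ U) (h0 : ∀ i, f i x₀ = 0) : ∀ x ∈ U, ∀ i, f i x = 0 := by
  have hloc : ∀ x ∈ U, (∀ i, f i x = 0) → ∀ᶠ y in 𝓝 x, ∀ i, f i y = 0 := by
    intro x hx hx0
    obtain ⟨C, hC⟩ := h x hx
    exact eventually_eq_zero_of_deriv_bound
      ((hU.eventually_mem hx).mono fun y hy i => hf i y hy) hC hx0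
  have hsub : U ⊆ interior {x | ∀ i, f i x = 0} := by
    refine hUc.isPreconnected.subset_of_closure_inter_subset isOpen_interior
      ⟨x₀, hx₀, mem_interior_iff_mem_nhds.2 (hloc x₀ hx₀ h0)⟩ ?_
    rintro x ⟨hxc, hxU⟩
    refine mem_interior_iff_mem_nhds.2 (hloc x hxU fun i => ?_)
    by_contra hne
    have hne' : ∀ᶠ y in 𝓝 x, f i y ≠ 0 := (hf i x hxU).continuousAt.eventually_ne hne
    obtain ⟨y, hy1, hy2⟩ := mem_closure_iff_nhds.1 hxc _ hne'
    exact hy1 (interior_subset hy2 i)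
  exact fun x hx => interior_subset (hsub hx)

/-- A solution of a closed first-order linear system on a connected domain vanishes identically
if it vanishes at a point. -/
theorem eq_zero_of_linear_system {ι : Type*} [Fintype ι] {U : Set (Coord n)} (hU : IsOpen U)
    (hUc : IsConnected U) {f : ι → Coord n → ℝ}
    (hf : ∀ i, ∀ x ∈ U, DifferentiableAt ℝ (f i) x) (M : Fin n → ι → ι → Coord n → ℝ)
    (hM : ∀ a i j, ∀ x ∈ U, ContinuousAt (M a i j) x)
    (h : ∀ x ∈ U, ∀ a i, pd a (f i) x = ∑ j, M a i j x * f j x)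
    {x₀ : Coord n} (hx₀ : x₀ ∈ U) (h0 : ∀ i, f i x₀ = 0) : ∀ x ∈ U, ∀ i, f i x = 0 := by
  refine eq_zero_of_deriv_bound hU hUc hf (fun x hx => ?_) hx₀ h0
  -- By continuity each coefficient grows by at most 1 near `x`; the full sum dominates every row
  -- sum, so one constant serves all rows.
  refine ⟨∑ a, ∑ i, ∑ j, (|M a i j x| + 1), ?_⟩
  have h1 : ∀ᶠ y in 𝓝 x, ∀ a i j, |M a i j y| ≤ |M a i j x| + 1 := by
    simp only [eventually_all]
    intro a i j
    exact ((hM a i j x hx).abs.eventually (eventually_le_nhds (lt_add_one _)))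
  filter_upwards [h1, hU.eventually_mem hx] with y hy hyU a i
  rw [h y hyU]
  refine (Finset.abs_sum_le_sum_abs _ _).trans ?_
  have h2 : ∑ j, |M a i j y * f j y| ≤ (∑ j, (|M a i j x| + 1)) * ‖fun j => f j y‖ := by
    rw [Finset.sum_mul]
    refine Finset.sum_le_sum fun j _ => ?_
    rw [abs_mul]
    exact mul_le_mul (hy a i j) (norm_le_pi_norm (fun j => f j y) j) (abs_nonneg _)
      (by positivity)
  refine h2.trans (mul_le_mul_of_nonneg_right ?_ (norm_nonneg _))
  refine le_trans ?_ (Finset.single_le_sum (f := fun a => ∑ i, ∑ j, (|M a i j x| + 1))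
    (fun _ _ => by positivity) (Finset.mem_univ a))
  exact Finset.single_le_sum (f := fun i => ∑ j, (|M a i j x| + 1))
    (fun _ _ => by positivity) (Finset.mem_univ i)

end UniqueContinuation

/-! ### Linear algebra of a nondegenerate symmetric bilinear form -/

section LinearAlgebra

variable {n : ℕ} {G : Matrix (Fin n) (Fin n) ℝ}

/-- Two linear conditions leave a nonzero solution in dimension at least 3. Much of the later use of
n ≥ 3 goes through this fact. -/
theorem exists_ne_zero_orthogonal (hn : 3 ≤ n) (p q : Coord n) :
    ∃ w : Coord n, w ≠ 0 ∧ p ⬝ᵥ w = 0 ∧ q ⬝ᵥ w = 0 := by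
  let F : Coord n →ₗ[ℝ] (Fin 2 → ℝ) := Matrix.mulVecLin (Matrix.of ![p, q])
  have hF : F.ker ≠ ⊥ := LinearMap.ker_ne_bot_of_finrank_lt (by simp; omega)
  obtain ⟨w, hw, hw0⟩ := Submodule.exists_mem_ne_zero_of_ne_bot hF
  refine ⟨w, hw0, ?_, ?_⟩
  · exact congrFun (LinearMap.mem_ker.1 hw) 0
  · exact congrFun (LinearMap.mem_ker.1 hw) 1

theorem dot_mulVec_comm (hG : G.IsSymm) (a b : Coord n) : a ⬝ᵥ G *ᵥ b = b ⬝ᵥ G *ᵥ a := by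
  rw [Matrix.dotProduct_mulVec, dotProduct_comm, ← Matrix.mulVec_transpose, hG.eq]

theorem mulVec_inv_mulVec (hdet : G.det ≠ 0) (p : Coord n) : G *ᵥ (G⁻¹ *ᵥ p) = p := by
  rw [Matrix.mulVec_mulVec, Matrix.mul_nonsing_inv _ (isUnit_iff_ne_zero.2 hdet), Matrix.one_mulVec]

theorem inv_mulVec_mulVec (hdet : G.det ≠ 0) (p : Coord n) : G⁻¹ *ᵥ (G *ᵥ p) = p := by
  rw [Matrix.mulVec_mulVec, Matrix.nonsing_inv_mul _ (isUnit_iff_ne_zero.2 hdet), Matrix.one_mulVec]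

theorem eq_zero_of_mulVec_eq_zero (hdet : G.det ≠ 0) {w : Coord n} (h : G *ᵥ w = 0) : w = 0 := by
  rw [← inv_mulVec_mulVec hdet w, h, Matrix.mulVec_zero]

/-- A bilinear form vanishing on all orthogonal pairs is a multiple of the metric. -/
theorem exists_smul_of_orthogonal (hdet : G.det ≠ 0) {β : Matrix (Fin n) (Fin n) ℝ}
    (h : ∀ a k : Coord n, a ⬝ᵥ G *ᵥ k = 0 → a ⬝ᵥ β *ᵥ k = 0) : ∃ r : ℝ, β = r • G := by
  have h1 : ∀ a p : Coord n, a ⬝ᵥ p = 0 → a ⬝ᵥ (β * G⁻¹) *ᵥ p = 0 := by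
    intro a p hap
    rw [← Matrix.mulVec_mulVec]
    exact h a _ (by rwa [mulVec_inv_mulVec hdet])
  have hoff : ∀ i j, i ≠ j → (β * G⁻¹) i j = 0 := by
    intro i j hij
    have := h1 (Pi.single i 1) (Pi.single j 1) (by simp [hij])
    simpa using this
  have hdiag : ∀ i j, (β * G⁻¹) i i = (β * G⁻¹) j j := by
    intro i j
    by_cases hij : i = j
    · rw [hij]
    -- The pair e_i - e_j, e_i + e_j annihilates under the standard pairing; once the off-diagonal
    -- entries vanish, it compares the two diagonal entries.
    have := h1 (Pi.single i 1 - Pi.single j 1) (Pi.single i 1 + Pi.single j 1)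
      (by simp [hij, Ne.symm hij])
    simp only [Matrix.mulVec_add, sub_dotProduct, dotProduct_add, single_one_dotProduct,
      Matrix.mulVec_single_one, Matrix.col_apply] at this
    rw [hoff i j hij, hoff j i (Ne.symm hij)] at this
    linarith
  have key : ∃ r : ℝ, β * G⁻¹ = r • (1 : Matrix (Fin n) (Fin n) ℝ) := by
    rcases isEmpty_or_nonempty (Fin n) with he | ⟨⟨i₀⟩⟩
    · exact ⟨0, Subsingleton.elim _ _⟩
    · refine ⟨(β * G⁻¹) i₀ i₀, ?_⟩
      ext i j
      by_cases hij : i = j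
      · subst hij
        simpa using hdiag i i₀
      · simp [hoff i j hij, hij]
  obtain ⟨r, hr⟩ := key
  refine ⟨r, ?_⟩
  rw [← Matrix.mul_one β, ← Matrix.nonsing_inv_mul G (isUnit_iff_ne_zero.2 hdet), ← mul_assoc, hr]
  simp

/-- The hypothesis is the shape in which curvature-type conditions arrive. Choose c ≠ 0 orthogonal
to k with c_i = 0 at an index where a_i ≠ 0. The i-th component gives β c k = 0, and then β a k • c
= 0. -/
theorem orthogonal_of_smul_eq (hn : 3 ≤ n) {β : Coord n → Coord n → ℝ}
    (h : ∀ k a c : Coord n, a ⬝ᵥ G *ᵥ k = 0 → c ⬝ᵥ G *ᵥ k = 0 → β a k • c = β c k • a)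
    (h0 : ∀ k, β 0 k = 0) {a k : Coord n} (hak : a ⬝ᵥ G *ᵥ k = 0) : β a k = 0 := by
  by_cases ha : a = 0
  · rw [ha, h0]
  obtain ⟨i, hi⟩ := Function.ne_iff.1 ha
  obtain ⟨c, hc0, hc1, hc2⟩ := exists_ne_zero_orthogonal hn (G *ᵥ k) (Pi.single i 1)
  have h1 := h k a c hak (by rwa [dotProduct_comm])
  have h2 : β c k = 0 := by
    have := congrFun h1 i
    simp only [single_one_dotProduct] at hc2
    simp only [Pi.smul_apply, smul_eq_mul, hc2, mul_zero] at this
    exact (mul_eq_zero.1 this.symm).resolve_right hi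
  rw [h2, zero_smul] at h1
  exact (smul_eq_zero.1 h1).resolve_right hc0

theorem eq_zero_of_symm_vecMulVec {y k : Coord n} (hk : k ≠ 0)
    (h : Matrix.vecMulVec y k + Matrix.vecMulVec k y = 0) : y = 0 := by
  obtain ⟨i, hi⟩ := Function.ne_iff.1 hk
  have hyi : y i = 0 := by
    have := congrFun (congrFun h i) i
    simp only [Matrix.add_apply, Matrix.vecMulVec_apply, Matrix.zero_apply] at this
    have h2 : y i * k i = 0 := by linarith
    exact (mul_eq_zero.1 h2).resolve_right hi
  ext j
  have := congrFun (congrFun h j) i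
  simp only [Matrix.add_apply, Matrix.vecMulVec_apply, Matrix.zero_apply, hyi, mul_zero,
    add_zero] at this
  exact (mul_eq_zero.1 this).resolve_right hi

/-- If the hyperplane ker u were totally null, a nonzero vector of ker u orthogonal to a
complementary vector e₀ would be orthogonal to everything, contradicting nondegeneracy. -/
theorem exists_nonnull_in_kernel (hn : 3 ≤ n) (hG : G.IsSymm) (hdet : G.det ≠ 0)
    (u : Coord n →ₗ[ℝ] ℝ) : ∃ v, u v = 0 ∧ v ⬝ᵥ G *ᵥ v ≠ 0 := by
  by_contra! hcon
  have hbil : ∀ v w, u v = 0 → u w = 0 → v ⬝ᵥ G *ᵥ w = 0 := by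
    intro v w hv hw
    have h1 := hcon (v + w) (by rw [map_add, hv, hw, add_zero])
    simp only [Matrix.mulVec_add, add_dotProduct, dotProduct_add, hcon v hv, hcon w hw,
      dot_mulVec_comm hG w v] at h1
    linarith
  by_cases hu : u = 0
  · obtain ⟨w, hw0, -⟩ := exists_ne_zero_orthogonal hn (0 : Coord n) 0
    refine hw0 (eq_zero_of_mulVec_eq_zero hdet ?_)
    ext i
    have := hbil (Pi.single i 1) w (by simp [hu]) (by simp [hu])
    simpa using this
  obtain ⟨e₀, he₀⟩ : ∃ e, u e ≠ 0 := by
    by_contra! hc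
    exact hu (LinearMap.ext hc)
  obtain ⟨w, hw0, hw1, hw2⟩ := exists_ne_zero_orthogonal hn (fun i => u (Pi.single i 1)) (G *ᵥ e₀)
  have huw : u w = 0 := by
    rw [← hw1]
    conv_lhs => rw [pi_eq_sum_univ' w, map_sum]
    simp only [map_smul, smul_eq_mul, dotProduct]
    refine Finset.sum_congr rfl fun i _ => ?_
    rw [mul_comm]
  refine hw0 (eq_zero_of_mulVec_eq_zero hdet ?_)
  ext i
  set x : Coord n := Pi.single i 1 with hx
  have h1 := hbil (x - (u x / u e₀) • e₀) w (by simp [he₀]) huw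
  have h2 : e₀ ⬝ᵥ G *ᵥ w = 0 := by rw [dot_mulVec_comm hG, dotProduct_comm, hw2]
  rw [sub_dotProduct, smul_dotProduct, h2, smul_zero, sub_zero, hx, single_one_dotProduct] at h1
  exact h1

end LinearAlgebra

/-! ### Divisibility of cubic forms by a quadratic form -/

section CubicForms

variable {n : ℕ}

/-- Real polynomials form an integral domain, and the first factor is a nonzero polynomial. -/
theorem const_coeff_eq_zero {a b c a' b' c' : ℝ} (hc : c ≠ 0)
    (h : ∀ s : ℝ, (a + b * s + c * s ^ 2) * (a' + b' * s + c' * s ^ 2) = 0) : a' = 0 := by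
  have hp : (Polynomial.C a + Polynomial.C b * Polynomial.X + Polynomial.C c * Polynomial.X ^ 2) *
      (Polynomial.C a' + Polynomial.C b' * Polynomial.X + Polynomial.C c' * Polynomial.X ^ 2)
      = 0 := by
    refine Polynomial.funext fun s => ?_
    simpa using h s
  rcases mul_eq_zero.1 hp with h1 | h1
  · exfalso
    apply hc
    have := congrArg (fun p => Polynomial.coeff p 2) h1
    simpa [Polynomial.coeff_X, Polynomial.coeff_C] using this
  · have := congrArg (Polynomial.eval 0) h1
    simpa using this

/-- The symmetric product of a linear form and a trace-free symmetric cubic form is divisible by a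
nondegenerate quadratic form only if one of the factors vanishes. -/
theorem cubic_eq_zero_of_mul_eq {G : Matrix (Fin n) (Fin n) ℝ} (hn : 3 ≤ n) (hG : G.IsSymm)
    (hdet : G.det ≠ 0) {S : Coord n →ₗ[ℝ] Coord n →ₗ[ℝ] Coord n →ₗ[ℝ] ℝ}
    (h12 : ∀ x y z, S x y z = S y x z) (h23 : ∀ x y z, S x y z = S x z y)
    (htr : ∀ z, ∑ b, S (Pi.single b 1) (G⁻¹ *ᵥ Pi.single b 1) z = 0)
    {u : Coord n →ₗ[ℝ] ℝ} (hu : u ≠ 0) {H : Coord n →ₗ[ℝ] Coord n →ₗ[ℝ] ℝ}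
    (h : ∀ v, u v * S v v v = (v ⬝ᵥ G *ᵥ v) * H v v) (x y z : Coord n) : S x y z = 0 := by
  obtain ⟨v₀, hv₀, hq₀⟩ := exists_nonnull_in_kernel hn hG hdet u
  -- On ker u the product of the metric and H vanishes. Restricted to the line w + s v₀ with v₀ ∈
  -- ker u non-null, the metric is a nonzero polynomial in s, so H vanishes there.
  have hker : ∀ w, u w = 0 → H w w = 0 := by
    intro w hw
    refine const_coeff_eq_zero (a := w ⬝ᵥ G *ᵥ w) (b := 2 * (w ⬝ᵥ G *ᵥ v₀))
      (b' := H w v₀ + H v₀ w) (c' := H v₀ v₀) hq₀ fun s => ?_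
    have := h (w + s • v₀)
    simp only [map_add, map_smul, hw, hv₀, Matrix.mulVec_add, Matrix.mulVec_smul, add_dotProduct,
      dotProduct_add, smul_dotProduct, dotProduct_smul, smul_eq_mul, LinearMap.add_apply,
      LinearMap.smul_apply, mul_zero, add_zero, zero_mul, dot_mulVec_comm hG v₀ w] at this
    linear_combination -this
  obtain ⟨e, he⟩ : ∃ e, u e = 1 := by
    obtain ⟨e₀, he₀⟩ : ∃ e, u e ≠ 0 := by
      by_contra! hc
      exact hu (LinearMap.ext hc)
    exact ⟨(u e₀)⁻¹ • e₀, by simp [he₀]⟩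
  let m : Coord n →ₗ[ℝ] ℝ := H.flip e + H e - (H e e) • u
  have hm : ∀ v, m v = H v e + H e v - H e e * u v := fun v => rfl
  have hH : ∀ v, H v v = u v * m v := by
    intro v
    have := hker (v - u v • e) (by simp [he])
    simp only [map_sub, map_smul, LinearMap.sub_apply, LinearMap.smul_apply, smul_eq_mul] at this
    rw [hm]
    linear_combination this
  have hS1 : ∀ v, u v * (S v v v - (v ⬝ᵥ G *ᵥ v) * m v) = 0 := by
    intro v
    have := h v
    rw [hH] at this
    linear_combination this
  have hS2 : ∀ v, S v v v = (v ⬝ᵥ G *ᵥ v) * m v := by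
    intro v
    by_cases huv : u v = 0
    · have h1 := fun s : ℝ => hS1 (v + s • e)
      have hP : ∀ s : ℝ, s ≠ 0 → S (v + s • e) (v + s • e) (v + s • e) -
          ((v + s • e) ⬝ᵥ G *ᵥ (v + s • e)) * m (v + s • e) = 0 := by
        intro s hs
        have := h1 s
        rw [map_add, map_smul, huv, he] at this
        simpa [hs] using this
      have p1 := hP 1 (by norm_num)
      have p2 := hP (-1) (by norm_num)
      have p3 := hP 2 (by norm_num)
      have p4 := hP (-2) (by norm_num)
      -- Where u(v) = 0, cancellation of u is justified along v + s e: a cubic polynomial P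
      -- satisfies 6 P(0) = 4 P(1) + 4 P(-1) - P(2) - P(-2), and P vanishes for s ≠ 0.
      simp only [map_add, map_smul, Matrix.mulVec_add, Matrix.mulVec_smul, add_dotProduct,
        dotProduct_add, smul_dotProduct, dotProduct_smul, smul_eq_mul, LinearMap.add_apply,
        LinearMap.smul_apply] at p1 p2 p3 p4
      linear_combination (4 * p1 + 4 * p2 - p3 - p4) / 6
    · have := (mul_eq_zero.1 (hS1 v)).resolve_left huv
      linarith
  let g : Coord n →ₗ[ℝ] Coord n →ₗ[ℝ] ℝ := Matrix.toLinearMap₂' ℝ G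
  have hg : ∀ x y, g x y = x ⬝ᵥ G *ᵥ y := fun x y => Matrix.toLinearMap₂'_apply' _ _ _
  have hpol : ∀ x y z, S x y z =
      (1 / 3) * (g x y * m z + g y z * m x + g x z * m y) := by
    intro x y z
    have e1 := hS2 (x + y + z)
    have e2 := hS2 (x + y)
    have e3 := hS2 (x + z)
    have e4 := hS2 (y + z)
    have e5 := hS2 x
    have e6 := hS2 y
    have e7 := hS2 z
    simp only [← hg] at e1 e2 e3 e4 e5 e6 e7
    have hgs : ∀ x y, g x y = g y x := fun x y => by rw [hg, hg, dot_mulVec_comm hG]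
    simp only [map_add, LinearMap.add_apply] at e1 e2 e3 e4
    rw [h12 y x z, h23 y z x, h12 y x z, h23 x z y, h12 z x y, h23 x z y, h23 z y x, h12 z x y,
      h23 x z y] at e1
    rw [hgs y x, hgs z x, hgs z y] at e1
    rw [hgs y x] at e2
    rw [hgs z x] at e3
    rw [hgs z y] at e4
    linear_combination (e1 - e2 - e3 - e4 + e5 + e6 + e7) / 6
  -- The trace of the symmetric product of the metric with m is, up to the factor 1/3, (n + 2) m, so
  -- trace-freeness kills m.
  have hm0 : ∀ z, m z = 0 := by
    intro z
    have h1 := htr z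
    simp only [hpol, ← Finset.mul_sum, Finset.sum_add_distrib] at h1
    have hE : ∀ (b : Fin n) (w : Coord n), g w (G⁻¹ *ᵥ Pi.single b 1) = w b := by
      intro b w
      rw [hg, mulVec_inv_mulVec hdet, dotProduct_single_one]
    have s1 : ∑ b, g (Pi.single b 1) (G⁻¹ *ᵥ Pi.single b 1) * m z = n * m z := by
      simp only [hE, Pi.single_eq_same, one_mul, Finset.sum_const, Finset.card_univ,
        Fintype.card_fin, nsmul_eq_mul]
    have s2 : ∑ b, g (G⁻¹ *ᵥ Pi.single b 1) z * m (Pi.single b 1) = m z := by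
      conv_rhs => rw [pi_eq_sum_univ' z, map_sum]
      refine Finset.sum_congr rfl fun b _ => ?_
      rw [hg, dot_mulVec_comm hG, ← hg, hE, map_smul, smul_eq_mul]
    have s3 : ∑ b, g (Pi.single b 1) z * m (G⁻¹ *ᵥ Pi.single b 1) = m z := by
      conv_rhs => rw [← inv_mulVec_mulVec hdet z, pi_eq_sum_univ' (G *ᵥ z), Matrix.mulVec_sum,
        map_sum]
      refine Finset.sum_congr rfl fun b _ => ?_
      rw [hg, single_one_dotProduct, Matrix.mulVec_smul, map_smul, smul_eq_mul]
    rw [s1, s2, s3] at h1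
    have h2 : ((n : ℝ) + 2) * m z = 0 := by linarith
    have h3 : (n : ℝ) + 2 ≠ 0 := by positivity
    exact (mul_eq_zero.1 h2).resolve_left h3
  rw [hpol]
  simp [hm0]

/-- This is the derivative in the direction e of the polynomial identity `hdiv` in v, taken at z =
E. -/
theorem linear_coeff_of_cubic_identity {S : Coord n →ₗ[ℝ] Coord n →ₗ[ℝ] Coord n →ₗ[ℝ] ℝ}
    (h12 : ∀ x y z, S x y z = S y x z) (h23 : ∀ x y z, S x y z = S x z y)
    {u : Coord n →ₗ[ℝ] ℝ} {f g : Coord n →ₗ[ℝ] Coord n →ₗ[ℝ] ℝ} (hgs : ∀ x y, g x y = g y x)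
    (hdiv : ∀ z v, g v v * (3 * u v * S z v v + u z * S v v v + g v v * f z v) =
      g z v * (4 * u v * S v v v + g v v * f v v)) (e E v : Coord n) :
    2 * (g v e * (3 * u v * S v v E + u E * S v v v + g v v * f E v))
        + g v v * (3 * u e * S v v E + 6 * u v * S e E v
        + 3 * u E * S v v e + 2 * (g v e * f E v) + g v v * f E e) =
      (4 * u v * S v v v + g v v * f v v) * g E e + g E v * (4 * u e * S v v v
        + 12 * u v * S v v e + 2 * g v e * f v v + g v v * (f v e + f e v)) := by
  have p := fun s : ℝ => hdiv E (v + s • e)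
  have p1 := p 1
  have p2 := p (-1)
  have p3 := p 2
  have p4 := p (-2)
  have p5 := p 3
  have p6 := p (-3)
  clear p hdiv
  simp only [map_add, map_smul, LinearMap.add_apply, LinearMap.smul_apply, smul_eq_mul]
    at p1 p2 p3 p4 p5 p6
  rw [h12 e v v, h23 v e v, h12 e v e, h23 v e e, hgs e v,
    h12 E v v, h23 v E v, h12 E v e, h12 E e v] at p1 p2 p3 p4 p5 p6
  rw [h23 v E e, h12 v e E, h23 e v E] at p1 p2 p3 p4 p5 p6
  -- The identity has degree 5 in s. These central-difference weights at ±1, ±2, ±3 extract the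
  -- coefficient of s exactly for such polynomials.
  linear_combination (3 / 4) * (p1 - p2) - (3 / 20) * (p3 - p4) + (1 / 60) * (p5 - p6)

/-- If the symmetric product of a linear form and a trace-free symmetric cubic form is, on
orthogonal pairs, a multiple of the metric, then one of the factors vanishes. -/
theorem cubic_eq_zero_of_orthogonal {G : Matrix (Fin n) (Fin n) ℝ} (hn : 3 ≤ n) (hG : G.IsSymm)
    (hdet : G.det ≠ 0) {S : Coord n →ₗ[ℝ] Coord n →ₗ[ℝ] Coord n →ₗ[ℝ] ℝ}
    (h12 : ∀ x y z, S x y z = S y x z) (h23 : ∀ x y z, S x y z = S x z y)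
    (htr : ∀ z, ∑ b, S (Pi.single b 1) (G⁻¹ *ᵥ Pi.single b 1) z = 0)
    {u : Coord n →ₗ[ℝ] ℝ} (hu : u ≠ 0) {f : Coord n →ₗ[ℝ] Coord n →ₗ[ℝ] ℝ}
    (h : ∀ z v, z ⬝ᵥ G *ᵥ v = 0 →
      3 * u v * S z v v + u z * S v v v + (v ⬝ᵥ G *ᵥ v) * f z v = 0) (x y z : Coord n) :
    S x y z = 0 := by
  let g : Coord n →ₗ[ℝ] Coord n →ₗ[ℝ] ℝ := Matrix.toLinearMap₂' ℝ G
  have hg : ∀ x y, g x y = x ⬝ᵥ G *ᵥ y := fun x y => Matrix.toLinearMap₂'_apply' _ _ _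
  have hgs : ∀ x y, g x y = g y x := fun x y => by rw [hg, hg, dot_mulVec_comm hG]
  simp only [← hg] at h
  set e : Fin n → Coord n := fun b => Pi.single b 1 with he
  set E : Fin n → Coord n := fun b => G⁻¹ *ᵥ Pi.single b 1 with hE
  have hgE : ∀ b w, g w (E b) = w b := by
    intro b w
    rw [hg, hE, mulVec_inv_mulVec hdet, dotProduct_single_one]
  have hsum : ∀ (F : Coord n →ₗ[ℝ] ℝ) (w : Coord n), ∑ b, w b * F (e b) = F w := by
    intro F w
    conv_rhs => rw [pi_eq_sum_univ' w, map_sum]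
    simp only [he, map_smul, smul_eq_mul]
  have hsum' : ∀ (F : Coord n →ₗ[ℝ] ℝ) (w : Coord n), ∑ b, g w (e b) * F (E b) = F w := by
    intro F w
    conv_rhs => rw [← inv_mulVec_mulVec hdet w, pi_eq_sum_univ' (G *ᵥ w), Matrix.mulVec_sum,
      map_sum]
    refine Finset.sum_congr rfl fun b _ => ?_
    rw [hgs, hg, he, single_one_dotProduct, Matrix.mulVec_smul, map_smul, smul_eq_mul]
  -- Applying the hypothesis to g(v,v) z - g(z,v) v, which is orthogonal to v, removes the
  -- orthogonality condition.
  have hdiv : ∀ z v, g v v * (3 * u v * S z v v + u z * S v v v + g v v * f z v) =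
      g z v * (4 * u v * S v v v + g v v * f v v) := by
    intro z v
    have h1 := h (g v v • z - g z v • v) v (by
      simp only [map_sub, map_smul, LinearMap.sub_apply, LinearMap.smul_apply, smul_eq_mul]
      ring)
    simp only [map_sub, map_smul, LinearMap.sub_apply, LinearMap.smul_apply, smul_eq_mul] at h1
    linear_combination h1
  have hcoef : ∀ b v, 2 * (g v (e b) * (3 * u v * S v v (E b) + u (E b) * S v v v
        + g v v * f (E b) v)) + g v v * (3 * u (e b) * S v v (E b) + 6 * u v * S (e b) (E b) v
        + 3 * u (E b) * S v v (e b) + 2 * (g v (e b) * f (E b) v) + g v v * f (E b) (e b)) =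
      (4 * u v * S v v v + g v v * f v v) * (g (E b) (e b)) + v b * (4 * u (e b) * S v v v
        + 12 * u v * S v v (e b) + 2 * g v (e b) * f v v
        + g v v * (f v (e b) + f (e b) v)) := by
    intro b v
    rw [linear_coeff_of_cubic_identity h12 h23 hgs hdiv, hgs (E b) v, hgE]
  -- Taking the divergence of `hdiv`, that is, differentiating along e_b, setting z = E_b and
  -- summing over the dual bases, shows that u · S is divisible by the metric. This reduces the
  -- claim to `cubic_eq_zero_of_mul_eq`.
  have htot : ∀ v, 4 * ((n : ℝ) + 2) * (u v * S v v v) = g v v *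
      (3 * ∑ b, u (e b) * S v v (E b) + 3 * ∑ b, u (E b) * S v v (e b) - n * f v v
        + g v v * ∑ b, f (E b) (e b)) := by
    intro v
    have hs := Finset.sum_congr rfl fun b (_ : b ∈ Finset.univ) => hcoef b v
    have t0 : ∑ b, g v (e b) * S v v (E b) = S v v v := hsum' (S v v) v
    have t1 : ∑ b, g v (e b) * u (E b) = u v := hsum' u v
    have t2 : ∑ b, g v (e b) * f (E b) v = f v v := hsum' (f.flip v) v
    have t3 : ∑ b, S (e b) (E b) v = 0 := htr v
    have t4 : ∑ b, g (E b) (e b) = n := by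
      have h1 : ∀ b, g (E b) (e b) = 1 := fun b => by rw [hgs, hgE]; exact Pi.single_eq_same b 1
      simp [h1]
    have t5 : ∑ b, v b * u (e b) = u v := hsum u v
    have t6 : ∑ b, v b * S v v (e b) = S v v v := hsum (S v v) v
    have t7 : ∑ b, v b * g v (e b) = g v v := hsum (g v) v
    have t8 : ∑ b, v b * f v (e b) = f v v := hsum (f v) v
    have t9 : ∑ b, v b * f (e b) v = f v v := hsum (f.flip v) v
    have hl : ∑ b, (2 * (g v (e b) * (3 * u v * S v v (E b) + u (E b) * S v v v
        + g v v * f (E b) v)) + g v v * (3 * u (e b) * S v v (E b) + 6 * u v * S (e b) (E b) v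
        + 3 * u (E b) * S v v (e b) + 2 * (g v (e b) * f (E b) v) + g v v * f (E b) (e b))) =
        6 * u v * ∑ b, g v (e b) * S v v (E b) + 2 * S v v v * ∑ b, g v (e b) * u (E b)
        + 4 * g v v * ∑ b, g v (e b) * f (E b) v + 3 * g v v * ∑ b, u (e b) * S v v (E b)
        + 6 * g v v * u v * ∑ b, S (e b) (E b) v + 3 * g v v * ∑ b, u (E b) * S v v (e b)
        + g v v * g v v * ∑ b, f (E b) (e b) := by
      simp only [Finset.mul_sum, ← Finset.sum_add_distrib]
      exact Finset.sum_congr rfl fun b _ => by ring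
    have hr : ∑ b, ((4 * u v * S v v v + g v v * f v v) * (g (E b) (e b))
        + v b * (4 * u (e b) * S v v v + 12 * u v * S v v (e b) + 2 * g v (e b) * f v v
        + g v v * (f v (e b) + f (e b) v))) =
        (4 * u v * S v v v + g v v * f v v) * ∑ b, g (E b) (e b)
        + 4 * S v v v * ∑ b, v b * u (e b) + 12 * u v * ∑ b, v b * S v v (e b)
        + 2 * f v v * ∑ b, v b * g v (e b) + g v v * ∑ b, v b * f v (e b)
        + g v v * ∑ b, v b * f (e b) v := by
      simp only [Finset.mul_sum, ← Finset.sum_add_distrib]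
      exact Finset.sum_congr rfl fun b _ => by ring
    rw [hl, hr, t0, t1, t2, t3, t4, t5, t6, t7, t8, t9] at hs
    linear_combination -hs
  let H : Coord n →ₗ[ℝ] Coord n →ₗ[ℝ] ℝ := (4 * ((n : ℝ) + 2))⁻¹ •
    ((3 : ℝ) • ∑ b, u (e b) • S (E b) + (3 : ℝ) • ∑ b, u (E b) • S (e b) - (n : ℝ) • f
      + (∑ b, f (E b) (e b)) • g)
  have hrot : ∀ x v, S x v v = S v v x := fun x v => by rw [h12, h23]
  refine cubic_eq_zero_of_mul_eq hn hG hdet h12 h23 htr hu (H := H) (fun v => ?_) x y z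
  have hn0 : 4 * ((n : ℝ) + 2) ≠ 0 := by positivity
  have h1 := htot v
  have h2 : H v v = (4 * ((n : ℝ) + 2))⁻¹ * (3 * ∑ b, u (e b) * S v v (E b)
      + 3 * ∑ b, u (E b) * S v v (e b) - n * f v v + g v v * ∑ b, f (E b) (e b)) := by
    simp only [H, LinearMap.smul_apply, LinearMap.add_apply, LinearMap.sub_apply,
      LinearMap.sum_apply, smul_eq_mul, hrot]
    ring
  rw [← hg, h2]
  field_simp
  linear_combination h1

end CubicForms

/-! ### The Levi-Civita connection in matrix form -/

section Connection

variable {n : ℕ}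

/-- The endomorphism `b ↦ C(a, b)` for the components `C i j k = Cᵢⱼᵏ` of a vector-valued bilinear
form. -/
def endForm (C : Fin n → Fin n → Fin n → ℝ) (a : Coord n) : Matrix (Fin n) (Fin n) ℝ :=
  Matrix.of fun k j => ∑ i, a i * C i j k

theorem endForm_add (C : Fin n → Fin n → Fin n → ℝ) (a b : Coord n) :
    endForm C (a + b) = endForm C a + endForm C b := by
  ext k j
  simp [endForm, add_mul, Finset.sum_add_distrib]

theorem endForm_smul (C : Fin n → Fin n → Fin n → ℝ) (r : ℝ) (a : Coord n) :
    endForm C (r • a) = r • endForm C a := by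
  ext k j
  simp [endForm, mul_assoc, Finset.mul_sum]

theorem endForm_sub (C : Fin n → Fin n → Fin n → ℝ) (a b : Coord n) :
    endForm C (a - b) = endForm C a - endForm C b := by
  ext k j
  simp [endForm, sub_mul, Finset.sum_sub_distrib]

theorem endForm_comm {C : Fin n → Fin n → Fin n → ℝ} (hC : ∀ i j k, C i j k = C j i k)
    (a b : Coord n) : endForm C a *ᵥ b = endForm C b *ᵥ a := by
  ext k
  simp only [endForm, Matrix.mulVec, dotProduct, Matrix.of_apply, Finset.sum_mul]
  rw [Finset.sum_comm]
  refine Finset.sum_congr rfl fun i _ => Finset.sum_congr rfl fun j _ => ?_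
  rw [hC]
  ring

theorem dot_endForm_mulVec (C : Fin n → Fin n → Fin n → ℝ) (p a b : Coord n) :
    p ⬝ᵥ endForm C a *ᵥ b = ∑ i, ∑ j, ∑ k, C i j k * (a i * b j * p k) := by
  simp only [endForm, Matrix.mulVec, dotProduct, Matrix.of_apply, Finset.sum_mul, Finset.mul_sum]
  rw [Finset.sum_comm]
  rw [Finset.sum_congr rfl fun j _ => Finset.sum_comm]
  rw [Finset.sum_comm]
  refine Finset.sum_congr rfl fun i _ => Finset.sum_congr rfl fun j _ =>
    Finset.sum_congr rfl fun k _ => ?_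
  ring

theorem smoothMat_endForm {C : Coord n → Fin n → Fin n → Fin n → ℝ} {x : Coord n}
    (hC : ∀ i j k, ContDiffAt ℝ ∞ (fun y => C y i j k) x) (a : Coord n) :
    SmoothMat (fun y => endForm (C y) a) x := fun k j => by
  simp only [endForm, Matrix.of_apply]
  exact ContDiffAt.sum fun i _ => contDiffAt_const.mul (hC i j k)

/-- The curvature of the connection with connection matrices `N x a`. -/
def curvature (N : Coord n → Coord n → Matrix (Fin n) (Fin n) ℝ) (c a : Coord n) (x : Coord n) :
    Matrix (Fin n) (Fin n) ℝ :=
  mdd c (fun y => N y a) x - mdd a (fun y => N y c) x + (N x c * N x a - N x a * N x c)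

theorem curvature_add {N D : Coord n → Coord n → Matrix (Fin n) (Fin n) ℝ} {x : Coord n}
    (hN : ∀ a, SmoothMat (fun y => N y a) x) (hD : ∀ a, SmoothMat (fun y => D y a) x)
    (c a : Coord n) :
    curvature (fun y b => N y b + D y b) c a x = curvature N c a x
      + (mdd c (fun y => D y a) x + (N x c * D x a - D x a * N x c)
        - (mdd a (fun y => D y c) x + (N x a * D x c - D x c * N x a)))
      + (D x c * D x a - D x a * D x c) := by
  unfold curvature
  rw [mdd_add (hN a) (hD a), mdd_add (hN c) (hD c)]
  noncomm_ring

/-- Connection matrices of the Levi-Civita connection. -/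
def conn (g : Coord n → Matrix (Fin n) (Fin n) ℝ) (x : Coord n) (a : Coord n) :
    Matrix (Fin n) (Fin n) ℝ :=
  endForm (fun i j k => christoffel g k i j x) a

variable {g : Coord n → Matrix (Fin n) (Fin n) ℝ} {U : Set (Coord n)} {x : Coord n}

theorem IsMetricOn.smoothMat (hg : IsMetricOn g U) (hU : IsOpen U) (hx : x ∈ U) :
    SmoothMat g x := fun i j => (hg.smooth i j).contDiffAt (hU.mem_nhds hx)

theorem IsMetricOn.smoothMat_inv (hg : IsMetricOn g U) (hU : IsOpen U) (hx : x ∈ U) :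
    SmoothMat (fun y => (g y)⁻¹) x :=
  Superintegrable.smoothMat_inv (hg.smoothMat hU hx) (hg.nondeg x hx)

theorem IsMetricOn.smooth_christoffel (hg : IsMetricOn g U) (hU : IsOpen U) (hx : x ∈ U)
    (k i j : Fin n) : ContDiffAt ℝ ∞ (christoffel g k i j) x := by
  unfold christoffel
  refine contDiffAt_const.mul (ContDiffAt.sum fun l _ => (hg.smoothMat_inv hU hx k l).mul ?_)
  have h := hg.smoothMat hU hx
  exact ((smooth_dd (h j l)).add (smooth_dd (h i l))).sub (smooth_dd (h i j))

theorem IsMetricOn.smoothMat_conn (hg : IsMetricOn g U) (hU : IsOpen U) (hx : x ∈ U)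
    (a : Coord n) : SmoothMat (fun y => conn g y a) x :=
  smoothMat_endForm (fun i j k => hg.smooth_christoffel hU hx k i j) a

theorem IsMetricOn.dd_symm (hg : IsMetricOn g U) (hU : IsOpen U) (hx : x ∈ U) (v : Coord n)
    (i j : Fin n) : dd v (fun y => g y i j) x = dd v (fun y => g y j i) x :=
  dd_congr ((hU.eventually_mem hx).mono fun y hy => (hg.symm y hy).apply j i)

theorem IsMetricOn.christoffel_symm (hg : IsMetricOn g U) (hU : IsOpen U) (hx : x ∈ U)
    (k i j : Fin n) : christoffel g k i j x = christoffel g k j i x := by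
  unfold christoffel
  congr 1
  refine Finset.sum_congr rfl fun l _ => ?_
  rw [pd_eq_dd l, pd_eq_dd l, hg.dd_symm hU hx _ i j]
  ring

theorem IsMetricOn.conn_comm (hg : IsMetricOn g U) (hU : IsOpen U) (hx : x ∈ U)
    (a b : Coord n) : conn g x a *ᵥ b = conn g x b *ᵥ a :=
  endForm_comm (fun i j k => hg.christoffel_symm hU hx k i j) a b

theorem IsMetricOn.lower_christoffel (hg : IsMetricOn g U) (hx : x ∈ U) (i j l : Fin n) :
    ∑ k, g x l k * christoffel g k i j x =
      (1 / 2) * (pd i (fun y => g y j l) x + pd j (fun y => g y i l) x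
        - pd l (fun y => g y i j) x) := by
  have h := mulVec_inv_mulVec (hg.nondeg x hx) (fun l =>
    (pd i (fun y => g y j l) x + pd j (fun y => g y i l) x - pd l (fun y => g y i j) x))
  have h' := congrFun h l
  rw [← h']
  simp only [christoffel, Matrix.mulVec, dotProduct]
  rw [Finset.mul_sum]
  refine Finset.sum_congr rfl fun k _ => ?_
  ring

/-- The Levi-Civita connection is metric. -/
theorem IsMetricOn.mdd_metric (hg : IsMetricOn g U) (hU : IsOpen U) (hx : x ∈ U) (c : Coord n) :
    mdd c g x = (conn g x c)ᵀ * g x + g x * conn g x c := by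
  have key : ∀ i j, (g x * conn g x c) i j = ∑ m, c m * ((1 / 2) *
      (pd m (fun y => g y j i) x + pd j (fun y => g y m i) x - pd i (fun y => g y m j) x)) := by
    intro i j
    simp only [Matrix.mul_apply, conn, endForm, Matrix.of_apply, Finset.mul_sum]
    rw [Finset.sum_comm]
    refine Finset.sum_congr rfl fun m _ => ?_
    rw [← hg.lower_christoffel hx m j i, Finset.mul_sum]
    refine Finset.sum_congr rfl fun k _ => ?_
    ring
  have ht : (conn g x c)ᵀ * g x = (g x * conn g x c)ᵀ := by
    rw [Matrix.transpose_mul, (hg.symm x hx).eq]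
  ext i j
  rw [ht, Matrix.add_apply, Matrix.transpose_apply, key, key, ← Finset.sum_add_distrib]
  simp only [mdd, Matrix.of_apply]
  rw [dd_eq_sum, dotProduct]
  refine Finset.sum_congr rfl fun m _ => ?_
  simp only [grad, pd_eq_dd]
  rw [hg.dd_symm hU hx _ j i]
  ring

theorem IsMetricOn.mdd_inv_metric (hg : IsMetricOn g U) (hU : IsOpen U) (hx : x ∈ U)
    (c : Coord n) : mdd c (fun y => (g y)⁻¹) x =
      -(conn g x c * (g x)⁻¹ + (g x)⁻¹ * (conn g x c)ᵀ) := by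
  rw [mdd_inv (hg.smoothMat hU hx) ((hU.eventually_mem hx).mono hg.nondeg),
    hg.mdd_metric hU hx]
  have h1 := Matrix.nonsing_inv_mul _ (isUnit_iff_ne_zero.2 (hg.nondeg x hx))
  have h2 := Matrix.mul_nonsing_inv _ (isUnit_iff_ne_zero.2 (hg.nondeg x hx))
  rw [mul_add, add_mul, mul_assoc, mul_assoc, h2, mul_one, ← mul_assoc, h1, one_mul,
    add_comm]

theorem curvature_conn_apply (l k i j : Fin n) :
    curvature (conn g) (Pi.single i 1) (Pi.single j 1) x l k = riemann g l k i j x := by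
  have h : ∀ (y : Coord n) (i l k : Fin n),
      conn g y (Pi.single i 1) l k = christoffel g l i k y := by
    intro y i l k
    simp [conn, endForm, Pi.single_apply]
  simp only [curvature, Matrix.add_apply, Matrix.sub_apply, mdd, Matrix.of_apply,
    Matrix.mul_apply, h, riemann, Finset.sum_sub_distrib]
  rfl

theorem curvature_conn_sum (hg : IsMetricOn g U) (hU : IsOpen U) (hx : x ∈ U) (c a : Coord n) :
    curvature (conn g) c a x =
      ∑ i, ∑ j, (c i * a j) • curvature (conn g) (Pi.single i 1) (Pi.single j 1) x := by
  have hconn : ∀ (y a : Coord n), conn g y a = ∑ i, a i • conn g y (Pi.single i 1) := by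
    intro y a
    ext k j
    simp [conn, endForm, Matrix.sum_apply, Pi.single_apply]
  have hm : ∀ c a : Coord n, mdd c (fun y => conn g y a) x =
      ∑ i, ∑ j, (c i * a j) • mdd (Pi.single i 1) (fun y => conn g y (Pi.single j 1)) x := by
    intro c a
    ext k l
    simp only [mdd, Matrix.of_apply, Matrix.sum_apply, Matrix.smul_apply, smul_eq_mul]
    rw [dd_eq_sum, dotProduct]
    refine Finset.sum_congr rfl fun i _ => ?_
    have : (fun y => conn g y a k l) = fun y => ∑ j, a j * conn g y (Pi.single j 1) k l := by
      ext y
      rw [hconn]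
      simp [Matrix.sum_apply]
    simp only [grad, pd_eq_dd]
    rw [this, dd_sum _ fun j _ => contDiffAt_const.mul (hg.smoothMat_conn hU hx _ k l),
      Finset.mul_sum]
    refine Finset.sum_congr rfl fun j _ => ?_
    rw [dd_const_mul _ (hg.smoothMat_conn hU hx _ k l), mul_assoc]
  have hp : ∀ c a : Coord n, conn g x c * conn g x a =
      ∑ i, ∑ j, (c i * a j) • (conn g x (Pi.single i 1) * conn g x (Pi.single j 1)) := by
    intro c a
    rw [hconn x c, hconn x a, Finset.sum_mul_sum]
    refine Finset.sum_congr rfl fun i _ => Finset.sum_congr rfl fun j _ => ?_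
    rw [smul_mul_smul_comm]
  have hsw : ∀ F : Fin n → Fin n → Matrix (Fin n) (Fin n) ℝ,
      ∑ i, ∑ j, (a i * c j) • F i j = ∑ i, ∑ j, (c i * a j) • F j i := by
    intro F
    rw [Finset.sum_comm]
    simp only [mul_comm]
  unfold curvature
  rw [hm c a, hm a c, hp c a, hp a c, hsw, hsw]
  simp only [smul_add, smul_sub, Finset.sum_add_distrib, Finset.sum_sub_distrib]

theorem curvature_of_constant (hg : IsMetricOn g U) (hU : IsOpen U) (hx : x ∈ U) {κ : ℝ}
    (hκ : ∀ l k i j : Fin n, riemann g l k i j x =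
      κ * ((if l = i then 1 else 0) * g x j k - (if l = j then 1 else 0) * g x i k))
    (c a k : Coord n) : curvature (conn g) c a x *ᵥ k =
      κ • ((a ⬝ᵥ g x *ᵥ k) • c - (c ⬝ᵥ g x *ᵥ k) • a) := by
  have h1 : curvature (conn g) c a x =
      κ • (Matrix.vecMulVec c (a ᵥ* g x) - Matrix.vecMulVec a (c ᵥ* g x)) := by
    ext l m
    rw [curvature_conn_sum hg hU hx]
    simp only [Matrix.sum_apply, Matrix.smul_apply, curvature_conn_apply, hκ, smul_eq_mul,
      Matrix.sub_apply, Matrix.vecMulVec_apply, Matrix.vecMul, dotProduct]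
    simp only [mul_sub, Finset.sum_sub_distrib, ite_mul, one_mul, zero_mul, mul_ite, mul_zero]
    rw [Finset.sum_comm (f := fun i j => if l = j then _ else _)]
    simp only [Finset.sum_ite_irrel, Finset.sum_const_zero, Finset.sum_ite_eq, Finset.mem_univ,
      if_true, Finset.mul_sum]
    congr 1 <;> exact Finset.sum_congr rfl fun j _ => by ring
  rw [h1, Matrix.smul_mulVec, Matrix.sub_mulVec]
  simp only [Matrix.vecMulVec_mulVec, Matrix.dotProduct_mulVec, op_smul_eq_smul]

/-- The Hessian as a matrix. -/
def hessM (g : Coord n → Matrix (Fin n) (Fin n) ℝ) (f : Coord n → ℝ) (x : Coord n) :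
    Matrix (Fin n) (Fin n) ℝ :=
  Matrix.of fun i j => hess g f i j x

variable {f : Coord n → ℝ}

theorem dd_dd_eq_sum (hf : ContDiffAt ℝ ∞ f x) (a b : Coord n) :
    dd b (dd a f) x = ∑ i, ∑ j, a i * (b j * pd j (pd i f) x) := by
  rw [← vdd_grad hf, dotProduct]
  refine Finset.sum_congr rfl fun i _ => ?_
  rw [← Finset.mul_sum]
  congr 1
  exact dd_eq_sum _ _ _

theorem dot_hessM_mulVec (hf : ContDiffAt ℝ ∞ f x) (a b : Coord n) :
    a ⬝ᵥ hessM g f x *ᵥ b = dd b (dd a f) x - dd (conn g x a *ᵥ b) f x := by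
  rw [dd_dd_eq_sum hf, dd_eq_sum (conn g x a *ᵥ b), dotProduct_comm _ (grad f x), conn,
    dot_endForm_mulVec, ← Finset.sum_sub_distrib]
  simp only [hessM, hess, Matrix.mulVec, dotProduct, Matrix.of_apply, Finset.mul_sum]
  refine Finset.sum_congr rfl fun i _ => ?_
  rw [← Finset.sum_sub_distrib]
  refine Finset.sum_congr rfl fun j _ => ?_
  rw [sub_mul, mul_sub, Finset.sum_mul, Finset.mul_sum]
  congr 1
  · ring
  · exact Finset.sum_congr rfl fun k _ => by simp only [grad]; ring

theorem vdd_grad_eq (hg : IsMetricOn g U) (hU : IsOpen U) (hx : x ∈ U)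
    (hf : ContDiffAt ℝ ∞ f x) (a : Coord n) :
    vdd a (grad f) x = hessM g f x *ᵥ a + (conn g x a)ᵀ *ᵥ grad f x := by
  ext i
  have h1 := dot_hessM_mulVec (g := g) hf (Pi.single i 1) a
  rw [single_one_dotProduct, hg.conn_comm hU hx, dd_eq_sum (conn g x a *ᵥ _),
    dotProduct_comm, Matrix.dotProduct_mulVec, dotProduct_single_one,
    ← Matrix.mulVec_transpose] at h1
  rw [Pi.add_apply, h1]
  simp [vdd, grad, pd_eq_dd]

theorem smooth_hess (hg : IsMetricOn g U) (hU : IsOpen U) (hx : x ∈ U)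
    (hf : ContDiffAt ℝ ∞ f x) : SmoothMat (hessM g f) x := fun i j => by
  simp only [hessM, hess, Matrix.of_apply]
  exact (smooth_dd (smooth_dd hf)).sub
    (ContDiffAt.sum fun k _ => (hg.smooth_christoffel hU hx k i j).mul (smooth_dd hf))

theorem hessM_symm (hg : IsMetricOn g U) (hU : IsOpen U) (hx : x ∈ U)
    (hf : ContDiffAt ℝ ∞ f x) : (hessM g f x).IsSymm := by
  ext i j
  have h1 := dot_hessM_mulVec (g := g) hf (Pi.single i 1) (Pi.single j 1)
  have h2 := dot_hessM_mulVec (g := g) hf (Pi.single j 1) (Pi.single i 1)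
  rw [hg.conn_comm hU hx, dd_comm hf, ← h2] at h1
  simpa using h1.symm

theorem smooth_lap (hg : IsMetricOn g U) (hU : IsOpen U) (hx : x ∈ U)
    (hf : ContDiffAt ℝ ∞ f x) : ContDiffAt ℝ ∞ (lap g f) x := by
  unfold lap
  exact ContDiffAt.sum fun i _ => ContDiffAt.sum fun j _ =>
    (hg.smoothMat_inv hU hx i j).mul (smooth_hess hg hU hx hf i j)

end Connection

/-! ### Integrals quadratic in the momenta -/

section Integrals

variable {n : ℕ} {g K : Coord n → Matrix (Fin n) (Fin n) ℝ} {U : Set (Coord n)}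
  {V W : Coord n → ℝ} {x : Coord n}

theorem dot_mulVec_eq_sum (A : Matrix (Fin n) (Fin n) ℝ) (p q : Coord n) :
    p ⬝ᵥ A *ᵥ q = ∑ i, ∑ j, A i j * p i * q j := by
  simp only [dotProduct, Matrix.mulVec, Finset.mul_sum]
  exact Finset.sum_congr rfl fun i _ => Finset.sum_congr rfl fun j _ => by ring

theorem pd_quadraticObservable_position (hK : SmoothMat K x) (hW : ContDiffAt ℝ ∞ W x)
    (p : Coord n) (i : Fin n) : pd i (fun q => quadraticObservable K W q p) x =
      p ⬝ᵥ mdd (Pi.single i 1) K x *ᵥ p + pd i W x := by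
  simp only [pd_eq_dd, quadraticObservable, dot_mulVec_eq_sum, mdd, Matrix.of_apply]
  have h1 : ∀ i j, ContDiffAt ℝ ∞ (fun y => K y i j * p i * p j) x := fun i j =>
    ((hK i j).mul contDiffAt_const).mul contDiffAt_const
  rw [dd_add (ContDiffAt.sum fun i _ => ContDiffAt.sum fun j _ => h1 i j) hW,
    dd_sum _ fun i _ => ContDiffAt.sum fun j _ => h1 i j]
  congr 1
  refine Finset.sum_congr rfl fun i _ => ?_
  rw [dd_sum _ fun j _ => h1 i j]
  refine Finset.sum_congr rfl fun j _ => ?_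
  rw [dd_mul ((hK i j).mul contDiffAt_const) contDiffAt_const,
    dd_mul (hK i j) contDiffAt_const, dd_const, dd_const]
  ring

theorem pd_quadraticObservable_momentum (hK : (K x).IsSymm) (p : Coord n) (i : Fin n) :
    pd i (quadraticObservable K W x) p = 2 * (K x *ᵥ p) i := by
  have h0 : quadraticObservable K W x = fun p => p ⬝ᵥ (K x *ᵥ p) + W x := by
    ext p
    rw [dot_mulVec_eq_sum]
    rfl
  have hid : SmoothVec (fun p : Coord n => p) p := fun j =>
    (ContinuousLinearMap.proj (R := ℝ) (φ := fun _ : Fin n => ℝ) j).contDiff.contDiffAt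
  have hc : SmoothVec (fun p : Coord n => K x *ᵥ p) p :=
    smoothVec_mulVec (smoothMat_const (K x)) hid
  have hvid : ∀ v : Coord n, vdd v (fun p : Coord n => p) p = v := by
    intro v
    ext j
    have : (fun y : Coord n => y j) = fun y => (ContinuousLinearMap.proj (R := ℝ) j :
      Coord n →L[ℝ] ℝ) y := rfl
    simp only [vdd, dd]
    rw [this, ContinuousLinearMap.fderiv]
    rfl
  rw [h0, pd_eq_dd, dd_add (smooth_dot hid hc) contDiffAt_const, dd_const, dd_dot hid hc,
    vdd_mulVec (smoothMat_const _) hid, mdd_const, Matrix.zero_mulVec, zero_add, hvid,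
    dot_mulVec_comm hK p, single_one_dotProduct]
  ring

theorem sum_dot_mdd_mul (A : Coord n → Matrix (Fin n) (Fin n) ℝ) (p w x : Coord n) :
    ∑ i, (p ⬝ᵥ mdd (Pi.single i 1) A x *ᵥ p) * w i = p ⬝ᵥ mdd w A x *ᵥ p := by
  simp only [dot_mulVec_eq_sum, mdd, Matrix.of_apply, Finset.sum_mul]
  rw [Finset.sum_comm]
  refine Finset.sum_congr rfl fun j _ => ?_
  rw [Finset.sum_comm]
  refine Finset.sum_congr rfl fun k _ => ?_
  rw [dd_eq_sum w, dotProduct, Finset.sum_mul, Finset.sum_mul]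
  refine Finset.sum_congr rfl fun i _ => ?_
  simp only [grad, pd_eq_dd]
  ring

theorem poisson_quadraticObservable {L : Coord n → Matrix (Fin n) (Fin n) ℝ}
    (hK : SmoothMat K x) (hL : SmoothMat L x) (hKs : (K x).IsSymm) (hLs : (L x).IsSymm)
    (hW : ContDiffAt ℝ ∞ W x) (hV : ContDiffAt ℝ ∞ V x) (p : Coord n) :
    poisson (quadraticObservable K W) (quadraticObservable L V) x p =
      2 * (p ⬝ᵥ mdd (L x *ᵥ p) K x *ᵥ p - p ⬝ᵥ mdd (K x *ᵥ p) L x *ᵥ p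
        + (dd (L x *ᵥ p) W x - dd (K x *ᵥ p) V x)) := by
  unfold poisson
  simp only [pd_quadraticObservable_position hK hW, pd_quadraticObservable_position hL hV,
    pd_quadraticObservable_momentum hKs, pd_quadraticObservable_momentum hLs]
  have hdot : ∀ a b : Coord n, a ⬝ᵥ b = ∑ i, a i * b i := fun _ _ => rfl
  rw [← sum_dot_mdd_mul K, ← sum_dot_mdd_mul L, dd_eq_sum, dd_eq_sum, hdot (L x *ᵥ p),
    hdot (K x *ᵥ p), ← Finset.sum_sub_distrib, ← Finset.sum_sub_distrib,
    ← Finset.sum_add_distrib, Finset.mul_sum]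
  exact Finset.sum_congr rfl fun i _ => by simp only [grad]; ring

/-- A field of symmetric contravariant tensors is the quadratic part of an integral if and only if
it is a Killing tensor and `K dV` is exact. -/
theorem admitsIntegral_iff (hg : IsMetricOn g U) (hU : IsOpen U)
    (hK : ∀ x ∈ U, SmoothMat K x) (hKs : ∀ x ∈ U, (K x).IsSymm)
    (hV : ∀ x ∈ U, ContDiffAt ℝ ∞ V x) : AdmitsIntegral U g V K ↔
      (∀ x ∈ U, ∀ p : Coord n, p ⬝ᵥ mdd ((g x)⁻¹ *ᵥ p) K x *ᵥ p =
        p ⬝ᵥ mdd (K x *ᵥ p) (fun y => (g y)⁻¹) x *ᵥ p) ∧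
      ∃ W : Coord n → ℝ, ContDiffOn ℝ ∞ W U ∧
        ∀ x ∈ U, grad W x = g x *ᵥ (K x *ᵥ grad V x) := by
  have hgi : ∀ x ∈ U, ((g x)⁻¹).IsSymm := fun x hx => by
    rw [Matrix.IsSymm, Matrix.transpose_nonsing_inv, (hg.symm x hx).eq]
  have hpois : ∀ W : Coord n → ℝ, ContDiffOn ℝ ∞ W U → ∀ x ∈ U, ∀ p,
      poisson (quadraticObservable K W) (hamiltonian g V) x p =
      2 * (p ⬝ᵥ mdd ((g x)⁻¹ *ᵥ p) K x *ᵥ p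
        - p ⬝ᵥ mdd (K x *ᵥ p) (fun y => (g y)⁻¹) x *ᵥ p
        + (dd ((g x)⁻¹ *ᵥ p) W x - dd (K x *ᵥ p) V x)) := fun W hW x hx p =>
    poisson_quadraticObservable (hK x hx) (hg.smoothMat_inv hU hx) (hKs x hx) (hgi x hx)
      (hW.contDiffAt (hU.mem_nhds hx)) (hV x hx) p
  have hlin : ∀ (W : Coord n → ℝ) (x : Coord n), x ∈ U → ((∀ p, dd ((g x)⁻¹ *ᵥ p) W x =
      dd (K x *ᵥ p) V x) ↔ grad W x = g x *ᵥ (K x *ᵥ grad V x)) := by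
    intro W x hx
    simp only [dd_eq_sum]
    have e1 : ∀ (A : Matrix (Fin n) (Fin n) ℝ) (w p : Coord n), A.IsSymm →
        (A *ᵥ p) ⬝ᵥ w = p ⬝ᵥ A *ᵥ w := fun A w p hA => by
      rw [dotProduct_comm, dot_mulVec_comm hA]
    constructor
    · intro h
      have h2 : (g x)⁻¹ *ᵥ grad W x = K x *ᵥ grad V x := by
        ext i
        have := h (Pi.single i 1)
        rwa [e1 _ _ _ (hgi x hx), e1 _ _ _ (hKs x hx), single_one_dotProduct,
          single_one_dotProduct] at this
      rw [← h2, mulVec_inv_mulVec (hg.nondeg x hx)]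
    · intro h p
      rw [e1 _ _ _ (hgi x hx), e1 _ _ _ (hKs x hx), h, inv_mulVec_mulVec (hg.nondeg x hx)]
  constructor
  · rintro ⟨W, hW, hint⟩
    have hsplit : ∀ x ∈ U, ∀ p : Coord n, p ⬝ᵥ mdd ((g x)⁻¹ *ᵥ p) K x *ᵥ p =
        p ⬝ᵥ mdd (K x *ᵥ p) (fun y => (g y)⁻¹) x *ᵥ p ∧
        dd ((g x)⁻¹ *ᵥ p) W x = dd (K x *ᵥ p) V x := by
      intro x hx p
      have h1 := hint x hx p
      -- The bracket is a cubic plus a linear polynomial in p. Doubling p scales these by 8 and 2,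
      -- so both parts vanish separately.
      have h2 := hint x hx ((2 : ℝ) • p)
      rw [hpois W hW x hx] at h1 h2
      have hm : ∀ (A : Coord n → Matrix (Fin n) (Fin n) ℝ) (w q : Coord n),
          q ⬝ᵥ mdd ((2 : ℝ) • w) A x *ᵥ q = 2 * (q ⬝ᵥ mdd w A x *ᵥ q) := by
        intro A w q
        have : mdd ((2 : ℝ) • w) A x = (2 : ℝ) • mdd w A x := by
          ext i j
          exact dd_vsmul _ _
        rw [this, Matrix.smul_mulVec, dotProduct_smul, smul_eq_mul]
      simp only [Matrix.mulVec_smul, hm, dd_vsmul, smul_dotProduct, dotProduct_smul,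
        smul_eq_mul] at h2
      constructor <;> linarith
    exact ⟨fun x hx p => (hsplit x hx p).1, W, hW, fun x hx =>
      (hlin W x hx).1 fun p => (hsplit x hx p).2⟩
  · rintro ⟨hkill, W, hW, hgrad⟩
    refine ⟨W, hW, fun x hx p => ?_⟩
    rw [hpois W hW x hx, hkill x hx p, (hlin W x hx).2 (hgrad x hx) p]
    ring

/-- Covariant derivative of a contravariant tensor field of rank two. -/
def covUp (g K : Coord n → Matrix (Fin n) (Fin n) ℝ) (a x : Coord n) : Matrix (Fin n) (Fin n) ℝ :=
  mdd a K x + conn g x a * K x + K x * (conn g x a)ᵀ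

/-- With p = g v, the derivative of g⁻¹ is rewritten by metric compatibility; what remains is the
covariant form ∇_v K(v, v) = 0 of the Killing equation. -/
theorem dot_covUp_killing (hg : IsMetricOn g U) (hU : IsOpen U) (hx : x ∈ U)
    (hkill : ∀ p : Coord n, p ⬝ᵥ mdd ((g x)⁻¹ *ᵥ p) K x *ᵥ p =
        p ⬝ᵥ mdd (K x *ᵥ p) (fun y => (g y)⁻¹) x *ᵥ p) (hKs : (K x).IsSymm) (v : Coord n) :
    (g x *ᵥ v) ⬝ᵥ covUp g K v x *ᵥ (g x *ᵥ v) = 0 := by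
  have h := hkill (g x *ᵥ v)
  have h3 : ∀ A : Matrix (Fin n) (Fin n) ℝ, ∀ p q : Coord n, p ⬝ᵥ Aᵀ *ᵥ q = q ⬝ᵥ A *ᵥ p := by
    intro A p q
    rw [Matrix.mulVec_transpose, dotProduct_comm, Matrix.dotProduct_mulVec]
  have hi : ((g x)⁻¹).IsSymm := by
    rw [Matrix.IsSymm, Matrix.transpose_nonsing_inv, (hg.symm x hx).eq]
  rw [inv_mulVec_mulVec (hg.nondeg x hx), hg.mdd_inv_metric hU hx, Matrix.neg_mulVec,
    Matrix.add_mulVec, dotProduct_neg, dotProduct_add, ← Matrix.mulVec_mulVec,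
    ← Matrix.mulVec_mulVec, inv_mulVec_mulVec (hg.nondeg x hx), dot_mulVec_comm hi,
    dotProduct_comm (_ *ᵥ _) ((g x)⁻¹ *ᵥ _), inv_mulVec_mulVec (hg.nondeg x hx),
    dotProduct_comm v, dotProduct_comm, ← dotProduct_comm, Matrix.mulVec_transpose] at h
  simp only [covUp, Matrix.add_mulVec, dotProduct_add, ← Matrix.mulVec_mulVec]
  rw [dot_mulVec_comm hKs (g x *ᵥ v), h, ← Matrix.dotProduct_mulVec, hg.conn_comm hU hx,
    Matrix.mulVec_transpose, ← Matrix.dotProduct_mulVec]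
  ring

end Integrals

/-! ### The prolongation of the Wilczynski equation -/

section Potentials

variable {n : ℕ} {g : Coord n → Matrix (Fin n) (Fin n) ℝ} {U : Set (Coord n)}
  {T : Coord n → Fin n → Fin n → Fin n → ℝ} {t : Coord n → Coord n} {V : Coord n → ℝ}
  {x : Coord n}

theorem transpose_dot (A : Matrix (Fin n) (Fin n) ℝ) (p q : Coord n) :
    p ⬝ᵥ Aᵀ *ᵥ q = q ⬝ᵥ A *ᵥ p := by
  rw [Matrix.mulVec_transpose, dotProduct_comm, Matrix.dotProduct_mulVec]

theorem IsStructureTensor.smoothMat (hT : IsStructureTensor g T U) (hU : IsOpen U) (hx : x ∈ U)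
    (a : Coord n) : SmoothMat (fun y => endForm (T y) a) x :=
  smoothMat_endForm (fun i j k => (hT.smooth i j k).contDiffAt (hU.mem_nhds hx)) a

theorem IsStructureTensor.endForm_comm (hT : IsStructureTensor g T U) (hx : x ∈ U)
    (a b : Coord n) : endForm (T x) a *ᵥ b = endForm (T x) b *ᵥ a :=
  Superintegrable.endForm_comm (hT.symm x hx) a b

/-- The skew part of the structure tensor in its last two (lowered) indices is the trace part
determined by the covector field `t`. -/
def HasSkewPart (g : Coord n → Matrix (Fin n) (Fin n) ℝ) (T : Coord n → Fin n → Fin n → Fin n → ℝ)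
    (t : Coord n → Coord n) (U : Set (Coord n)) : Prop :=
  ∀ x ∈ U, ∀ a c : Coord n,
    (endForm (T x) a)ᵀ *ᵥ (g x *ᵥ c) - (endForm (T x) c)ᵀ *ᵥ (g x *ᵥ a) =
      (1 + 2 / (n : ℝ)) • ((t x ⬝ᵥ a) • (g x *ᵥ c) - (t x ⬝ᵥ c) • (g x *ᵥ a))

theorem Wilczynski.hessM_mulVec (hT : IsStructureTensor g T U) (hV : Wilczynski g T U V)
    (hx : x ∈ U) (a : Coord n) : hessM g V x *ᵥ a =
      (endForm (T x) a)ᵀ *ᵥ grad V x + (1 / (n : ℝ) * lap g V x) • (g x *ᵥ a) := by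
  ext i
  have h : ∀ j, hess g V i j x = (∑ k, T x i j k * pd k V x)
      + (1 / (n : ℝ)) * g x i j * lap g V x := fun j => hV x hx i j
  simp only [hessM, endForm, grad, Matrix.mulVec, dotProduct, Matrix.of_apply, h,
    Matrix.transpose_apply, Pi.add_apply, Pi.smul_apply, smul_eq_mul, Finset.mul_sum, add_mul,
    Finset.sum_add_distrib, Finset.sum_mul]
  congr 1
  · rw [Finset.sum_comm]
    refine Finset.sum_congr rfl fun k _ => Finset.sum_congr rfl fun j _ => ?_
    rw [hT.symm x hx i j k]
    ring
  · exact Finset.sum_congr rfl fun j _ => by ring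

/-- The connection matrices of the Levi-Civita connection modified by the structure tensor. -/
def structConn (g : Coord n → Matrix (Fin n) (Fin n) ℝ)
    (T : Coord n → Fin n → Fin n → Fin n → ℝ) (x a : Coord n) : Matrix (Fin n) (Fin n) ℝ :=
  conn g x a + endForm (T x) a

theorem smoothMat_structConn (hg : IsMetricOn g U) (hU : IsOpen U) (hT : IsStructureTensor g T U)
    (hx : x ∈ U) (a : Coord n) : SmoothMat (fun y => structConn g T y a) x :=
  smoothMat_add (hg.smoothMat_conn hU hx a) (hT.smoothMat hU hx a)

theorem Wilczynski.vdd_grad (hg : IsMetricOn g U) (hU : IsOpen U) (hT : IsStructureTensor g T U)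
    (hVs : ∀ x ∈ U, ContDiffAt ℝ ∞ V x) (hV : Wilczynski g T U V) (hx : x ∈ U) (a : Coord n) :
    vdd a (grad V) x = (structConn g T x a)ᵀ *ᵥ grad V x
      + (1 / (n : ℝ) * lap g V x) • (g x *ᵥ a) := by
  rw [vdd_grad_eq hg hU hx (hVs x hx), hV.hessM_mulVec hT hx, structConn, Matrix.transpose_add,
    Matrix.add_mulVec]
  abel

/-- Symmetry of the second derivatives of dV, computed from the first-order equation. The Laplacian
term involves only the skew part of T, which is why `HasSkewPart` suffices and only the covector t
enters. -/
theorem Wilczynski.integrability (hg : IsMetricOn g U) (hU : IsOpen U)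
    (hT : IsStructureTensor g T U) (hskew : HasSkewPart g T t U)
    (hVs : ∀ x ∈ U, ContDiffAt ℝ ∞ V x) (hV : Wilczynski g T U V) (hx : x ∈ U) (c a : Coord n) :
    (curvature (structConn g T) c a x)ᵀ *ᵥ grad V x
      + (dd c (fun y => 1 / (n : ℝ) * lap g V y) x
          - (1 + 2 / (n : ℝ)) * (t x ⬝ᵥ c) * (1 / (n : ℝ) * lap g V x)) • (g x *ᵥ a)
      - (dd a (fun y => 1 / (n : ℝ) * lap g V y) x
          - (1 + 2 / (n : ℝ)) * (t x ⬝ᵥ a) * (1 / (n : ℝ) * lap g V x)) • (g x *ᵥ c) = 0 := by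
  have hL : ContDiffAt ℝ ∞ (fun y => 1 / (n : ℝ) * lap g V y) x :=
    contDiffAt_const.mul (smooth_lap hg hU hx (hVs x hx))
  have hξ := smoothVec_grad (hVs x hx)
  have hgx := hg.smoothMat hU hx
  have key : ∀ c a : Coord n, vdd c (vdd a (grad V)) x =
      (mdd c (fun y => structConn g T y a) x)ᵀ *ᵥ grad V x
      + (structConn g T x a)ᵀ *ᵥ ((structConn g T x c)ᵀ *ᵥ grad V x
          + (1 / (n : ℝ) * lap g V x) • (g x *ᵥ c))
      + (dd c (fun y => 1 / (n : ℝ) * lap g V y) x • (g x *ᵥ a)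
        + (1 / (n : ℝ) * lap g V x) • (((conn g x c)ᵀ * g x + g x * conn g x c) *ᵥ a)) := by
    intro c a
    have hA := smoothMat_structConn hg hU hT hx a
    rw [vdd_congr ((hU.eventually_mem hx).mono fun y hy =>
      hV.vdd_grad hg hU hT hVs hy a),
      vdd_add (smoothVec_mulVec (smoothMat_transpose hA) hξ)
        (smoothVec_smul hL (smoothVec_mulVec hgx (smoothVec_const a))),
      vdd_mulVec (smoothMat_transpose hA) hξ, mdd_transpose,
      vdd_smul hL (smoothVec_mulVec hgx (smoothVec_const a)),
      vdd_mulVec hgx (smoothVec_const a), vdd_const, Matrix.mulVec_zero, add_zero,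
      hg.mdd_metric hU hx, hV.vdd_grad hg hU hT hVs hx c]
  have hcomm := vdd_comm hξ a c
  rw [key, key] at hcomm
  have hs := hskew x hx a c
  have hcc := hg.conn_comm hU hx a c
  simp only [curvature, Matrix.transpose_add, Matrix.transpose_sub, Matrix.transpose_mul,
    Matrix.add_mulVec, Matrix.sub_mulVec, ← Matrix.mulVec_mulVec]
  simp only [Matrix.mulVec_add, Matrix.mulVec_smul, Matrix.add_mulVec, ← Matrix.mulVec_mulVec]
    at hcomm
  have e1 : (structConn g T x a)ᵀ *ᵥ (g x *ᵥ c) =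
      (conn g x a)ᵀ *ᵥ (g x *ᵥ c) + (endForm (T x) a)ᵀ *ᵥ (g x *ᵥ c) := by
    rw [structConn, Matrix.transpose_add, Matrix.add_mulVec]
  have e2 : (structConn g T x c)ᵀ *ᵥ (g x *ᵥ a) =
      (conn g x c)ᵀ *ᵥ (g x *ᵥ a) + (endForm (T x) c)ᵀ *ᵥ (g x *ᵥ a) := by
    rw [structConn, Matrix.transpose_add, Matrix.add_mulVec]
  rw [e1, e2, hcc] at hcomm
  ext i
  have h1 := congrFun hcomm i
  have h2 := congrFun hs i
  simp only [Pi.add_apply, Pi.sub_apply, Pi.smul_apply, smul_eq_mul, Pi.zero_apply] at h1 h2 ⊢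
  linear_combination h1 - (1 / (n : ℝ) * lap g V x) * h2

/-- Contracting the integrability condition over a with the inverse metric produces (n - 1) μ(c),
where μ is the corrected differential of ΔV/n. This is the equation that closes the prolonged
system. -/
theorem Wilczynski.dd_lap (hn : 3 ≤ n) (hg : IsMetricOn g U) (hU : IsOpen U)
    (hT : IsStructureTensor g T U) (hskew : HasSkewPart g T t U)
    (hVs : ∀ x ∈ U, ContDiffAt ℝ ∞ V x) (hV : Wilczynski g T U V) (hx : x ∈ U) (c : Coord n) :
    dd c (fun y => 1 / (n : ℝ) * lap g V y) x =
      -(1 / ((n : ℝ) - 1)) * ((∑ b, curvature (structConn g T) c (Pi.single b 1) x *ᵥ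
        ((g x)⁻¹ *ᵥ Pi.single b 1)) ⬝ᵥ grad V x)
      + (1 + 2 / (n : ℝ)) * (t x ⬝ᵥ c) * (1 / (n : ℝ) * lap g V x) := by
  set μ : Coord n → ℝ := fun c => dd c (fun y => 1 / (n : ℝ) * lap g V y) x
          - (1 + 2 / (n : ℝ)) * (t x ⬝ᵥ c) * (1 / (n : ℝ) * lap g V x) with hμ
  have hμlin : ∀ w : Coord n, ∑ b, w b * μ (Pi.single b 1) = μ w := by
    intro w
    simp only [hμ, mul_sub, Finset.sum_sub_distrib]
    rw [dd_eq_sum w, dotProduct]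
    congr 1
    simp only [dotProduct_single_one]
    simp only [dotProduct, Finset.mul_sum, Finset.sum_mul]
    exact Finset.sum_congr rfl fun b _ => by ring
  have hint : ∀ b, ((g x)⁻¹ *ᵥ Pi.single b 1) ⬝ᵥ ((curvature (structConn g T) c (Pi.single b 1) x)ᵀ
      *ᵥ grad V x) + μ c - c b * μ (Pi.single b 1) = 0 := by
    intro b
    have h := congrArg (fun w => ((g x)⁻¹ *ᵥ Pi.single b 1) ⬝ᵥ w)
      (hV.integrability hg hU hT hskew hVs hx c (Pi.single b 1))
    simp only [dotProduct_add, dotProduct_sub, dotProduct_smul, smul_eq_mul, dotProduct_zero] at h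
    rw [dot_mulVec_comm (hg.symm x hx), mulVec_inv_mulVec (hg.nondeg x hx),
      dot_mulVec_comm (hg.symm x hx), mulVec_inv_mulVec (hg.nondeg x hx)] at h
    simp only [dotProduct_single_one, Pi.single_eq_same] at h
    simp only [hμ, dotProduct_single_one]
    linear_combination h
  have hsum := Finset.sum_eq_zero fun b (_ : b ∈ Finset.univ) => hint b
  rw [Finset.sum_sub_distrib, Finset.sum_add_distrib, hμlin, Finset.sum_const, Finset.card_univ,
    Fintype.card_fin, nsmul_eq_mul] at hsum
  have hdot : (∑ b, curvature (structConn g T) c (Pi.single b 1) x *ᵥ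
        ((g x)⁻¹ *ᵥ Pi.single b 1)) ⬝ᵥ grad V x = ∑ b, ((g x)⁻¹ *ᵥ Pi.single b 1) ⬝ᵥ
        ((curvature (structConn g T) c (Pi.single b 1) x)ᵀ *ᵥ grad V x) := by
    rw [sum_dotProduct]
    refine Finset.sum_congr rfl fun b _ => ?_
    rw [transpose_dot, dotProduct_comm]
  rw [hdot]
  have hn1 : (n : ℝ) - 1 ≠ 0 := by
    have : (3 : ℝ) ≤ n := by exact_mod_cast hn
    linarith
  have h3 : μ c = -(1 / ((n : ℝ) - 1)) * ∑ b, ((g x)⁻¹ *ᵥ Pi.single b 1) ⬝ᵥ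
        ((curvature (structConn g T) c (Pi.single b 1) x)ᵀ *ᵥ grad V x) := by
    field_simp
    linear_combination hsum
  rw [← h3]
  simp only [hμ]
  ring

theorem smoothMat_curvature {N : Coord n → Coord n → Matrix (Fin n) (Fin n) ℝ}
    (hN : ∀ a, SmoothMat (fun y => N y a) x) (c a : Coord n) : SmoothMat (curvature N c a) x :=
  smoothMat_add (smoothMat_sub (smoothMat_mdd (hN a)) (smoothMat_mdd (hN c)))
    (smoothMat_sub (smoothMat_mul (hN c) (hN a)) (smoothMat_mul (hN a) (hN c)))

/-- The 2-jet data that determine a solution of the Wilczynski equation. -/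
def jet (g : Coord n → Matrix (Fin n) (Fin n) ℝ) (V : Coord n → ℝ) :
    Fin n ⊕ Bool → Coord n → ℝ
  | Sum.inl i => pd i V
  | Sum.inr false => V
  | Sum.inr true => fun y => 1 / (n : ℝ) * lap g V y

/-- The n + 2 functions (dV, V, ΔV/n) satisfy a closed linear first-order system with continuous
coefficients M, so unique continuation applies. -/
theorem Wilczynski.eq_zero_of_jet (hn : 3 ≤ n) (hg : IsMetricOn g U) (hU : IsOpen U)
    (hUc : IsConnected U) (hT : IsStructureTensor g T U) (hskew : HasSkewPart g T t U)
    (ht : ∀ x ∈ U, SmoothVec t x) (hVs : ∀ x ∈ U, ContDiffAt ℝ ∞ V x) (hV : Wilczynski g T U V)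
    (hx : x ∈ U) (h0 : ∀ i, jet g V i x = 0) : ∀ y ∈ U, V y = 0 := by
  let M : Fin n → (Fin n ⊕ Bool) → (Fin n ⊕ Bool) → Coord n → ℝ := fun a i j =>
    match i, j with
    | Sum.inl i, Sum.inl j => fun y => structConn g T y (Pi.single a 1) j i
    | Sum.inl i, Sum.inr true => fun y => g y i a
    | Sum.inl _, Sum.inr false => fun _ => 0
    | Sum.inr false, Sum.inl j => fun _ => if j = a then 1 else 0
    | Sum.inr false, Sum.inr _ => fun _ => 0
    | Sum.inr true, Sum.inl j => fun y => -(1 / ((n : ℝ) - 1)) * (∑ b,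
        curvature (structConn g T) (Pi.single a 1) (Pi.single b 1) y *ᵥ
          ((g y)⁻¹ *ᵥ Pi.single b 1)) j
    | Sum.inr true, Sum.inr false => fun _ => 0
    | Sum.inr true, Sum.inr true => fun y => (1 + 2 / (n : ℝ)) * t y a
  have hsm : ∀ i, ∀ y ∈ U, ContDiffAt ℝ ∞ (jet g V i) y := by
    rintro (i | _ | _) y hy
    · exact smooth_dd (hVs y hy)
    · exact hVs y hy
    · exact contDiffAt_const.mul (smooth_lap hg hU hy (hVs y hy))
  have hM : ∀ a i j, ∀ y ∈ U, ContinuousAt (M a i j) y := by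
    rintro a (i | _ | _) (j | _ | _) y hy
    · exact (smoothMat_structConn hg hU hT hy _ j i).continuousAt
    · exact continuousAt_const
    · exact (hg.smoothMat hU hy i a).continuousAt
    · exact continuousAt_const
    · exact continuousAt_const
    · exact continuousAt_const
    · refine ContDiffAt.continuousAt (𝕜 := ℝ) (n := ∞) (contDiffAt_const.mul ?_)
      simp only [Finset.sum_apply]
      exact ContDiffAt.sum fun b _ => smoothVec_mulVec
        (smoothMat_curvature (smoothMat_structConn hg hU hT hy) _ _)
        (smoothVec_mulVec (hg.smoothMat_inv hU hy) (smoothVec_const _)) j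
    · exact continuousAt_const
    · exact (contDiffAt_const.mul (ht y hy a)).continuousAt
  have hsys : ∀ y ∈ U, ∀ a i, pd a (jet g V i) y = ∑ j, M a i j y * jet g V j y := by
    rintro y hy a (i | _ | _)
    · have h1 := congrFun (hV.vdd_grad hg hU hT hVs hy (Pi.single a 1)) i
      simp only [Fintype.sum_sum_type, Fintype.sum_bool, M, jet]
      rw [zero_mul, add_zero]
      refine h1.trans ?_
      simp only [Pi.add_apply, Pi.smul_apply, smul_eq_mul, Matrix.mulVec_single_one,
        Matrix.col_apply]
      rw [mul_comm (1 / (n : ℝ) * lap g V y)]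
      rfl
    · simp [Fintype.sum_sum_type, M, jet]
    · have h1 := hV.dd_lap hn hg hU hT hskew hVs hy (Pi.single a 1)
      simp only [Fintype.sum_sum_type, Fintype.sum_bool, M, jet]
      rw [zero_mul, add_zero]
      refine h1.trans ?_
      rw [dotProduct_single_one]
      congr 1
      rw [dotProduct, Finset.mul_sum]
      exact Finset.sum_congr rfl fun j _ => by simp only [grad]; ring
  have := eq_zero_of_linear_system hU hUc
    (fun i y hy => smooth_differentiableAt (hsm i y hy)) M hM hsys hx h0
  exact fun y hy => this y hy (Sum.inr false)

theorem lap_add {V W : Coord n → ℝ} (hV : ∀ᶠ y in 𝓝 x, ContDiffAt ℝ ∞ V y)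
    (hW : ∀ᶠ y in 𝓝 x, ContDiffAt ℝ ∞ W y) :
    lap g (fun y => V y + W y) x = lap g V x + lap g W x := by
  have h1 : ∀ i, pd i (fun y => V y + W y) =ᶠ[𝓝 x] fun y => pd i V y + pd i W y := by
    intro i
    filter_upwards [hV, hW] with y h1 h2
    exact dd_add h1 h2
  simp only [lap, ← Finset.sum_add_distrib, hess]
  refine Finset.sum_congr rfl fun i _ => Finset.sum_congr rfl fun j _ => ?_
  have h2 : pd j (pd i (fun y => V y + W y)) x = pd j (pd i V) x + pd j (pd i W) x := by
    rw [pd_eq_dd, dd_congr (h1 i)]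
    exact dd_add (smooth_dd hV.self_of_nhds) (smooth_dd hW.self_of_nhds)
  rw [h2, ← mul_add]
  simp only [fun i => (h1 i).self_of_nhds, mul_add, Finset.sum_add_distrib]
  ring

theorem lap_smul {V : Coord n → ℝ} (r : ℝ) (hV : ∀ᶠ y in 𝓝 x, ContDiffAt ℝ ∞ V y) :
    lap g (fun y => r * V y) x = r * lap g V x := by
  have h1 : ∀ i, pd i (fun y => r * V y) =ᶠ[𝓝 x] fun y => r * pd i V y := by
    intro i
    filter_upwards [hV] with y h1
    exact dd_const_mul r h1
  simp only [lap, hess, Finset.mul_sum]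
  refine Finset.sum_congr rfl fun i _ => Finset.sum_congr rfl fun j _ => ?_
  have h2 : pd j (pd i (fun y => r * V y)) x = r * pd j (pd i V) x := by
    rw [pd_eq_dd, dd_congr (h1 i)]
    exact dd_const_mul _ (smooth_dd hV.self_of_nhds)
  rw [h2]
  simp only [fun i => (h1 i).self_of_nhds, mul_left_comm _ r, ← Finset.mul_sum]
  ring

/-- On a non-degenerate system the gradient and the Laplacian of a potential can be prescribed
at a point. -/
theorem System.IsNondegenerate.exists_potential (hn : 3 ≤ n) (hU : IsOpen U)
    (hUc : IsConnected U) {S : System n U} (hS : S.IsNondegenerate T)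
    (hskew : HasSkewPart S.g T t U) (ht : ∀ x ∈ U, SmoothVec t x) (hx : x ∈ U) (ξ : Coord n)
    (r : ℝ) : ∃ V ∈ S.potentials, grad V x = ξ ∧ 1 / (n : ℝ) * lap S.g V x = r := by
  have hsm : ∀ V ∈ S.potentials, ∀ y ∈ U, ContDiffAt ℝ ∞ V y := fun V hV y hy =>
    (S.potentials_smooth V hV).contDiffAt (hU.mem_nhds hy)
  have hw : ∀ V ∈ S.potentials, Wilczynski S.g T U V := fun V hV => by
    have : V ∈ (S.potentials : Set (Coord n → ℝ)) := hV
    rw [hS.potentials_eq] at this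
    exact this.2.2
  have hev : ∀ V ∈ S.potentials, ∀ᶠ y in 𝓝 x, ContDiffAt ℝ ∞ V y := fun V hV =>
    (hU.eventually_mem hx).mono (hsm V hV)
  let J : S.potentials →ₗ[ℝ] (Fin n ⊕ Bool → ℝ) :=
    { toFun := fun V i => jet S.g V.1 i x
      map_add' := by
        rintro ⟨V, hV⟩ ⟨W, hW⟩
        ext (i | _ | _)
        · exact dd_add (hsm V hV x hx) (hsm W hW x hx)
        · rfl
        · have := lap_add (g := S.g) (hev V hV) (hev W hW)
          exact (congrArg (fun s => 1 / (n : ℝ) * s) this).trans (mul_add _ _ _)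
      map_smul' := by
        rintro r ⟨V, hV⟩
        ext (i | _ | _)
        · exact dd_const_mul r (hsm V hV x hx)
        · rfl
        · have := lap_smul (g := S.g) r (hev V hV)
          exact (congrArg (fun s => 1 / (n : ℝ) * s) this).trans (mul_left_comm _ _ _) }
  have hinj : Function.Injective J := by
    rw [← LinearMap.ker_eq_bot, LinearMap.ker_eq_bot']
    rintro ⟨V, hV⟩ h0
    have := (hw V hV).eq_zero_of_jet hn S.isMetric hU hUc hS.tensor hskew ht (hsm V hV) hx
      (fun i => congrFun h0 i)
    ext y
    by_cases hy : y ∈ U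
    · exact this y hy
    · exact S.potentials_zero V hV y hy
  have hfin : FiniteDimensional ℝ S.potentials :=
    Module.finite_of_finrank_pos (by rw [hS.finrank_eq]; omega)
  -- The jet map at `x` is injective by unique continuation, and source and target both have
  -- dimension n + 2.
  have hsurj : Function.Surjective J :=
    (LinearMap.injective_iff_surjective_of_finrank_eq_finrank
      (by rw [hS.finrank_eq]; simp)).1 hinj
  obtain ⟨⟨V, hV⟩, hVJ⟩ := hsurj (Sum.elim ξ (fun _ => r))
  refine ⟨V, hV, ?_, congrFun hVJ (Sum.inr true)⟩
  ext i
  exact congrFun hVJ (Sum.inl i)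

/-- Integrability of the Wilczynski equation: the curvature of the modified connection annihilates
vectors orthogonal to its arguments. -/
theorem System.IsNondegenerate.curvature_mulVec (hn : 3 ≤ n) (hU : IsOpen U)
    (hUc : IsConnected U) {S : System n U} (hS : S.IsNondegenerate T)
    (hskew : HasSkewPart S.g T t U) (ht : ∀ x ∈ U, SmoothVec t x) (hx : x ∈ U) {c a k : Coord n}
    (hc : c ⬝ᵥ S.g x *ᵥ k = 0) (ha : a ⬝ᵥ S.g x *ᵥ k = 0) :
    curvature (structConn S.g T) c a x *ᵥ k = 0 := by
  ext i
  -- Potentials realise every gradient, here the i-th coordinate covector. Pairing the integrability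
  -- condition with k then removes the terms in g a and g c.
  obtain ⟨V, hV, hξ, -⟩ := hS.exists_potential hn hU hUc hskew ht hx (Pi.single i 1) 0
  have hV' : V ∈ (S.potentials : Set (Coord n → ℝ)) := hV
  rw [hS.potentials_eq] at hV'
  have h := congrArg (fun w => k ⬝ᵥ w) (hV'.2.2.integrability S.isMetric hU hS.tensor hskew
    (fun y hy => hV'.1.contDiffAt (hU.mem_nhds hy)) hx c a)
  simp only [dotProduct_add, dotProduct_sub, dotProduct_smul, smul_eq_mul, dotProduct_zero] at h
  rw [dot_mulVec_comm (S.isMetric.symm x hx) k, dot_mulVec_comm (S.isMetric.symm x hx) k, hc, ha,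
    transpose_dot, hξ, single_one_dotProduct] at h
  simpa using h

end Potentials

/-! ### The prolongation of the Killing equation -/

section Killing

variable {n : ℕ} {g K : Coord n → Matrix (Fin n) (Fin n) ℝ} {U : Set (Coord n)}
  {T : Coord n → Fin n → Fin n → Fin n → ℝ} {t : Coord n → Coord n} {V W : Coord n → ℝ}
  {x : Coord n}

theorem conn_add (a b : Coord n) : conn g x (a + b) = conn g x a + conn g x b :=
  endForm_add _ _ _

theorem mdd_vadd (a b : Coord n) : mdd (a + b) K x = mdd a K x + mdd b K x := by
  ext i j
  exact dd_vadd a b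

theorem covUp_vadd (a b : Coord n) : covUp g K (a + b) x = covUp g K a x + covUp g K b x := by
  simp only [covUp, mdd_vadd, conn_add, Matrix.transpose_add]
  noncomm_ring

theorem mdd_symm (hU : IsOpen U) (hx : x ∈ U) (hKs : ∀ y ∈ U, (K y).IsSymm) (a : Coord n) :
    (mdd a K x).IsSymm := by
  ext i j
  exact dd_congr ((hU.eventually_mem hx).mono fun y hy => (hKs y hy).apply i j)

theorem covUp_symm (hU : IsOpen U) (hx : x ∈ U) (hKs : ∀ y ∈ U, (K y).IsSymm) (a : Coord n) :
    (covUp g K a x).IsSymm := by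
  simp only [Matrix.IsSymm, covUp, Matrix.transpose_add, Matrix.transpose_mul,
    Matrix.transpose_transpose, (hKs x hx).eq, (mdd_symm hU hx hKs a).eq]
  abel

/-- The Bertrand-Darboux condition. -/
theorem bertrand_darboux (hg : IsMetricOn g U) (hU : IsOpen U) (hT : IsStructureTensor g T U)
    (hVs : ∀ x ∈ U, ContDiffAt ℝ ∞ V x) (hV : Wilczynski g T U V)
    (hK : ∀ x ∈ U, SmoothMat K x) (hKs : ∀ x ∈ U, (K x).IsSymm)
    (hWs : ∀ x ∈ U, ContDiffAt ℝ ∞ W x) (hW : ∀ x ∈ U, grad W x = g x *ᵥ (K x *ᵥ grad V x))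
    (hx : x ∈ U) (a c : Coord n) :
    (g x *ᵥ a) ⬝ᵥ (covUp g K c x + K x * (endForm (T x) c)ᵀ) *ᵥ grad V x =
      (g x *ᵥ c) ⬝ᵥ (covUp g K a x + K x * (endForm (T x) a)ᵀ) *ᵥ grad V x := by
  have hξ := smoothVec_grad (hVs x hx)
  have hgx := hg.smoothMat hU hx
  have key : ∀ a c : Coord n, a ⬝ᵥ vdd c (grad W) x =
      (conn g x c *ᵥ a) ⬝ᵥ (g x *ᵥ (K x *ᵥ grad V x))
      + (g x *ᵥ a) ⬝ᵥ (covUp g K c x + K x * (endForm (T x) c)ᵀ) *ᵥ grad V x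
      + (1 / (n : ℝ) * lap g V x) * ((g x *ᵥ a) ⬝ᵥ K x *ᵥ (g x *ᵥ c)) := by
    intro a c
    rw [vdd_congr ((hU.eventually_mem hx).mono hW),
      vdd_mulVec hgx (smoothVec_mulVec (hK x hx) hξ), vdd_mulVec (hK x hx) hξ,
      hg.mdd_metric hU hx, vdd_grad_eq hg hU hx (hVs x hx), hV.hessM_mulVec hT hx]
    have e : ∀ w : Coord n, a ⬝ᵥ (g x *ᵥ w) = (g x *ᵥ a) ⬝ᵥ w := fun w => by
      rw [dot_mulVec_comm (hg.symm x hx), dotProduct_comm]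
    have e2 : ∀ w : Coord n, (conn g x c *ᵥ a) ⬝ᵥ w = a ⬝ᵥ (conn g x c)ᵀ *ᵥ w := fun w => by
      rw [transpose_dot, dotProduct_comm]
    simp only [covUp, Matrix.add_mulVec, Matrix.mulVec_add, dotProduct_add, Matrix.mulVec_smul,
      dotProduct_smul, smul_eq_mul, ← Matrix.mulVec_mulVec, e, e2]
    ring
  have h1 : a ⬝ᵥ vdd c (grad W) x = c ⬝ᵥ vdd a (grad W) x := by
    rw [vdd_grad (hWs x hx), vdd_grad (hWs x hx), dd_comm (hWs x hx)]
  -- The terms in ΔV cancel because K is symmetric, and the connection terms cancel because the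
  -- connection is torsion-free.
  rw [key, key, hg.conn_comm hU hx c a, dot_mulVec_comm (hKs x hx) (g x *ᵥ a)] at h1
  linarith

/-- The closed first-order system satisfied by the Killing tensors of a non-degenerate system. -/
def KillingEq (g : Coord n → Matrix (Fin n) (Fin n) ℝ) (T : Coord n → Fin n → Fin n → Fin n → ℝ)
    (K : Coord n → Matrix (Fin n) (Fin n) ℝ) (U : Set (Coord n)) : Prop :=
  ∀ x ∈ U, ∀ a : Coord n, (3 : ℝ) • covUp g K a x =
    endForm (T x) (K x *ᵥ (g x *ᵥ a)) * (g x)⁻¹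
      + (endForm (T x) (K x *ᵥ (g x *ᵥ a)) * (g x)⁻¹)ᵀ
      - endForm (T x) a * K x - K x * (endForm (T x) a)ᵀ

/-- Polarisation of ∇_v K(v, v) = 0, using the symmetry of K. -/
theorem killing_cyclic (hg : IsMetricOn g U) (hU : IsOpen U) (hx : x ∈ U)
    (hKs : ∀ x ∈ U, (K x).IsSymm)
    (hkill : ∀ p : Coord n, p ⬝ᵥ mdd ((g x)⁻¹ *ᵥ p) K x *ᵥ p =
        p ⬝ᵥ mdd (K x *ᵥ p) (fun y => (g y)⁻¹) x *ᵥ p) (a i j : Coord n) :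
    (g x *ᵥ i) ⬝ᵥ covUp g K a x *ᵥ (g x *ᵥ j) + (g x *ᵥ a) ⬝ᵥ covUp g K i x *ᵥ (g x *ᵥ j)
      + (g x *ᵥ a) ⬝ᵥ covUp g K j x *ᵥ (g x *ᵥ i) = 0 := by
  have h := dot_covUp_killing hg hU hx hkill (hKs x hx)
  have h1 := h (a + i + j)
  have h2 := h (a + i)
  have h3 := h (a + j)
  have h4 := h (i + j)
  simp only [covUp_vadd, Matrix.mulVec_add, Matrix.add_mulVec, dotProduct_add, add_dotProduct,
    h] at h1 h2 h3 h4
  have e : ∀ w p q : Coord n, p ⬝ᵥ covUp g K w x *ᵥ q = q ⬝ᵥ covUp g K w x *ᵥ p := fun w p q =>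
    dot_mulVec_comm (covUp_symm hU hx hKs w) p q
  rw [e j (g x *ᵥ i) (g x *ᵥ a), e i (g x *ᵥ j) (g x *ᵥ a), e a (g x *ᵥ j) (g x *ᵥ i),
    e i (g x *ᵥ i) (g x *ᵥ a), e j (g x *ᵥ j) (g x *ᵥ a), e a (g x *ᵥ i) (g x *ᵥ a),
    e a (g x *ᵥ j) (g x *ᵥ a), e i (g x *ᵥ j) (g x *ᵥ i), e j (g x *ᵥ j) (g x *ᵥ i)] at h1
  rw [e i (g x *ᵥ i) (g x *ᵥ a), e a (g x *ᵥ i) (g x *ᵥ a)] at h2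
  rw [e j (g x *ᵥ j) (g x *ᵥ a), e a (g x *ᵥ j) (g x *ᵥ a)] at h3
  rw [e i (g x *ᵥ j) (g x *ᵥ i), e j (g x *ᵥ j) (g x *ᵥ i)] at h4
  linarith

theorem eq_of_dot_metric (hg : IsMetricOn g U) (hx : x ∈ U) {A B : Matrix (Fin n) (Fin n) ℝ}
    (h : ∀ i j : Coord n, (g x *ᵥ i) ⬝ᵥ A *ᵥ (g x *ᵥ j) = (g x *ᵥ i) ⬝ᵥ B *ᵥ (g x *ᵥ j)) :
    A = B := by
  ext i j
  have := h ((g x)⁻¹ *ᵥ Pi.single i 1) ((g x)⁻¹ *ᵥ Pi.single j 1)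
  rw [mulVec_inv_mulVec (hg.nondeg x hx), mulVec_inv_mulVec (hg.nondeg x hx)] at this
  simpa only [single_one_dotProduct, Matrix.mulVec_single_one, Matrix.col_apply] using this

/-- Since gradients of potentials are arbitrary at a point, the Bertrand-Darboux condition expresses
∇_c K(a, ·) - ∇_a K(c, ·) through T and K. The Killing equation supplies the cyclic sum of ∇K.
Together they determine ∇K; the factor 3 comes from that cyclic sum. -/
theorem System.IsNondegenerate.killingEq (hn : 3 ≤ n) (hU : IsOpen U)
    (hUc : IsConnected U) {S : System n U} (hS : S.IsNondegenerate T)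
    (hskew : HasSkewPart S.g T t U) (ht : ∀ x ∈ U, SmoothVec t x)
    (hK : ∀ x ∈ U, SmoothMat K x) (hKs : ∀ x ∈ U, (K x).IsSymm)
    (hint : ∀ V ∈ S.potentials, AdmitsIntegral U S.g V K) : KillingEq S.g T K U := by
  intro x hx a
  have hg := S.isMetric
  have hT := hS.tensor
  have hw : ∀ V ∈ S.potentials, ContDiffOn ℝ ∞ V U ∧ Wilczynski S.g T U V := fun V hV => by
    have : V ∈ (S.potentials : Set (Coord n → ℝ)) := hV
    rw [hS.potentials_eq] at this
    exact ⟨this.1, this.2.2⟩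
  have hbd : ∀ a c p : Coord n,
      (S.g x *ᵥ a) ⬝ᵥ (covUp S.g K c x + K x * (endForm (T x) c)ᵀ) *ᵥ p =
      (S.g x *ᵥ c) ⬝ᵥ (covUp S.g K a x + K x * (endForm (T x) a)ᵀ) *ᵥ p := by
    intro a c p
    obtain ⟨V, hV, hξ, -⟩ := hS.exists_potential hn hU hUc hskew ht hx p 0
    have hVs : ∀ x ∈ U, ContDiffAt ℝ ∞ V x := fun y hy =>
      (hw V hV).1.contDiffAt (hU.mem_nhds hy)
    obtain ⟨-, W, hW, hgrad⟩ := (admitsIntegral_iff hg hU hK hKs hVs).1 (hint V hV)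
    have := bertrand_darboux hg hU hT hVs (hw V hV).2 hK hKs
      (fun y hy => hW.contDiffAt (hU.mem_nhds hy)) hgrad hx a c
    rwa [hξ] at this
  obtain ⟨V, hV, -, -⟩ := hS.exists_potential hn hU hUc hskew ht hx 0 0
  have hkill := ((admitsIntegral_iff hg hU hK hKs fun y hy =>
    (hw V hV).1.contDiffAt (hU.mem_nhds hy)).1 (hint V hV)).1 x hx
  refine eq_of_dot_metric hg hx fun i j => ?_
  have hcyc := killing_cyclic hg hU hx hKs hkill a i j
  have b1 := hbd a i (S.g x *ᵥ j)
  have b2 := hbd a j (S.g x *ᵥ i)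
  have e1 : ∀ p q : Coord n, p ⬝ᵥ covUp S.g K a x *ᵥ q = q ⬝ᵥ covUp S.g K a x *ᵥ p :=
    dot_mulVec_comm (covUp_symm hU hx hKs a)
  have e2 : ∀ p q : Coord n, p ⬝ᵥ K x *ᵥ q = q ⬝ᵥ K x *ᵥ p := dot_mulVec_comm (hKs x hx)
  have e3 : ∀ i p : Coord n, (S.g x *ᵥ a) ⬝ᵥ K x *ᵥ ((endForm (T x) i)ᵀ *ᵥ p) =
      p ⬝ᵥ endForm (T x) (K x *ᵥ (S.g x *ᵥ a)) *ᵥ i := by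
    intro i p
    rw [e2, dotProduct_comm, transpose_dot, hT.endForm_comm hx]
  simp only [Matrix.add_mulVec, dotProduct_add, ← Matrix.mulVec_mulVec, e3] at b1 b2
  rw [e1 (S.g x *ᵥ j)] at b2
  simp only [Matrix.add_mulVec, Matrix.sub_mulVec, Matrix.smul_mulVec, dotProduct_add,
    dotProduct_sub, dotProduct_smul, smul_eq_mul, transpose_dot, ← Matrix.mulVec_mulVec,
    inv_mulVec_mulVec (hg.nondeg x hx)]
  have e4 : (S.g x *ᵥ i) ⬝ᵥ endForm (T x) a *ᵥ (K x *ᵥ (S.g x *ᵥ j)) =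
      (S.g x *ᵥ j) ⬝ᵥ K x *ᵥ ((endForm (T x) a)ᵀ *ᵥ (S.g x *ᵥ i)) := by
    conv_rhs => rw [e2, dotProduct_comm, transpose_dot]
  rw [e4]
  linarith

theorem smoothMat_endForm_vec {C : Coord n → Fin n → Fin n → Fin n → ℝ} {w : Coord n → Coord n}
    (hC : ∀ i j k, ContDiffAt ℝ ∞ (fun y => C y i j k) x) (hw : SmoothVec w x) :
    SmoothMat (fun y => endForm (C y) (w y)) x := fun k j => by
  simp only [endForm, Matrix.of_apply]
  exact ContDiffAt.sum fun i _ => (hw i).mul (hC i j k)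

/-- The right-hand side of the Killing system, solved for the partial derivatives. -/
def killingOp (g : Coord n → Matrix (Fin n) (Fin n) ℝ) (T : Coord n → Fin n → Fin n → Fin n → ℝ)
    (x a : Coord n) : Matrix (Fin n) (Fin n) ℝ →ₗ[ℝ] Matrix (Fin n) (Fin n) ℝ where
  toFun A := (1 / 3 : ℝ) • (endForm (T x) (A *ᵥ (g x *ᵥ a)) * (g x)⁻¹
      + (endForm (T x) (A *ᵥ (g x *ᵥ a)) * (g x)⁻¹)ᵀ
      - endForm (T x) a * A - A * (endForm (T x) a)ᵀ) - conn g x a * A - A * (conn g x a)ᵀ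
  map_add' A B := by
    simp only [Matrix.add_mulVec, endForm_add, add_mul, mul_add, Matrix.transpose_add, smul_add,
      smul_sub]
    abel
  map_smul' r A := by
    simp only [Matrix.smul_mulVec, endForm_smul, Matrix.smul_mul, Matrix.mul_smul,
      Matrix.transpose_smul, RingHom.id_apply, smul_sub, smul_add, smul_comm r (1 / 3 : ℝ)]

theorem KillingEq.mdd_eq (hK : KillingEq g T K U) (hx : x ∈ U) (a : Coord n) :
    mdd a K x = killingOp g T x a (K x) := by
  have h := hK x hx a
  simp only [killingOp, LinearMap.coe_mk, AddHom.coe_mk]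
  rw [← h, smul_smul]
  norm_num
  simp only [covUp]
  abel

theorem KillingEq.eq_zero (hg : IsMetricOn g U) (hU : IsOpen U) (hUc : IsConnected U)
    (hT : IsStructureTensor g T U) (hKs : ∀ x ∈ U, SmoothMat K x) (hK : KillingEq g T K U)
    (hx : x ∈ U) (h0 : K x = 0) : ∀ y ∈ U, K y = 0 := by
  have key := eq_zero_of_linear_system (ι := Fin n × Fin n) hU hUc
    (f := fun p y => K y p.1 p.2)
    (fun p y hy => smooth_differentiableAt (hKs y hy p.1 p.2))
    (fun a p q y => killingOp g T y (Pi.single a 1) (Matrix.single q.1 q.2 1) p.1 p.2)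
    ?_ ?_ hx (fun p => by simp [h0])
  · intro y hy
    ext i j
    exact key y hy (i, j)
  · rintro a ⟨i, j⟩ q y hy
    have hgy := hg.smoothMat hU hy
    have hTy : ∀ i j k, ContDiffAt ℝ ∞ (fun z => T z i j k) y := fun i j k =>
      (hT.smooth i j k).contDiffAt (hU.mem_nhds hy)
    have hA := smoothMat_const (n := n) (x := y) (Matrix.single q.1 q.2 (1 : ℝ))
    have h1 := smoothMat_mul (smoothMat_endForm_vec hTy (smoothVec_mulVec hA
      (smoothVec_mulVec hgy (smoothVec_const (Pi.single a 1))))) (hg.smoothMat_inv hU hy)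
    have h2 := hT.smoothMat hU hy (Pi.single a 1)
    have h3 := hg.smoothMat_conn hU hy (Pi.single a 1)
    exact (smoothMat_sub (smoothMat_sub (smoothMat_smul (contDiffAt_const (c := (1 / 3 : ℝ)))
      (smoothMat_sub (smoothMat_sub (smoothMat_add h1 (smoothMat_transpose h1))
        (smoothMat_mul h2 hA)) (smoothMat_mul hA (smoothMat_transpose h2))))
      (smoothMat_mul h3 hA)) (smoothMat_mul hA (smoothMat_transpose h3)) i j).continuousAt
  · rintro y hy a ⟨i, j⟩
    have h1 := congrFun (congrFun (hK.mdd_eq hy (Pi.single a 1)) i) j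
    refine h1.trans ?_
    conv_lhs => rw [Matrix.matrix_eq_sum_single (K y)]
    rw [Fintype.sum_prod_type]
    simp only [map_sum, Matrix.sum_apply]
    refine Finset.sum_congr rfl fun k _ => Finset.sum_congr rfl fun l _ => ?_
    have : Matrix.single k l (K y k l) = K y k l • Matrix.single k l (1 : ℝ) := by
      rw [Matrix.smul_single, smul_eq_mul, mul_one]
    rw [this, map_smul, Matrix.smul_apply, smul_eq_mul, mul_comm]

/-- On an abundant system the value of a Killing tensor can be prescribed at a point. -/
theorem System.IsAbundant.exists_killing (hn : 3 ≤ n) (hU : IsOpen U)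
    (hUc : IsConnected U) {S : System n U} (hS : S.IsAbundant T)
    (hskew : HasSkewPart S.g T t U) (ht : ∀ x ∈ U, SmoothVec t x) (hx : x ∈ U)
    {A : Matrix (Fin n) (Fin n) ℝ} (hA : A.IsSymm) : ∃ K ∈ S.killing, K x = A := by
  have hsm : ∀ K ∈ S.killing, ∀ y ∈ U, SmoothMat K y := fun K hK y hy i j =>
    (S.killing_smooth K hK i j).contDiffAt (hU.mem_nhds hy)
  have hke : ∀ K ∈ S.killing, KillingEq S.g T K U := fun K hK =>
    hS.nondegenerate.killingEq hn hU hUc hskew ht (hsm K hK) (S.killing_symm K hK)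
      fun V hV => S.integral V hV K hK
  -- A symmetric matrix is encoded by a function on unordered pairs, a space of dimension n(n +
  -- 1)/2. Evaluation is injective by unique continuation, hence bijective by the dimension count of
  -- abundance.
  let ev : S.killing →ₗ[ℝ] (Sym2 (Fin n) → ℝ) :=
    { toFun := fun K => Sym2.lift ⟨fun i j => K.1 x i j + K.1 x j i, fun i j => add_comm _ _⟩
      map_add' := by
        rintro ⟨K, hK⟩ ⟨L, hL⟩
        ext s
        induction s using Sym2.ind with
        | _ i j => simp; ring
      map_smul' := by
        rintro r ⟨K, hK⟩
        ext s
        induction s using Sym2.ind with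
        | _ i j => simp; ring }
  have hinj : Function.Injective ev := by
    rw [← LinearMap.ker_eq_bot, LinearMap.ker_eq_bot']
    rintro ⟨K, hK⟩ h0
    have hKx : K x = 0 := by
      ext i j
      have h1 : K x i j + K x j i = 0 := congrFun h0 s(i, j)
      have h2 := (S.killing_symm K hK x hx).apply i j
      simp only [Matrix.zero_apply]
      linarith
    have := (hke K hK).eq_zero S.isMetric hU hUc hS.nondegenerate.tensor (hsm K hK) hx hKx
    ext y i j
    by_cases hy : y ∈ U
    · simp [this y hy]
    · simp [S.killing_zero K hK y hy]
  have hpos : 0 < n * (n + 1) / 2 := Nat.div_pos (by nlinarith) (by norm_num)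
  have hfin : FiniteDimensional ℝ S.killing :=
    Module.finite_of_finrank_pos (by rw [hS.finrank_eq]; exact hpos)
  have hsurj : Function.Surjective ev :=
    (LinearMap.injective_iff_surjective_of_finrank_eq_finrank (by
      rw [hS.finrank_eq, Module.finrank_fintype_fun_eq_card, Sym2.card, Fintype.card_fin,
        Nat.choose_two_right, Nat.add_sub_cancel, mul_comm])).1 hinj
  obtain ⟨⟨K, hK⟩, hKA⟩ := hsurj (Sym2.lift ⟨fun i j => A i j + A j i, fun i j => add_comm _ _⟩)
  refine ⟨K, hK, ?_⟩
  ext i j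
  have h1 : K x i j + K x j i = A i j + A j i := congrFun hKA s(i, j)
  have h2 := (S.killing_symm K hK x hx).apply i j
  have h3 := hA.apply i j
  linarith

theorem covUp_sub {L : Coord n → Matrix (Fin n) (Fin n) ℝ} (hK : SmoothMat K x)
    (hL : SmoothMat L x) (a : Coord n) :
    covUp g (fun y => K y - L y) a x = covUp g K a x - covUp g L a x := by
  simp only [covUp, mdd_sub hK hL]
  noncomm_ring

/-- The Killing tensors of an abundant system are all tensors that give rise to an integral for
each potential. -/
theorem System.IsAbundant.mem_killing (hn : 3 ≤ n) (hU : IsOpen U)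
    (hUc : IsConnected U) {S : System n U} (hS : S.IsAbundant T)
    (hskew : HasSkewPart S.g T t U) (ht : ∀ x ∈ U, SmoothVec t x)
    (hK : ∀ x ∈ U, SmoothMat K x) (hKs : ∀ x ∈ U, (K x).IsSymm) (hK0 : ∀ x ∉ U, K x = 0)
    (hint : ∀ V ∈ S.potentials, AdmitsIntegral U S.g V K) : K ∈ S.killing := by
  obtain ⟨x, hx⟩ := hUc.nonempty
  obtain ⟨L, hL, hLx⟩ := hS.exists_killing hn hU hUc hskew ht hx (hKs x hx)
  have hLs : ∀ y ∈ U, SmoothMat L y := fun y hy i j =>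
    (S.killing_smooth L hL i j).contDiffAt (hU.mem_nhds hy)
  have h1 := hS.nondegenerate.killingEq hn hU hUc hskew ht hK hKs hint
  have h2 := hS.nondegenerate.killingEq hn hU hUc hskew ht hLs (S.killing_symm L hL)
    fun V hV => S.integral V hV L hL
  -- The system is linear, so K minus the Killing tensor L with the same value at `x` vanishes
  -- identically.
  have h3 : KillingEq S.g T (fun y => K y - L y) U := by
    intro y hy a
    rw [covUp_sub (hK y hy) (hLs y hy), smul_sub, h1 y hy, h2 y hy, Matrix.sub_mulVec,
      endForm_sub]
    simp only [sub_mul, mul_sub, Matrix.transpose_sub]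
    abel
  have h4 := h3.eq_zero S.isMetric hU hUc hS.nondegenerate.tensor
    (fun y hy => smoothMat_sub (hK y hy) (hLs y hy)) hx (by rw [hLx, sub_self])
  have : K = L := by
    ext y : 1
    by_cases hy : y ∈ U
    · exact sub_eq_zero.1 (h4 y hy)
    · rw [hK0 y hy, S.killing_zero L hL y hy]
  rwa [this]

end Killing

/-! ### Decomposition of the structure tensor -/

section Decomposition

variable {n : ℕ} {g : Coord n → Matrix (Fin n) (Fin n) ℝ} {U : Set (Coord n)}
  {T s : Coord n → Fin n → Fin n → Fin n → ℝ} {t : Coord n → Coord n} {B : Coord n → ℝ}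
  {x : Coord n}

/-- The trilinear form with components `s i j k`. -/
def cubicForm (s : Fin n → Fin n → Fin n → ℝ) : Coord n →ₗ[ℝ] Coord n →ₗ[ℝ] Coord n →ₗ[ℝ] ℝ :=
  LinearMap.mk₂ ℝ (fun a j => dotProductBilin ℝ ℝ (endForm s a *ᵥ j))
    (fun a b j => by rw [endForm_add, Matrix.add_mulVec, map_add])
    (fun r a j => by rw [endForm_smul, Matrix.smul_mulVec, map_smul])
    (fun a j k => by rw [Matrix.mulVec_add, map_add])
    (fun r a j => by rw [Matrix.mulVec_smul, map_smul])

theorem cubicForm_apply (s : Fin n → Fin n → Fin n → ℝ) (a j k : Coord n) :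
    cubicForm s a j k = k ⬝ᵥ endForm s a *ᵥ j := by
  rw [dotProduct_comm]
  rfl

/-- The endomorphism-valued form with components
`tᵢ δᵏⱼ + tⱼ δᵏᵢ - r tᵏ gᵢⱼ`, contracted with `a`. -/
def traceForm (G : Matrix (Fin n) (Fin n) ℝ) (r : ℝ) (t a : Coord n) : Matrix (Fin n) (Fin n) ℝ :=
  (t ⬝ᵥ a) • (1 : Matrix (Fin n) (Fin n) ℝ) + Matrix.vecMulVec a t
    - r • Matrix.vecMulVec (G⁻¹ *ᵥ t) (G *ᵥ a)

theorem traceForm_mulVec {G : Matrix (Fin n) (Fin n) ℝ} (hG : G.IsSymm) (r : ℝ) (t a b : Coord n) :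
    traceForm G r t a *ᵥ b =
      (t ⬝ᵥ a) • b + (t ⬝ᵥ b) • a - (r * (a ⬝ᵥ G *ᵥ b)) • (G⁻¹ *ᵥ t) := by
  simp only [traceForm, Matrix.sub_mulVec, Matrix.add_mulVec, Matrix.smul_mulVec, Matrix.one_mulVec,
    Matrix.vecMulVec_mulVec, op_smul_eq_smul, smul_smul]
  rw [dotProduct_comm (G *ᵥ a) b, dot_mulVec_comm hG b a]

theorem dot_traceForm_mulVec {G : Matrix (Fin n) (Fin n) ℝ} (hG : G.IsSymm) (hdet : G.det ≠ 0)
    (r : ℝ) (t a b k : Coord n) : (G *ᵥ k) ⬝ᵥ traceForm G r t a *ᵥ b =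
      (t ⬝ᵥ a) * (b ⬝ᵥ G *ᵥ k) + (t ⬝ᵥ b) * (a ⬝ᵥ G *ᵥ k) - r * (a ⬝ᵥ G *ᵥ b) * (t ⬝ᵥ k) := by
  have h : (G *ᵥ k) ⬝ᵥ (G⁻¹ *ᵥ t) = t ⬝ᵥ k := by
    rw [dotProduct_comm, dot_mulVec_comm hG, mulVec_inv_mulVec hdet, dotProduct_comm]
  rw [traceForm_mulVec hG, dotProduct_sub, dotProduct_add, dotProduct_smul, dotProduct_smul,
    dotProduct_smul, h, dotProduct_comm (G *ᵥ k) b, dotProduct_comm (G *ᵥ k) a]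
  simp only [smul_eq_mul]

/-- The decomposition of the structure tensor into a totally symmetric trace-free part `s` and
a trace part determined by the covector `t`. -/
structure HasDecomposition (g : Coord n → Matrix (Fin n) (Fin n) ℝ)
    (T s : Coord n → Fin n → Fin n → Fin n → ℝ) (t : Coord n → Coord n) (U : Set (Coord n)) :
    Prop where
  smooth : ∀ x ∈ U, SmoothVec t x
  symm₁ : ∀ x ∈ U, ∀ a b c, cubicForm (s x) a b c = cubicForm (s x) b a c
  symm₂ : ∀ x ∈ U, ∀ a b c, cubicForm (s x) a b c = cubicForm (s x) a c b
  lower : ∀ x ∈ U, ∀ a b k : Coord n, (g x *ᵥ k) ⬝ᵥ endForm (T x) a *ᵥ b =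
    cubicForm (s x) a b k + (g x *ᵥ k) ⬝ᵥ traceForm (g x) (2 / n) (t x) a *ᵥ b

/-- The totally symmetric part drops out, and skew-symmetrising the trace part t_i g_jk + t_j g_ik -
(2/n) t_k g_ij in i and k leaves the factor 1 + 2/n. -/
theorem HasDecomposition.hasSkewPart (h : HasDecomposition g T s t U) (hg : IsMetricOn g U) :
    HasSkewPart g T t U := by
  intro x hx a c
  have hG := hg.symm x hx
  refine dotProduct_eq _ _ fun j => ?_
  rw [dotProduct_comm, dotProduct_comm _ j]
  simp only [dotProduct_sub, dotProduct_smul, smul_eq_mul, transpose_dot, h.lower x hx,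
    dot_traceForm_mulVec hG (hg.nondeg x hx)]
  rw [h.symm₂ x hx a j c, h.symm₁ x hx a c j, h.symm₂ x hx c a j, dot_mulVec_comm hG c a,
    dot_mulVec_comm hG j a, dot_mulVec_comm hG j c]
  ring

theorem sum_single_dot (p q : Coord n) :
    ∑ b, (p ⬝ᵥ Pi.single b 1) * (q ⬝ᵥ Pi.single b 1) = p ⬝ᵥ q := by
  simp only [dotProduct_single_one]
  rfl

/-- The coefficient 2/n makes the trace part trace-free in its first two indices. Since T is too, so
is the cubic part. -/
theorem HasDecomposition.trace (hn : 3 ≤ n) (h : HasDecomposition g T s t U) (hg : IsMetricOn g U)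
    (hT : IsStructureTensor g T U) (hx : x ∈ U) (z : Coord n) :
    ∑ b, cubicForm (s x) (Pi.single b 1) ((g x)⁻¹ *ᵥ Pi.single b 1) z = 0 := by
  have hG := hg.symm x hx
  have hGi : (g x)⁻¹.IsSymm := by rw [Matrix.IsSymm, Matrix.transpose_nonsing_inv, hG.eq]
  have hd := hg.nondeg x hx
  have h1 : ∑ b, endForm (T x) (Pi.single b 1) *ᵥ ((g x)⁻¹ *ᵥ Pi.single b 1) = 0 := by
    ext k
    rw [Finset.sum_apply, Pi.zero_apply, ← hT.tracefree x hx k]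
    refine Finset.sum_congr rfl fun b _ => ?_
    simp only [endForm, Matrix.mulVec, dotProduct, Matrix.of_apply, Pi.single_apply, ite_mul,
      one_mul, zero_mul, mul_ite, mul_one, mul_zero, Finset.sum_ite_eq', Finset.mem_univ, if_true]
    refine Finset.sum_congr rfl fun j _ => ?_
    rw [mul_comm, hGi.apply]
  have h2 : ∀ b : Fin n, cubicForm (s x) (Pi.single b 1) ((g x)⁻¹ *ᵥ Pi.single b 1) z =
      (g x *ᵥ z) ⬝ᵥ endForm (T x) (Pi.single b 1) *ᵥ ((g x)⁻¹ *ᵥ Pi.single b 1)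
      - ((t x ⬝ᵥ Pi.single b 1) * (z ⬝ᵥ Pi.single b 1)
        + (((g x)⁻¹ *ᵥ t x) ⬝ᵥ Pi.single b 1) * ((g x *ᵥ z) ⬝ᵥ Pi.single b 1))
      + 2 / n * (t x ⬝ᵥ z) := by
    intro b
    have e1 : ((g x)⁻¹ *ᵥ Pi.single b 1) ⬝ᵥ (g x *ᵥ z) = z ⬝ᵥ Pi.single b 1 := by
      rw [dotProduct_comm, dot_mulVec_comm hGi, inv_mulVec_mulVec hd, dotProduct_comm]
    have e2 : t x ⬝ᵥ ((g x)⁻¹ *ᵥ Pi.single b 1) = ((g x)⁻¹ *ᵥ t x) ⬝ᵥ Pi.single b 1 := by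
      rw [dot_mulVec_comm hGi, dotProduct_comm]
    have e3 : Pi.single b 1 ⬝ᵥ (Pi.single b (1 : ℝ) : Coord n) = 1 := by simp
    rw [h.lower x hx, dot_traceForm_mulVec hG hd, mulVec_inv_mulVec hd, e1, e2, e3,
      dotProduct_comm (Pi.single b 1)]
    ring
  have h3 : ((g x)⁻¹ *ᵥ t x) ⬝ᵥ (g x *ᵥ z) = t x ⬝ᵥ z := by
    rw [dotProduct_comm, dot_mulVec_comm hGi, inv_mulVec_mulVec hd]
  have hn0 : (n : ℝ) ≠ 0 := by positivity
  simp only [h2, Finset.sum_add_distrib, Finset.sum_sub_distrib, sum_single_dot, h3,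
    ← dotProduct_sum, h1, dotProduct_zero, Finset.sum_const, Finset.card_univ, Fintype.card_fin,
    nsmul_eq_mul]
  field_simp
  ring

theorem smooth_scalarCurv (hg : IsMetricOn g U) (hU : IsOpen U) (hx : x ∈ U) :
    ContDiffAt ℝ ∞ (scalarCurv g) x := by
  have hc := hg.smooth_christoffel hU hx
  unfold scalarCurv riemann
  exact ContDiffAt.sum fun k _ => ContDiffAt.sum fun j _ => (hg.smoothMat_inv hU hx k j).mul
    (ContDiffAt.sum fun i _ => ((smooth_dd (hc i j k)).sub (smooth_dd (hc i i k))).add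
      (ContDiffAt.sum fun m _ => ((hc i i m).mul (hc m j k)).sub ((hc i j m).mul (hc m i k))))

/-- The covector field `t = w / (n + 2)` determined by a structure function. -/
def traceCovector (g : Coord n → Matrix (Fin n) (Fin n) ℝ) (B : Coord n → ℝ) (x : Coord n) :
    Coord n := fun c => (1 / ((n : ℝ) + 2)) * (pd c (lap g B) x
        + 2 * ((n : ℝ) + 1) / ((n : ℝ) * ((n : ℝ) - 1)) * scalarCurv g x * pd c B x)

/-- The totally symmetric trace-free part of the third covariant derivative. -/
def symmThird (g : Coord n → Matrix (Fin n) (Fin n) ℝ) (B : Coord n → ℝ) (x : Coord n) :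
    Fin n → Fin n → Fin n → ℝ :=
  tracefree3 (g x) (symmetrize (fun a b c => third g B a b c x))

theorem symmetrize_swap₁ (A : Fin n → Fin n → Fin n → ℝ) (i j k : Fin n) :
    symmetrize A i j k = symmetrize A j i k := by
  simp only [symmetrize]; ring

theorem symmetrize_swap₂ (A : Fin n → Fin n → Fin n → ℝ) (i j k : Fin n) :
    symmetrize A i j k = symmetrize A i k j := by
  simp only [symmetrize]; ring

theorem tracefree3_swap₁ {G : Matrix (Fin n) (Fin n) ℝ} (hG : G.IsSymm)
    {A : Fin n → Fin n → Fin n → ℝ} (hA : ∀ i j k, A i j k = A j i k) (i j k : Fin n) :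
    tracefree3 G A i j k = tracefree3 G A j i k := by
  simp only [tracefree3]
  rw [hA i j k, hG.apply j i, hG.apply k j, hG.apply k i]
  ring

theorem tracefree3_swap₂ {G : Matrix (Fin n) (Fin n) ℝ} (hG : G.IsSymm)
    {A : Fin n → Fin n → Fin n → ℝ} (hA : ∀ i j k, A i j k = A i k j) (i j k : Fin n) :
    tracefree3 G A i j k = tracefree3 G A i k j := by
  simp only [tracefree3]
  rw [hA i j k, hG.apply j i, hG.apply k j, hG.apply k i]
  ring

theorem cubicForm_eq_sum (s : Fin n → Fin n → Fin n → ℝ) (a b c : Coord n) :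
    cubicForm s a b c = ∑ i, ∑ j, ∑ k, s i j k * (a i * b j * c k) := by
  rw [cubicForm_apply, dot_endForm_mulVec]

theorem cubicForm_swap₁ {s : Fin n → Fin n → Fin n → ℝ} (hs : ∀ i j k, s i j k = s j i k)
    (a b c : Coord n) : cubicForm s a b c = cubicForm s b a c := by
  rw [cubicForm_eq_sum, cubicForm_eq_sum, Finset.sum_comm]
  refine Finset.sum_congr rfl fun i _ => Finset.sum_congr rfl fun j _ =>
    Finset.sum_congr rfl fun k _ => ?_
  rw [hs]; ring

theorem cubicForm_swap₂ {s : Fin n → Fin n → Fin n → ℝ} (hs : ∀ i j k, s i j k = s i k j)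
    (a b c : Coord n) : cubicForm s a b c = cubicForm s a c b := by
  rw [cubicForm_eq_sum, cubicForm_eq_sum]
  refine Finset.sum_congr rfl fun i _ => ?_
  rw [Finset.sum_comm]
  refine Finset.sum_congr rfl fun j _ => Finset.sum_congr rfl fun k _ => ?_
  rw [hs]; ring

theorem IsStructureFunction.hasDecomposition (hB : IsStructureFunction g T U B)
    (hg : IsMetricOn g U) (hU : IsOpen U) :
    HasDecomposition g T (symmThird g B) (traceCovector g B) U where
  smooth x hx c := by
    have hBx := hB.1.contDiffAt (hU.mem_nhds hx)
    exact contDiffAt_const.mul ((smooth_dd (smooth_lap hg hU hx hBx)).add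
      ((contDiffAt_const.mul (smooth_scalarCurv hg hU hx)).mul (smooth_dd hBx)))
  symm₁ x hx := cubicForm_swap₁ (tracefree3_swap₁ (hg.symm x hx) (symmetrize_swap₁ _))
  symm₂ x hx := cubicForm_swap₂ (tracefree3_swap₂ (hg.symm x hx) (symmetrize_swap₂ _))
  lower x hx a b k := by
    have hG := hg.symm x hx
    have h1 : g x * endForm (T x) a = endForm (symmThird g B x) a
        + ((traceCovector g B x ⬝ᵥ a) • g x
          + Matrix.vecMulVec (g x *ᵥ a) (traceCovector g B x)
          - (2 / (n : ℝ)) • Matrix.vecMulVec (traceCovector g B x) (g x *ᵥ a)) := by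
      ext l j
      have e : ∀ i, ∑ m, T x i j m * g x m l = symmThird g B x i j l
          + (g x l j * traceCovector g B x i + g x l i * traceCovector g B x j
            - (2 / (n : ℝ)) * g x j i * traceCovector g B x l) := fun i => by
        rw [hG.apply i l, hG.apply j l, hG.apply i j]
        refine (hB.2 x hx i j l).trans ?_
        simp only [symmThird, traceCovector]
        ring
      have e2 : (g x * endForm (T x) a) l j = ∑ i, a i * ∑ m, T x i j m * g x m l := by
        simp only [Matrix.mul_apply, endForm, Matrix.of_apply, Finset.mul_sum]
        rw [Finset.sum_comm]
        refine Finset.sum_congr rfl fun i _ => Finset.sum_congr rfl fun m _ => ?_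
        rw [hG.apply m l]
        ring
      rw [e2]
      simp only [e, Matrix.add_apply, Matrix.sub_apply, Matrix.smul_apply, Matrix.vecMulVec_apply,
        endForm, Matrix.of_apply, Matrix.mulVec, dotProduct, smul_eq_mul, mul_add, mul_sub,
        Finset.sum_add_distrib, Finset.sum_sub_distrib, Finset.sum_mul, Finset.mul_sum]
      congr 2
      · congr 1 <;> exact Finset.sum_congr rfl fun i _ => by ring
      · exact Finset.sum_congr rfl fun i _ => by ring
    have h2 : (g x *ᵥ k) ⬝ᵥ endForm (T x) a *ᵥ b = k ⬝ᵥ (g x * endForm (T x) a) *ᵥ b := by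
      rw [← Matrix.mulVec_mulVec, dot_mulVec_comm hG, dotProduct_comm]
    rw [h2, h1, cubicForm_apply, dot_traceForm_mulVec hG (hg.nondeg x hx), Matrix.add_mulVec,
      dotProduct_add]
    simp only [Matrix.sub_mulVec, Matrix.add_mulVec, Matrix.smul_mulVec, Matrix.vecMulVec_mulVec,
      op_smul_eq_smul, dotProduct_add, dotProduct_sub, dotProduct_smul, smul_eq_mul]
    rw [dot_mulVec_comm hG b k, dot_mulVec_comm hG a k, dotProduct_comm (g x *ᵥ a) b,
      dot_mulVec_comm hG b a, dotProduct_comm k (traceCovector g B x)]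
    ring

end Decomposition

/-! ### Integrability conditions of the Killing system -/

section KillingIntegrability

variable {n : ℕ} {g K : Coord n → Matrix (Fin n) (Fin n) ℝ} {U : Set (Coord n)}
  {T s : Coord n → Fin n → Fin n → Fin n → ℝ} {t : Coord n → Coord n} {x : Coord n}

/-- The covariant derivative of an endomorphism-valued one-form. -/
def covEnd (g : Coord n → Matrix (Fin n) (Fin n) ℝ)
    (F : Coord n → Coord n → Matrix (Fin n) (Fin n) ℝ) (c a x : Coord n) :
    Matrix (Fin n) (Fin n) ℝ :=
  mdd c (fun y => F y a) x + conn g x c * F x a - F x a * conn g x c - F x (conn g x c *ᵥ a)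

theorem mdd_endForm_vec {C : Coord n → Fin n → Fin n → Fin n → ℝ} {w : Coord n → Coord n}
    (hC : ∀ i j k, ContDiffAt ℝ ∞ (fun y => C y i j k) x) (hw : SmoothVec w x) (c : Coord n) :
    mdd c (fun y => endForm (C y) (w y)) x =
      mdd c (fun y => endForm (C y) (w x)) x + endForm (C x) (vdd c w x) := by
  ext k j
  simp only [mdd, endForm, Matrix.of_apply, Matrix.add_apply, vdd]
  rw [dd_sum _ fun i _ => (hw i).mul (hC i j k), dd_sum _ fun i _ => contDiffAt_const.mul (hC i j k),
    ← Finset.sum_add_distrib]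
  refine Finset.sum_congr rfl fun i _ => ?_
  rw [dd_mul (hw i) (hC i j k), dd_const_mul _ (hC i j k)]
  ring

/-- The right-hand side of the Killing system is H + Hᵀ; this is the covariant derivative of H, by
the product rule with the metric parallel. -/
theorem mdd_killing_half (hg : IsMetricOn g U) (hU : IsOpen U) (hT : IsStructureTensor g T U)
    (hK : SmoothMat K x) (hx : x ∈ U) (c a : Coord n) :
    mdd c (fun y => endForm (T y) (K y *ᵥ (g y *ᵥ a)) * (g y)⁻¹ - endForm (T y) a * K y) x
      + conn g x c * (endForm (T x) (K x *ᵥ (g x *ᵥ a)) * (g x)⁻¹ - endForm (T x) a * K x)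
      + (endForm (T x) (K x *ᵥ (g x *ᵥ a)) * (g x)⁻¹ - endForm (T x) a * K x) * (conn g x c)ᵀ =
    (covEnd g (fun y => endForm (T y)) c (K x *ᵥ (g x *ᵥ a)) x
        + endForm (T x) (covUp g K c x *ᵥ (g x *ᵥ a))
        + endForm (T x) (K x *ᵥ (g x *ᵥ (conn g x c *ᵥ a)))) * (g x)⁻¹
      - covEnd g (fun y => endForm (T y)) c a x * K x - endForm (T x) (conn g x c *ᵥ a) * K x
      - endForm (T x) a * covUp g K c x := by
  have hTx : ∀ i j k, ContDiffAt ℝ ∞ (fun z => T z i j k) x := fun i j k =>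
      (hT.smooth i j k).contDiffAt (hU.mem_nhds hx)
  have hgx := hg.smoothMat hU hx
  have hga := smoothVec_mulVec hgx (smoothVec_const a)
  have hw := smoothVec_mulVec hK hga
  rw [mdd_sub (smoothMat_mul (smoothMat_endForm_vec hTx hw) (hg.smoothMat_inv hU hx))
      (smoothMat_mul (hT.smoothMat hU hx a) hK),
    mdd_mul (smoothMat_endForm_vec hTx hw) (hg.smoothMat_inv hU hx),
    mdd_mul (hT.smoothMat hU hx a) hK, mdd_endForm_vec hTx hw, hg.mdd_inv_metric hU hx,
    vdd_mulVec hK hga, vdd_mulVec hgx (smoothVec_const a), vdd_const, Matrix.mulVec_zero, add_zero,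
    hg.mdd_metric hU hx]
  have e : mdd c K x *ᵥ (g x *ᵥ a)
      + K x *ᵥ (((conn g x c)ᵀ * g x + g x * conn g x c) *ᵥ a) =
      covUp g K c x *ᵥ (g x *ᵥ a) + K x *ᵥ (g x *ᵥ (conn g x c *ᵥ a))
        - conn g x c *ᵥ (K x *ᵥ (g x *ᵥ a)) := by
    simp only [covUp, Matrix.add_mulVec, Matrix.mulVec_add, ← Matrix.mulVec_mulVec]
    abel
  rw [e, endForm_sub, endForm_add]
  simp only [covEnd]
  rw [show covUp g K c x = mdd c K x + conn g x c * K x + K x * (conn g x c)ᵀ from rfl]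
  noncomm_ring

theorem smoothMat_covUp (hg : IsMetricOn g U) (hU : IsOpen U) (hK : SmoothMat K x) (hx : x ∈ U)
    (a : Coord n) : SmoothMat (covUp g K a) x :=
  smoothMat_add (smoothMat_add (smoothMat_mdd hK) (smoothMat_mul (hg.smoothMat_conn hU hx a) hK))
    (smoothMat_mul hK (smoothMat_transpose (hg.smoothMat_conn hU hx a)))

/-- The Ricci identity. For constant coefficient vectors the terms in ∇_{∇_c a} cancel by
torsion-freeness and are left out. -/
theorem covUp_commutator (hg : IsMetricOn g U) (hU : IsOpen U) (hK : SmoothMat K x) (hx : x ∈ U)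
    (c a : Coord n) :
    mdd c (covUp g K a) x + conn g x c * covUp g K a x + covUp g K a x * (conn g x c)ᵀ
      - (mdd a (covUp g K c) x + conn g x a * covUp g K c x + covUp g K c x * (conn g x a)ᵀ) =
    curvature (conn g) c a x * K x + K x * (curvature (conn g) c a x)ᵀ := by
  have h : ∀ c a : Coord n, mdd c (covUp g K a) x = mdd c (mdd a K) x
      + (mdd c (fun y => conn g y a) x * K x + conn g x a * mdd c K x)
      + (mdd c K x * (conn g x a)ᵀ + K x * (mdd c (fun y => conn g y a) x)ᵀ) := by
    intro c a
    have h1 := hg.smoothMat_conn hU hx a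
    unfold covUp
    rw [mdd_add (smoothMat_add (smoothMat_mdd hK) (smoothMat_mul h1 hK))
      (smoothMat_mul hK (smoothMat_transpose h1)), mdd_add (smoothMat_mdd hK) (smoothMat_mul h1 hK),
      mdd_mul h1 hK, mdd_mul hK (smoothMat_transpose h1), mdd_transpose]
  rw [h, h, mdd_comm hK]
  simp only [covUp, curvature, Matrix.transpose_add, Matrix.transpose_sub, Matrix.transpose_mul]
  noncomm_ring

/-- The terms of the integrability condition of the Killing system. -/
def killingDefect (g : Coord n → Matrix (Fin n) (Fin n) ℝ)
    (T : Coord n → Fin n → Fin n → Fin n → ℝ) (K : Coord n → Matrix (Fin n) (Fin n) ℝ)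
    (c a x : Coord n) : Matrix (Fin n) (Fin n) ℝ :=
  (covEnd g (fun y => endForm (T y)) c (K x *ᵥ (g x *ᵥ a)) x
      + endForm (T x) (covUp g K c x *ᵥ (g x *ᵥ a))) * (g x)⁻¹
    - covEnd g (fun y => endForm (T y)) c a x * K x - endForm (T x) a * covUp g K c x

/-- The Killing system is differentiated once more and antisymmetrised; the left-hand side of the
system becomes curvature by the Ricci identity. -/
theorem KillingEq.integrability (hg : IsMetricOn g U) (hU : IsOpen U)
    (hT : IsStructureTensor g T U) (hK : ∀ x ∈ U, SmoothMat K x) (hKs : ∀ x ∈ U, (K x).IsSymm)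
    (hKe : KillingEq g T K U) (hx : x ∈ U) (c a : Coord n) :
    killingDefect g T K c a x + (killingDefect g T K c a x)ᵀ
      - (killingDefect g T K a c x + (killingDefect g T K a c x)ᵀ) =
    (3 : ℝ) • (curvature (conn g) c a x * K x + K x * (curvature (conn g) c a x)ᵀ) := by
  let H : Coord n → Coord n → Matrix (Fin n) (Fin n) ℝ := fun a y =>
    endForm (T y) (K y *ᵥ (g y *ᵥ a)) * (g y)⁻¹ - endForm (T y) a * K y
  have hTx : ∀ i j k, ContDiffAt ℝ ∞ (fun z => T z i j k) x := fun i j k =>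
      (hT.smooth i j k).contDiffAt (hU.mem_nhds hx)
  have hH : ∀ a, SmoothMat (H a) x := fun a =>
    smoothMat_sub (smoothMat_mul (smoothMat_endForm_vec hTx (smoothVec_mulVec (hK x hx)
      (smoothVec_mulVec (hg.smoothMat hU hx) (smoothVec_const a)))) (hg.smoothMat_inv hU hx))
      (smoothMat_mul (hT.smoothMat hU hx a) (hK x hx))
  have hN : ∀ a, ∀ y ∈ U, (3 : ℝ) • covUp g K a y = H a y + (H a y)ᵀ := by
    intro a y hy
    rw [hKe y hy a]
    simp only [H, Matrix.transpose_sub, Matrix.transpose_mul, (hKs y hy).eq]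
    abel
  have hD : ∀ c a, (3 : ℝ) • (mdd c (covUp g K a) x + conn g x c * covUp g K a x
      + covUp g K a x * (conn g x c)ᵀ) =
      (mdd c (H a) x + conn g x c * H a x + H a x * (conn g x c)ᵀ)
      + (mdd c (H a) x + conn g x c * H a x + H a x * (conn g x c)ᵀ)ᵀ := by
    intro c a
    have h1 : (3 : ℝ) • mdd c (covUp g K a) x = mdd c (H a) x + (mdd c (H a) x)ᵀ := by
      have := mdd_congr (v := c) ((hU.eventually_mem hx).mono (hN a))
      rw [mdd_add (hH a) (smoothMat_transpose (hH a)), mdd_transpose] at this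
      rw [← this]
      ext i j
      exact (dd_const_mul _ (smoothMat_covUp hg hU (hK x hx) hx a i j)).symm
    rw [smul_add, smul_add, h1, ← Matrix.mul_smul, ← Matrix.smul_mul, hN a x hx]
    simp only [Matrix.transpose_add, Matrix.transpose_mul, Matrix.transpose_transpose]
    noncomm_ring
  rw [← covUp_commutator hg hU (hK x hx) hx, smul_sub, hD, hD, mdd_killing_half hg hU hT (hK x hx) hx,
    mdd_killing_half hg hU hT (hK x hx) hx, hg.conn_comm hU hx c a]
  simp only [killingDefect, add_mul, Matrix.transpose_add, Matrix.transpose_sub]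
  abel

theorem covEnd_endForm_smul {C : Coord n → Fin n → Fin n → Fin n → ℝ}
    (hC : ∀ i j k, ContDiffAt ℝ ∞ (fun y => C y i j k) x) (c a : Coord n) (r : ℝ) :
    covEnd g (fun y => endForm (C y)) c (r • a) x = r • covEnd g (fun y => endForm (C y)) c a x := by
  have h : mdd c (fun y => endForm (C y) (r • a)) x = r • mdd c (fun y => endForm (C y) a) x := by
    simp only [endForm_smul]
    rw [mdd_smul contDiffAt_const (smoothMat_endForm hC a), dd_const, zero_smul, zero_add]
  unfold covEnd
  rw [h]
  simp only [endForm_smul, Matrix.mulVec_smul, Matrix.mul_smul, Matrix.smul_mul, smul_sub, smul_add]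

theorem covEnd_endForm_zero {C : Coord n → Fin n → Fin n → Fin n → ℝ}
    (hC : ∀ i j k, ContDiffAt ℝ ∞ (fun y => C y i j k) x) (c : Coord n) :
    covEnd g (fun y => endForm (C y)) c 0 x = 0 := by
  simpa using covEnd_endForm_smul (g := g) hC c 0 0

theorem IsStructureTensor.covEnd_comm (hT : IsStructureTensor g T U) (hU : IsOpen U) (hx : x ∈ U)
    (c a b : Coord n) : covEnd g (fun y => endForm (T y)) c a x *ᵥ b =
      covEnd g (fun y => endForm (T y)) c b x *ᵥ a := by
  have h : ∀ a b : Coord n, mdd c (fun y => endForm (T y) a) x *ᵥ b =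
      vdd c (fun y => endForm (T y) a *ᵥ b) x := fun a b => by
    rw [vdd_mulVec (hT.smoothMat hU hx a) (smoothVec_const b), vdd_const, Matrix.mulVec_zero,
      add_zero]
  have h2 := vdd_congr (v := c) ((hU.eventually_mem hx).mono fun y hy => hT.endForm_comm hy a b)
  simp only [covEnd, Matrix.sub_mulVec, Matrix.add_mulVec, h, h2, ← Matrix.mulVec_mulVec]
  rw [hT.endForm_comm hx a b, hT.endForm_comm hx a, hT.endForm_comm hx (conn g x c *ᵥ a)]
  abel

theorem covUp_of_orthogonal (hKe : KillingEq g T K U) (hx : x ∈ U)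
    {a : Coord n} (ha : K x *ᵥ (g x *ᵥ a) = 0) :
    (3 : ℝ) • covUp g K a x = -(endForm (T x) a * K x) - K x * (endForm (T x) a)ᵀ := by
  have h0 : endForm (T x) 0 = 0 := by simpa using endForm_smul (T x) 0 0
  rw [hKe x hx a, ha, h0]
  simp

theorem vecMulVec_mulVec' (a b c : Coord n) : Matrix.vecMulVec a b *ᵥ c = (b ⬝ᵥ c) • a := by
  rw [Matrix.vecMulVec_mulVec, op_smul_eq_smul]

/-- For K = k ⊗ k and a, c ⊥ k, the contractions of K with a and c vanish and the curvature terms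
disappear. The terms with g⁻¹ cancel between (c, a) and (a, c) by the skew-part condition. What
survives is X k ⊗ k + k ⊗ X k = 0, hence X k = 0. -/
theorem KillingEq.commutator (hg : IsMetricOn g U) (hU : IsOpen U)
    (hT : IsStructureTensor g T U) (hskew : HasSkewPart g T t U)
    (hK : ∀ x ∈ U, SmoothMat K x) (hKs : ∀ x ∈ U, (K x).IsSymm)
    (hKe : KillingEq g T K U) (hx : x ∈ U) {k a c : Coord n} (hk : k ≠ 0)
    (hKx : K x = Matrix.vecMulVec k k) (hak : a ⬝ᵥ g x *ᵥ k = 0) (hck : c ⬝ᵥ g x *ᵥ k = 0)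
    (hR : curvature (conn g) c a x *ᵥ k = 0) :
    (endForm (T x) a * endForm (T x) c - endForm (T x) c * endForm (T x) a) *ᵥ k =
      (3 : ℝ) • ((covEnd g (fun y => endForm (T y)) c a x
        - covEnd g (fun y => endForm (T y)) a c x) *ᵥ k) := by
  have hG := hg.symm x hx
  have hTx : ∀ i j k, ContDiffAt ℝ ∞ (fun z => T z i j k) x := fun i j k =>
      (hT.smooth i j k).contDiffAt (hU.mem_nhds hx)
  have hK0 : ∀ a : Coord n, a ⬝ᵥ g x *ᵥ k = 0 → K x *ᵥ (g x *ᵥ a) = 0 := fun a ha => by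
    rw [hKx, vecMulVec_mulVec', dot_mulVec_comm hG, ha, zero_smul]
  have hN : ∀ a c : Coord n, a ⬝ᵥ g x *ᵥ k = 0 → c ⬝ᵥ g x *ᵥ k = 0 →
      (3 : ℝ) • (covUp g K c x *ᵥ (g x *ᵥ a)) =
        -((g x *ᵥ a) ⬝ᵥ endForm (T x) c *ᵥ k) • k := by
    intro a c ha hc
    rw [← Matrix.smul_mulVec, covUp_of_orthogonal hKe hx (hK0 c hc), Matrix.sub_mulVec,
      Matrix.neg_mulVec, ← Matrix.mulVec_mulVec, hK0 a ha, Matrix.mulVec_zero, neg_zero, zero_sub,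
      ← Matrix.mulVec_mulVec, hKx, vecMulVec_mulVec', transpose_dot, neg_smul]
  have hsym : (g x *ᵥ a) ⬝ᵥ endForm (T x) c *ᵥ k = (g x *ᵥ c) ⬝ᵥ endForm (T x) a *ᵥ k := by
    have h := congrArg (k ⬝ᵥ ·) (hskew x hx a c)
    simp only [dotProduct_sub, dotProduct_smul, transpose_dot, dot_mulVec_comm hG k, hak, hck,
      smul_zero, sub_zero] at h
    linarith
  have hM : ∀ a c : Coord n, a ⬝ᵥ g x *ᵥ k = 0 → c ⬝ᵥ g x *ᵥ k = 0 →
      (3 : ℝ) • killingDefect g T K c a x =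
        -((g x *ᵥ a) ⬝ᵥ endForm (T x) c *ᵥ k) • (endForm (T x) k * (g x)⁻¹)
        - (3 : ℝ) • (covEnd g (fun y => endForm (T y)) c a x * K x)
        + endForm (T x) a * endForm (T x) c * K x
        + endForm (T x) a * K x * (endForm (T x) c)ᵀ := by
    intro a c ha hc
    rw [killingDefect, hK0 a ha, covEnd_endForm_zero hTx, zero_add, smul_sub, smul_sub,
      ← Matrix.smul_mul 3 (endForm _ _), ← endForm_smul, hN a c ha hc, endForm_smul,
      ← Matrix.mul_smul _ 3 (covUp _ _ _ _), covUp_of_orthogonal hKe hx (hK0 c hc),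
      Matrix.smul_mul]
    noncomm_ring
  have hRK : curvature (conn g) c a x * K x = 0 := by
    rw [hKx, Matrix.mul_vecMulVec, hR, Matrix.zero_vecMulVec]
  have hKR : K x * (curvature (conn g) c a x)ᵀ = 0 := by
    rw [← (hKs x hx).eq, ← Matrix.transpose_mul, hRK, Matrix.transpose_zero]
  have h := congrArg ((3 : ℝ) • ·) (hKe.integrability hg hU hT hK hKs hx c a)
  simp only [hRK, hKR, add_zero, smul_zero, smul_sub, smul_add, ← Matrix.transpose_smul] at h
  rw [hM a c hak hck, hM c a hck hak, hsym] at h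
  set X := (endForm (T x) a * endForm (T x) c - endForm (T x) c * endForm (T x) a)
    - (3 : ℝ) • (covEnd g (fun y => endForm (T y)) c a x
        - covEnd g (fun y => endForm (T y)) a c x) with hX
  have h2 : X * K x + (X * K x)ᵀ = 0 := by
    rw [← h, hX]
    simp only [sub_mul, Matrix.smul_mul, Matrix.transpose_sub, Matrix.transpose_add,
      Matrix.transpose_smul, Matrix.transpose_mul, Matrix.transpose_transpose, (hKs x hx).eq,
      smul_sub, mul_assoc]
    abel
  rw [hKx, Matrix.mul_vecMulVec, Matrix.transpose_vecMulVec] at h2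
  have h3 := eq_zero_of_symm_vecMulVec hk h2
  rw [hX, Matrix.sub_mulVec, Matrix.smul_mulVec, sub_eq_zero] at h3
  exact h3

/-- For K = z ⊗ z, the integrability condition in the directions (c, v) is evaluated on g v twice.
As K(g v) = 0, the curvature terms and the defect for (c, v) vanish, so the defect for (v, c)
vanishes too, and that is the identity. -/
theorem KillingEq.covEnd_identity (hg : IsMetricOn g U) (hU : IsOpen U)
    (hT : IsStructureTensor g T U) (hskew : HasSkewPart g T t U)
    (hK : ∀ x ∈ U, SmoothMat K x) (hKs : ∀ x ∈ U, (K x).IsSymm)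
    (hKe : KillingEq g T K U) (hx : x ∈ U) {z v : Coord n}
    (hKx : K x = Matrix.vecMulVec z z) (hzv : z ⬝ᵥ g x *ᵥ v = 0) :
    3 * ((g x *ᵥ v) ⬝ᵥ covEnd g (fun y => endForm (T y)) v v x *ᵥ z)
      - (g x *ᵥ v) ⬝ᵥ endForm (T x) v *ᵥ (endForm (T x) v *ᵥ z)
      - (1 + 2 / (n : ℝ)) * (t x ⬝ᵥ v) * ((g x *ᵥ v) ⬝ᵥ endForm (T x) v *ᵥ z) = 0 := by
  by_cases hz : z = 0
  · simp [hz]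
  have hG := hg.symm x hx
  have hTx : ∀ i j k, ContDiffAt ℝ ∞ (fun z => T z i j k) x := fun i j k =>
      (hT.smooth i j k).contDiffAt (hU.mem_nhds hx)
  -- The auxiliary direction c makes K(g c) = z. The terms in which c survives are traded for t(v)
  -- by the skew-part condition.
  obtain ⟨c, hc⟩ : ∃ c : Coord n, z ⬝ᵥ g x *ᵥ c = 1 := by
    obtain ⟨i, hi⟩ := Function.ne_iff.1 hz
    refine ⟨(g x)⁻¹ *ᵥ Pi.single i (z i)⁻¹, ?_⟩
    rw [mulVec_inv_mulVec (hg.nondeg x hx), dotProduct_single]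
    exact mul_inv_cancel₀ hi
  have hKc : ∀ c : Coord n, K x *ᵥ c = (z ⬝ᵥ c) • z := fun c => by rw [hKx, vecMulVec_mulVec']
  have hKv : K x *ᵥ (g x *ᵥ v) = 0 := by rw [hKc, hzv, zero_smul]
  have hpK : ∀ w : Coord n, (g x *ᵥ v) ⬝ᵥ K x *ᵥ w = 0 := fun w => by
    rw [dot_mulVec_comm (hKs x hx), hKv, dotProduct_zero]
  have hinv := inv_mulVec_mulVec (hg.nondeg x hx) v
  have h := congrArg (fun A => (g x *ᵥ v) ⬝ᵥ A *ᵥ (g x *ᵥ v))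
    (hKe.integrability hg hU hT hK hKs hx c v)
  simp only [Matrix.sub_mulVec, Matrix.add_mulVec, dotProduct_sub, dotProduct_add,
    Matrix.smul_mulVec, dotProduct_smul, transpose_dot, ← Matrix.mulVec_mulVec, hpK, hKv,
    Matrix.mulVec_zero, dotProduct_zero, add_zero, smul_zero] at h
  have h1 : (g x *ᵥ v) ⬝ᵥ killingDefect g T K c v x *ᵥ (g x *ᵥ v) = 0 := by
    rw [killingDefect, hKv, covEnd_endForm_zero hTx, zero_add]
    simp only [Matrix.sub_mulVec, ← Matrix.mulVec_mulVec, hKv, hinv, Matrix.mulVec_zero, sub_zero]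
    rw [hT.endForm_comm hx v, sub_self, dotProduct_zero]
  have h2 : (g x *ᵥ v) ⬝ᵥ killingDefect g T K v c x *ᵥ (g x *ᵥ v) = 0 := by linarith
  have hN : ∀ p : Coord n, (3 : ℝ) • (covUp g K v x *ᵥ p) =
      -((z ⬝ᵥ p) • endForm (T x) v *ᵥ z) - (p ⬝ᵥ endForm (T x) v *ᵥ z) • z := fun p => by
    rw [← Matrix.smul_mulVec, covUp_of_orthogonal hKe hx hKv, Matrix.sub_mulVec,
      Matrix.neg_mulVec, ← Matrix.mulVec_mulVec, ← Matrix.mulVec_mulVec, hKc, hKc, transpose_dot,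
      Matrix.mulVec_smul]
  have h3 : (3 : ℝ) • killingDefect g T K v c x *ᵥ (g x *ᵥ v) =
      (3 : ℝ) • covEnd g (fun y => endForm (T y)) v v x *ᵥ z
      - endForm (T x) v *ᵥ (endForm (T x) v *ᵥ z)
      - ((g x *ᵥ c) ⬝ᵥ endForm (T x) v *ᵥ z) • endForm (T x) v *ᵥ z
      + ((g x *ᵥ v) ⬝ᵥ endForm (T x) v *ᵥ z) • endForm (T x) c *ᵥ z := by
    rw [killingDefect, hKc, hc, one_smul]
    simp only [Matrix.sub_mulVec, Matrix.add_mulVec, ← Matrix.mulVec_mulVec, hKv, hinv,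
      Matrix.mulVec_zero, sub_zero, smul_sub, smul_add]
    rw [hT.covEnd_comm hU hx v z v, hT.endForm_comm hx _ v,
      ← Matrix.mulVec_smul (endForm (T x) v) 3, ← Matrix.mulVec_smul (endForm (T x) c) 3, hN, hN,
      hc, hzv]
    simp only [Matrix.mulVec_sub, Matrix.mulVec_neg, Matrix.mulVec_smul, one_smul, zero_smul,
      neg_zero, Matrix.mulVec_zero]
    module
  have hsk := congrArg (z ⬝ᵥ ·) (hskew x hx v c)
  simp only [dotProduct_sub, dotProduct_smul, transpose_dot, hc, hzv, smul_eq_mul, mul_one,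
    mul_zero, sub_zero] at hsk
  have h4 := congrArg ((g x *ᵥ v) ⬝ᵥ ·) h3
  simp only [dotProduct_smul, dotProduct_sub, dotProduct_add, smul_eq_mul, h2, mul_zero] at h4
  linear_combination -h4 + ((g x *ᵥ v) ⬝ᵥ endForm (T x) v *ᵥ z) * hsk

theorem System.IsAbundant.exists_killingEq (hn : 3 ≤ n) (hU : IsOpen U)
    (hUc : IsConnected U) {S : System n U} (hS : S.IsAbundant T)
    (hskew : HasSkewPart S.g T t U) (ht : ∀ x ∈ U, SmoothVec t x) (hx : x ∈ U)
    {A : Matrix (Fin n) (Fin n) ℝ} (hA : A.IsSymm) :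
    ∃ K : Coord n → Matrix (Fin n) (Fin n) ℝ, (∀ x ∈ U, SmoothMat K x) ∧
      (∀ x ∈ U, (K x).IsSymm) ∧ KillingEq S.g T K U ∧ K x = A := by
  obtain ⟨K, hK, hKA⟩ := hS.exists_killing hn hU hUc hskew ht hx hA
  have hsm : ∀ y ∈ U, SmoothMat K y := fun y hy i j =>
    (S.killing_smooth K hK i j).contDiffAt (hU.mem_nhds hy)
  exact ⟨K, hsm, S.killing_symm K hK, hS.nondegenerate.killingEq hn hU hUc hskew ht hsm
    (S.killing_symm K hK) (fun V hV => S.integral V hV K hK), hKA⟩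

theorem HasConstantCurvature.curvature_mulVec (hκ : HasConstantCurvature g U)
    (hg : IsMetricOn g U) (hU : IsOpen U) (hx : x ∈ U) {c a k : Coord n}
    (hck : c ⬝ᵥ g x *ᵥ k = 0) (hak : a ⬝ᵥ g x *ᵥ k = 0) : curvature (conn g) c a x *ᵥ k = 0 := by
  obtain ⟨κ, hκ⟩ := hκ
  rw [curvature_of_constant hg hU hx (hκ x hx), hck, hak]
  simp

/-- The endomorphisms of the structure tensor of an abundant system commute on common orthogonal
vectors. -/
theorem System.IsAbundant.commutator_eq_zero (hn : 3 ≤ n) (hU : IsOpen U)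
    (hUc : IsConnected U) {S : System n U} (hS : S.IsAbundant T)
    (hκ : HasConstantCurvature S.g U) (hskew : HasSkewPart S.g T t U)
    (ht : ∀ x ∈ U, SmoothVec t x) (hx : x ∈ U) {a c k : Coord n}
    (hak : a ⬝ᵥ S.g x *ᵥ k = 0) (hck : c ⬝ᵥ S.g x *ᵥ k = 0) :
    endForm (T x) a *ᵥ (endForm (T x) c *ᵥ k) = endForm (T x) c *ᵥ (endForm (T x) a *ᵥ k) := by
  by_cases hk : k = 0
  · simp [hk]
  have hg := S.isMetric
  have hT := hS.nondegenerate.tensor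
  obtain ⟨K, hK, hKs, hKe, hKx⟩ := hS.exists_killingEq hn hU hUc hskew ht hx
    (A := Matrix.vecMulVec k k) (Matrix.transpose_vecMulVec k k)
  have hR := hκ.curvature_mulVec hg hU hx hck hak
  have h1 := hKe.commutator hg hU hT hskew hK hKs hx hk hKx hak hck hR
  have h2 := hS.nondegenerate.curvature_mulVec hn hU hUc hskew ht hx hck hak
  -- Let D be the antisymmetrised ∇T and C the commutator, both applied to k. The potentials give D
  -- = C while the Killing tensors give C = 3 D, so both vanish.
  have h3 : curvature (structConn S.g T) c a x = curvature (conn S.g) c a x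
      + (covEnd S.g (fun y => endForm (T y)) c a x - covEnd S.g (fun y => endForm (T y)) a c x)
      - (endForm (T x) a * endForm (T x) c - endForm (T x) c * endForm (T x) a) := by
    unfold structConn
    rw [curvature_add (fun a => hg.smoothMat_conn hU hx a) (fun a => hT.smoothMat hU hx a)]
    simp only [covEnd, hg.conn_comm hU hx a c]
    abel
  rw [h3, Matrix.sub_mulVec, Matrix.add_mulVec, hR, zero_add, h1] at h2
  have h4 : (covEnd S.g (fun y => endForm (T y)) c a x
      - covEnd S.g (fun y => endForm (T y)) a c x) *ᵥ k = 0 := by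
    have : (-2 : ℝ) • ((covEnd S.g (fun y => endForm (T y)) c a x
      - covEnd S.g (fun y => endForm (T y)) a c x) *ᵥ k) = 0 := by rw [← h2]; module
    exact (smul_eq_zero.1 this).resolve_left (by norm_num)
  rw [h4, smul_zero, Matrix.sub_mulVec, sub_eq_zero, ← Matrix.mulVec_mulVec,
    ← Matrix.mulVec_mulVec] at h1
  exact h1

theorem System.IsAbundant.covEnd_identity (hn : 3 ≤ n) (hU : IsOpen U)
    (hUc : IsConnected U) {S : System n U} (hS : S.IsAbundant T)
    (hskew : HasSkewPart S.g T t U) (ht : ∀ x ∈ U, SmoothVec t x) (hx : x ∈ U) {z v : Coord n}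
    (hzv : z ⬝ᵥ S.g x *ᵥ v = 0) :
    3 * ((S.g x *ᵥ v) ⬝ᵥ covEnd S.g (fun y => endForm (T y)) v v x *ᵥ z)
      - (S.g x *ᵥ v) ⬝ᵥ endForm (T x) v *ᵥ (endForm (T x) v *ᵥ z)
      - (1 + 2 / (n : ℝ)) * (t x ⬝ᵥ v) * ((S.g x *ᵥ v) ⬝ᵥ endForm (T x) v *ᵥ z) = 0 := by
  obtain ⟨K, hK, hKs, hKe, hKx⟩ := hS.exists_killingEq hn hU hUc hskew ht hx
    (A := Matrix.vecMulVec z z) (Matrix.transpose_vecMulVec z z)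
  exact hKe.covEnd_identity S.isMetric hU hS.nondegenerate.tensor hskew hK hKs hx hKx hzv

end KillingIntegrability

/-! ### Conformal change of the metric -/

section Conformal

variable {n : ℕ} {g g' : Coord n → Matrix (Fin n) (Fin n) ℝ} {U : Set (Coord n)}
  {Ω B f : Coord n → ℝ} {d : Coord n → Coord n} {x : Coord n}

/-- `g' = Ω² g` on `U` with a smooth positive function `Ω`. -/
structure ConformalOn (g g' : Coord n → Matrix (Fin n) (Fin n) ℝ) (Ω : Coord n → ℝ)
    (U : Set (Coord n)) : Prop where
  smooth : ∀ x ∈ U, ContDiffAt ℝ ∞ Ω x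
  pos : ∀ x ∈ U, 0 < Ω x
  eq : ∀ x ∈ U, g' x = (Ω x ^ 2) • g x

/-- The logarithm of the conformal factor. -/
def logFactor (Ω : Coord n → ℝ) (x : Coord n) : ℝ := Real.log (Ω x)

theorem ConformalOn.smooth_log (h : ConformalOn g g' Ω U) (hx : x ∈ U) :
    ContDiffAt ℝ ∞ (logFactor Ω) x := (h.smooth x hx).log (h.pos x hx).ne'

theorem ConformalOn.dd_factor (h : ConformalOn g g' Ω U) (hx : x ∈ U) (v : Coord n) :
    dd v Ω x = Ω x * dd v (logFactor Ω) x := by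
  have h1 := ((smooth_differentiableAt (h.smooth x hx)).hasFDerivAt).log (h.pos x hx).ne'
  have h2 : dd v (logFactor Ω) x = (Ω x)⁻¹ * dd v Ω x := by
    have h3 : logFactor Ω = fun y => Real.log (Ω y) := rfl
    simp only [dd, h3, h1.fderiv]
    rfl
  rw [h2, mul_inv_cancel_left₀ (h.pos x hx).ne']

theorem ConformalOn.smooth_sq (h : ConformalOn g g' Ω U) (hx : x ∈ U) :
    ContDiffAt ℝ ∞ (fun y => Ω y ^ 2) x := (h.smooth x hx).pow 2

theorem ConformalOn.dd_sq (h : ConformalOn g g' Ω U) (hx : x ∈ U) (v : Coord n) :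
    dd v (fun y => Ω y ^ 2) x = 2 * Ω x ^ 2 * dd v (logFactor Ω) x := by
  have := dd_mul (v := v) (h.smooth x hx) (h.smooth x hx)
  simp only [sq]
  rw [this, h.dd_factor hx]
  ring

theorem ConformalOn.inv_eq (h : ConformalOn g g' Ω U) (hg : IsMetricOn g U) (hx : x ∈ U) :
    (g' x)⁻¹ = (Ω x ^ 2)⁻¹ • (g x)⁻¹ := by
  have hp := (pow_pos (h.pos x hx) 2).ne'
  rw [h.eq x hx]
  refine Matrix.inv_eq_left_inv ?_
  rw [Matrix.smul_mul, Matrix.mul_smul, Matrix.nonsing_inv_mul _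
    (isUnit_iff_ne_zero.2 (hg.nondeg x hx)), smul_smul, inv_mul_cancel₀ hp, one_smul]

theorem ConformalOn.orthogonal (h : ConformalOn g g' Ω U) (hx : x ∈ U) {a b : Coord n}
    (hab : a ⬝ᵥ g x *ᵥ b = 0) : a ⬝ᵥ g' x *ᵥ b = 0 := by
  rw [h.eq x hx, Matrix.smul_mulVec, dotProduct_smul, hab, smul_zero]

theorem ConformalOn.christoffel (h : ConformalOn g g' Ω U) (hg : IsMetricOn g U) (hU : IsOpen U)
    (hx : x ∈ U) (k i j : Fin n) : christoffel g' k i j x = Superintegrable.christoffel g k i j x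
      + (pd i (logFactor Ω) x * (1 : Matrix (Fin n) (Fin n) ℝ) k j
        + (1 : Matrix (Fin n) (Fin n) ℝ) k i * pd j (logFactor Ω) x
        - ((g x)⁻¹ *ᵥ grad (logFactor Ω) x) k * g x j i) := by
  have hgx := hg.smoothMat hU hx
  have hG := hg.symm x hx
  have hp := (h.pos x hx).ne'
  have hpd : ∀ m i j, pd m (fun y => g' y i j) x =
      Ω x ^ 2 * (2 * pd m (logFactor Ω) x * g x i j + pd m (fun y => g y i j) x) := by
    intro m i j
    have h1 := dd_congr (v := Pi.single m 1) (f := fun y => g' y i j)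
      (h := fun y => Ω y ^ 2 * g y i j) ((hU.eventually_mem hx).mono fun y hy => by simp [h.eq y hy])
    rw [dd_mul (h.smooth_sq hx) (hgx i j), h.dd_sq hx] at h1
    simp only [pd_eq_dd, h1]
    ring
  have hinv : ∀ j, ∑ l, (g x)⁻¹ k l * g x j l = (1 : Matrix (Fin n) (Fin n) ℝ) k j := fun j => by
    rw [← Matrix.nonsing_inv_mul _ (isUnit_iff_ne_zero.2 (hg.nondeg x hx)), Matrix.mul_apply]
    exact Finset.sum_congr rfl fun l _ => by rw [hG.apply]
  have hs : ((g x)⁻¹ *ᵥ grad (logFactor Ω) x) k = ∑ l, (g x)⁻¹ k l * pd l (logFactor Ω) x := rfl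
  unfold Superintegrable.christoffel
  rw [← hinv, ← hinv, hs, h.inv_eq hg hx]
  simp only [hpd, Matrix.smul_apply, smul_eq_mul, Finset.mul_sum, Finset.sum_mul]
  rw [← Finset.sum_add_distrib, ← Finset.sum_sub_distrib, ← Finset.sum_add_distrib]
  refine Finset.sum_congr rfl fun l _ => ?_
  rw [hG.apply i j]
  field_simp
  ring

theorem ConformalOn.conn (h : ConformalOn g g' Ω U) (hg : IsMetricOn g U) (hU : IsOpen U)
    (hx : x ∈ U) (a : Coord n) :
    conn g' x a = Superintegrable.conn g x a + traceForm (g x) 1 (grad (logFactor Ω) x) a := by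
  ext k j
  have e1 : ∑ i, (1 : Matrix (Fin n) (Fin n) ℝ) k i * a i = a k := congrFun (Matrix.one_mulVec a) k
  simp only [Superintegrable.conn, endForm, Matrix.of_apply, h.christoffel hg hU hx, traceForm,
    Matrix.add_apply, Matrix.sub_apply, Matrix.smul_apply, Matrix.vecMulVec_apply, smul_eq_mul,
    mul_add, mul_sub, Finset.sum_add_distrib, Finset.sum_sub_distrib, one_mul]
  rw [← e1]
  simp only [dotProduct, Matrix.mulVec, Finset.sum_mul, Finset.mul_sum]
  congr 2
  · congr 1
    · exact Finset.sum_congr rfl fun i _ => by simp only [grad]; ring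
    · exact Finset.sum_congr rfl fun i _ => by simp only [grad]; ring
  · exact Finset.sum_congr rfl fun i _ => Finset.sum_congr rfl fun m _ => by ring

theorem mdd_vecMulVec {p q : Coord n → Coord n} (hp : SmoothVec p x) (hq : SmoothVec q x)
    (c : Coord n) : mdd c (fun y => Matrix.vecMulVec (p y) (q y)) x =
      Matrix.vecMulVec (vdd c p x) (q x) + Matrix.vecMulVec (p x) (vdd c q x) := by
  ext i j
  exact dd_mul (hp i) (hq j)

theorem smoothMat_vecMulVec {p q : Coord n → Coord n} (hp : SmoothVec p x) (hq : SmoothVec q x) :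
    SmoothMat (fun y => Matrix.vecMulVec (p y) (q y)) x := fun i j => (hp i).mul (hq j)

theorem smoothMat_traceForm (hg : IsMetricOn g U) (hU : IsOpen U) (hx : x ∈ U)
    (hd : SmoothVec d x) (r : ℝ) (a : Coord n) : SmoothMat (fun y => traceForm (g y) r (d y) a) x :=
  smoothMat_sub (smoothMat_add (smoothMat_smul (smooth_dot hd (smoothVec_const a))
    (smoothMat_const 1)) (smoothMat_vecMulVec (smoothVec_const a) hd))
    (smoothMat_smul contDiffAt_const (smoothMat_vecMulVec
      (smoothVec_mulVec (hg.smoothMat_inv hU hx) hd)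
      (smoothVec_mulVec (hg.smoothMat hU hx) (smoothVec_const a))))

/-- The metric and the identity are parallel, so the derivative falls on the covector alone. -/
theorem covEnd_traceForm (hg : IsMetricOn g U) (hU : IsOpen U) (hx : x ∈ U)
    (hd : SmoothVec d x) (r : ℝ) (c a : Coord n) :
    covEnd g (fun y => traceForm (g y) r (d y)) c a x =
      traceForm (g x) r (vdd c d x - (Superintegrable.conn g x c)ᵀ *ᵥ d x) a := by
  have hgx := hg.smoothMat hU hx
  have hgi := hg.smoothMat_inv hU hx
  have s1 := smooth_dot hd (smoothVec_const a)
  have s2 := smoothMat_vecMulVec (smoothVec_const a) hd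
  have s3 := smoothVec_mulVec hgi hd
  have s4 := smoothVec_mulVec hgx (smoothVec_const a)
  have e1 : mdd c (fun y => traceForm (g y) r (d y) a) x =
      (vdd c d x ⬝ᵥ a) • (1 : Matrix (Fin n) (Fin n) ℝ) + Matrix.vecMulVec a (vdd c d x)
      - r • (Matrix.vecMulVec (vdd c (fun y => (g y)⁻¹ *ᵥ d y) x) (g x *ᵥ a)
        + Matrix.vecMulVec ((g x)⁻¹ *ᵥ d x) (vdd c (fun y => g y *ᵥ a) x)) := by
    simp only [traceForm]
    rw [mdd_sub (smoothMat_add (smoothMat_smul s1 (smoothMat_const 1)) s2)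
      (smoothMat_smul contDiffAt_const (smoothMat_vecMulVec s3 s4)),
      mdd_add (smoothMat_smul s1 (smoothMat_const 1)) s2, mdd_smul s1 (smoothMat_const 1),
      mdd_const, mdd_smul contDiffAt_const (smoothMat_vecMulVec s3 s4), dd_const,
      mdd_vecMulVec (smoothVec_const a) hd, mdd_vecMulVec s3 s4, vdd_const,
      dd_dot hd (smoothVec_const a), vdd_const]
    simp
  have e2 : vdd c (fun y => (g y)⁻¹ *ᵥ d y) x = (g x)⁻¹ *ᵥ vdd c d x
      - Superintegrable.conn g x c *ᵥ ((g x)⁻¹ *ᵥ d x)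
      - (g x)⁻¹ *ᵥ ((Superintegrable.conn g x c)ᵀ *ᵥ d x) := by
    rw [vdd_mulVec hgi hd, hg.mdd_inv_metric hU hx, Matrix.neg_mulVec, Matrix.add_mulVec,
      Matrix.mulVec_mulVec, Matrix.mulVec_mulVec]
    abel
  have e3 : vdd c (fun y => g y *ᵥ a) x = (Superintegrable.conn g x c)ᵀ *ᵥ (g x *ᵥ a)
      + g x *ᵥ (Superintegrable.conn g x c *ᵥ a) := by
    rw [vdd_mulVec hgx (smoothVec_const a), vdd_const, hg.mdd_metric hU hx, Matrix.mulVec_zero,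
      add_zero, Matrix.add_mulVec, Matrix.mulVec_mulVec, Matrix.mulVec_mulVec]
  have e4 : ∀ (M : Matrix (Fin n) (Fin n) ℝ) (u w : Coord n),
      Matrix.vecMulVec u w * M = Matrix.vecMulVec u (Mᵀ *ᵥ w) := fun M u w => by
    rw [Matrix.vecMulVec_mul, Matrix.mulVec_transpose]
  have e5 : d x ⬝ᵥ Superintegrable.conn g x c *ᵥ a =
      ((Superintegrable.conn g x c)ᵀ *ᵥ d x) ⬝ᵥ a := by
    rw [dotProduct_comm _ a, transpose_dot]
  rw [covEnd, e1, e2, e3]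
  simp only [traceForm, mul_add, add_mul, mul_sub, sub_mul, Matrix.mul_smul, Matrix.smul_mul, e4,
    Matrix.mul_vecMulVec, mul_one, one_mul, sub_dotProduct, Matrix.mulVec_sub, e5,
    Matrix.sub_vecMulVec, Matrix.vecMulVec_sub, Matrix.vecMulVec_add, sub_smul, smul_add, smul_sub]
  abel

/-- The connections differ by the trace form of dφ, and the covariant derivative of dφ is Hess φ;
the rest is the curvature of a modified connection. -/
theorem ConformalOn.curvature (h : ConformalOn g g' Ω U) (hg : IsMetricOn g U) (hU : IsOpen U)
    (hx : x ∈ U) (c a : Coord n) : curvature (Superintegrable.conn g') c a x =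
      Superintegrable.curvature (Superintegrable.conn g) c a x
      + (traceForm (g x) 1 (hessM g (logFactor Ω) x *ᵥ c) a
        - traceForm (g x) 1 (hessM g (logFactor Ω) x *ᵥ a) c)
      + (traceForm (g x) 1 (grad (logFactor Ω) x) c * traceForm (g x) 1 (grad (logFactor Ω) x) a
        - traceForm (g x) 1 (grad (logFactor Ω) x) a
          * traceForm (g x) 1 (grad (logFactor Ω) x) c) := by
  have hφ := h.smooth_log hx
  have h1 : Superintegrable.curvature (Superintegrable.conn g') c a x =
      Superintegrable.curvature (fun y b => Superintegrable.conn g y b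
        + traceForm (g y) 1 (grad (logFactor Ω) y) b) c a x := by
    unfold Superintegrable.curvature
    simp only [h.conn hg hU hx]
    rw [mdd_congr ((hU.eventually_mem hx).mono fun y hy => h.conn hg hU hy a),
      mdd_congr ((hU.eventually_mem hx).mono fun y hy => h.conn hg hU hy c)]
  rw [h1, curvature_add (fun a => hg.smoothMat_conn hU hx a)
    (fun a => smoothMat_traceForm hg hU hx (smoothVec_grad hφ) 1 a)]
  have h2 : ∀ c a : Coord n, traceForm (g x) 1 (hessM g (logFactor Ω) x *ᵥ c) a =
      mdd c (fun y => traceForm (g y) 1 (grad (logFactor Ω) y) a) x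
      + (Superintegrable.conn g x c * traceForm (g x) 1 (grad (logFactor Ω) x) a
        - traceForm (g x) 1 (grad (logFactor Ω) x) a * Superintegrable.conn g x c)
      - traceForm (g x) 1 (grad (logFactor Ω) x) (Superintegrable.conn g x c *ᵥ a) := by
    intro c a
    have := covEnd_traceForm hg hU hx (smoothVec_grad hφ) 1 c a
    rw [vdd_grad_eq hg hU hx hφ, add_sub_cancel_right] at this
    rw [← this, covEnd]
    abel
  rw [h2, h2, hg.conn_comm hU hx c a]
  abel

/-- If both metrics have constant curvature, then the Hessian of the logarithm of the conformal
factor is determined up to multiples of the metric. -/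
theorem ConformalOn.hess_orthogonal (hn : 3 ≤ n) (h : ConformalOn g g' Ω U) (hg : IsMetricOn g U)
    (hg' : IsMetricOn g' U) (hU : IsOpen U) (hκ : HasConstantCurvature g U)
    (hκ' : HasConstantCurvature g' U) (hx : x ∈ U) {a k : Coord n} (hak : a ⬝ᵥ g x *ᵥ k = 0) :
    a ⬝ᵥ hessM g (logFactor Ω) x *ᵥ k =
      (grad (logFactor Ω) x ⬝ᵥ a) * (grad (logFactor Ω) x ⬝ᵥ k) := by
  have hG := hg.symm x hx
  have hH := hessM_symm hg hU hx (h.smooth_log hx)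
  have key := orthogonal_of_smul_eq hn (G := g x) (a := a) (k := k)
    -- For a, c ⊥ k both curvatures annihilate k, and the difference formula collapses to β(a, k) c
    -- = β(c, k) a with β = Hess φ - dφ ⊗ dφ.
    (β := fun a k => a ⬝ᵥ hessM g (logFactor Ω) x *ᵥ k
      - (grad (logFactor Ω) x ⬝ᵥ a) * (grad (logFactor Ω) x ⬝ᵥ k)) ?_ (by simp) hak
  · linarith
  intro k a c hak hck
  have h1 := congrArg (· *ᵥ k) (h.curvature hg hU hx c a)
  have e : ∀ c k : Coord n, (hessM g (logFactor Ω) x *ᵥ c) ⬝ᵥ k =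
      c ⬝ᵥ hessM g (logFactor Ω) x *ᵥ k := fun c k => by
    rw [dotProduct_comm, dot_mulVec_comm hH]
  simp only [Matrix.add_mulVec, Matrix.sub_mulVec, ← Matrix.mulVec_mulVec,
    hκ.curvature_mulVec hg hU hx hck hak,
    hκ'.curvature_mulVec hg' hU hx (h.orthogonal hx hck) (h.orthogonal hx hak),
    traceForm_mulVec hG, hak, hck, mul_zero, zero_smul, sub_zero, zero_add, dotProduct_add,
    dotProduct_smul, Matrix.mulVec_add, Matrix.mulVec_smul, e, dot_mulVec_comm hH c a,
    dot_mulVec_comm hG c a, smul_eq_mul] at h1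
  rw [← sub_eq_zero, ← neg_eq_zero]
  refine Eq.trans ?_ h1.symm
  module

end Conformal

/-! ### Conformal change of Hessians and of the structure function -/

section ThirdDerivative

variable {n : ℕ} {g g' h k : Coord n → Matrix (Fin n) (Fin n) ℝ} {U : Set (Coord n)}
  {Ω B B' f : Coord n → ℝ} {p q : Coord n → Coord n} {x : Coord n}

theorem eq_of_dot {A B : Matrix (Fin n) (Fin n) ℝ}
    (h : ∀ a b : Coord n, a ⬝ᵥ A *ᵥ b = a ⬝ᵥ B *ᵥ b) : A = B := by
  ext i j
  simpa using h (Pi.single i 1) (Pi.single j 1)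

theorem dot_vecMulVec (p q a b : Coord n) :
    a ⬝ᵥ Matrix.vecMulVec p q *ᵥ b = (p ⬝ᵥ a) * (q ⬝ᵥ b) := by
  rw [vecMulVec_mulVec', dotProduct_smul, smul_eq_mul, dotProduct_comm a p]
  ring

theorem hessM_congr (hf : B =ᶠ[𝓝 x] B') : hessM g B x = hessM g B' x := by
  have h1 : ∀ i, pd i B =ᶠ[𝓝 x] pd i B' := fun i =>
    hf.eventuallyEq_nhds.mono fun y hy => dd_congr hy
  ext i j
  simp only [hessM, hess, Matrix.of_apply, fun k => (h1 k).self_of_nhds]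
  congr 1
  exact dd_congr (h1 i)

theorem ConformalOn.hessM_eq (hc : ConformalOn g g' Ω U) (hg : IsMetricOn g U) (hU : IsOpen U)
    (hx : x ∈ U) (hf : ContDiffAt ℝ ∞ f x) : hessM g' f x = hessM g f x
      - Matrix.vecMulVec (grad (logFactor Ω) x) (grad f x)
      - Matrix.vecMulVec (grad f x) (grad (logFactor Ω) x)
      + (((g x)⁻¹ *ᵥ grad (logFactor Ω) x) ⬝ᵥ grad f x) • g x := by
  refine eq_of_dot fun a b => ?_
  rw [dot_hessM_mulVec hf, hc.conn hg hU hx, Matrix.add_mulVec, traceForm_mulVec (hg.symm x hx)]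
  simp only [Matrix.add_mulVec, Matrix.sub_mulVec, dotProduct_add, dotProduct_sub, dot_vecMulVec,
    dot_hessM_mulVec hf, dd_eq_sum _ f, Matrix.smul_mulVec, dotProduct_smul, smul_eq_mul,
    dotProduct_comm _ (grad f x)]
  ring

theorem ConformalOn.grad_sq_mul (hc : ConformalOn g g' Ω U) (hx : x ∈ U)
    (hf : ContDiffAt ℝ ∞ f x) : grad (fun y => Ω y ^ 2 * f y) x =
      (Ω x ^ 2) • (grad f x + (2 * f x) • grad (logFactor Ω) x) := by
  ext i
  refine (dd_mul (hc.smooth_sq hx) hf).trans ?_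
  rw [hc.dd_sq hx]
  simp only [grad, pd_eq_dd, Pi.smul_apply, Pi.add_apply, smul_eq_mul]
  ring

theorem ConformalOn.hessM_sq_mul (hc : ConformalOn g g' Ω U) (hU : IsOpen U)
    (hx : x ∈ U) (hf : ∀ y ∈ U, ContDiffAt ℝ ∞ f y) :
    hessM g (fun y => Ω y ^ 2 * f y) x = (Ω x ^ 2) • (hessM g f x
      + (2 : ℝ) • (Matrix.vecMulVec (grad (logFactor Ω) x) (grad f x)
        + Matrix.vecMulVec (grad f x) (grad (logFactor Ω) x))
      + (4 * f x) • Matrix.vecMulVec (grad (logFactor Ω) x) (grad (logFactor Ω) x)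
      + (2 * f x) • hessM g (logFactor Ω) x) := by
  have hφ := hc.smooth_log hx
  have h1 : ∀ y ∈ U, ∀ a : Coord n, dd a (fun y => Ω y ^ 2 * f y) y =
      Ω y ^ 2 * (2 * dd a (logFactor Ω) y * f y + dd a f y) := fun y hy a => by
    rw [dd_mul (hc.smooth_sq hy) (hf y hy), hc.dd_sq hy]
    ring
  refine eq_of_dot fun a b => ?_
  have s1 : ContDiffAt ℝ ∞ (fun y => 2 * dd a (logFactor Ω) y) x :=
    contDiffAt_const.mul (smooth_dd hφ)
  have h2 : dd b (dd a (fun y => Ω y ^ 2 * f y)) x =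
      Ω x ^ 2 * (2 * dd b (logFactor Ω) x * (2 * dd a (logFactor Ω) x * f x + dd a f x)
        + 2 * dd b (dd a (logFactor Ω)) x * f x + 2 * dd a (logFactor Ω) x * dd b f x
        + dd b (dd a f) x) := by
    rw [dd_congr ((hU.eventually_mem hx).mono fun y hy => h1 y hy a),
      dd_mul (hc.smooth_sq hx) ((s1.mul (hf x hx)).add (smooth_dd (hf x hx))), hc.dd_sq hx,
      dd_add (s1.mul (hf x hx)) (smooth_dd (hf x hx)), dd_mul s1 (hf x hx),
      dd_const_mul _ (smooth_dd hφ)]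
    ring
  rw [dot_hessM_mulVec ((hc.smooth_sq hx).mul (hf x hx)), h2, h1 x hx]
  simp only [Matrix.add_mulVec, dotProduct_add, dot_vecMulVec, Matrix.smul_mulVec, dotProduct_smul,
    smul_eq_mul, dot_hessM_mulVec hφ, dot_hessM_mulVec (hf x hx), dd_eq_sum _ f,
    dd_eq_sum _ (logFactor Ω), dotProduct_comm _ (grad f x),
    dotProduct_comm _ (grad (logFactor Ω) x)]
  ring

/-- Hessian with respect to `g' = Ω² g` of `Ω² f`. -/
theorem ConformalOn.hessM_rescaled (hc : ConformalOn g g' Ω U) (hg : IsMetricOn g U)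
    (hU : IsOpen U) (hx : x ∈ U) (hf : ∀ y ∈ U, ContDiffAt ℝ ∞ f y) :
    hessM g' (fun y => Ω y ^ 2 * f y) x = (Ω x ^ 2) • (hessM g f x
      + (Matrix.vecMulVec (grad (logFactor Ω) x) (grad f x)
        + Matrix.vecMulVec (grad f x) (grad (logFactor Ω) x))
      + (2 * f x) • hessM g (logFactor Ω) x
      + (((g x)⁻¹ *ᵥ grad (logFactor Ω) x) ⬝ᵥ
          (grad f x + (2 * f x) • grad (logFactor Ω) x)) • g x) := by
  rw [hc.hessM_eq hg hU hx ((hc.smooth_sq hx).mul (hf x hx)), hc.hessM_sq_mul hU hx hf,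
    hc.grad_sq_mul hx (hf x hx)]
  simp only [Matrix.vecMulVec_smul, Matrix.smul_vecMulVec, Matrix.vecMulVec_add,
    Matrix.add_vecMulVec, dotProduct_smul, smul_eq_mul]
  module

/-- The covariant derivative of a covariant 2-tensor field. -/
def covBil (g h : Coord n → Matrix (Fin n) (Fin n) ℝ) (v x : Coord n) :
    Matrix (Fin n) (Fin n) ℝ :=
  mdd v h x - (conn g x v)ᵀ * h x - h x * conn g x v

theorem covBil_congr (hh : h =ᶠ[𝓝 x] k) (v : Coord n) : covBil g h v x = covBil g k v x := by
  simp only [covBil, mdd_congr hh, hh.self_of_nhds]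

theorem covBil_add (hh : SmoothMat h x) (hk : SmoothMat k x) (v : Coord n) :
    covBil g (fun y => h y + k y) v x = covBil g h v x + covBil g k v x := by
  simp only [covBil, mdd_add hh hk]
  noncomm_ring

theorem covBil_smul (hf : ContDiffAt ℝ ∞ f x) (hh : SmoothMat h x) (v : Coord n) :
    covBil g (fun y => f y • h y) v x = dd v f x • h x + f x • covBil g h v x := by
  simp only [covBil, mdd_smul hf hh, Matrix.mul_smul, Matrix.smul_mul, smul_sub]
  abel

theorem covBil_metric (hg : IsMetricOn g U) (hU : IsOpen U) (hx : x ∈ U) (v : Coord n) :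
    covBil g g v x = 0 := by
  rw [covBil, hg.mdd_metric hU hx]
  abel

theorem covBil_vecMulVec (hp : SmoothVec p x) (hq : SmoothVec q x) (v : Coord n) :
    covBil g (fun y => Matrix.vecMulVec (p y) (q y)) v x =
      Matrix.vecMulVec (vdd v p x - (conn g x v)ᵀ *ᵥ p x) (q x)
        + Matrix.vecMulVec (p x) (vdd v q x - (conn g x v)ᵀ *ᵥ q x) := by
  rw [covBil, mdd_vecMulVec hp hq, Matrix.mul_vecMulVec, Matrix.vecMulVec_mul,
    ← Matrix.mulVec_transpose, Matrix.sub_vecMulVec, Matrix.vecMulVec_sub]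
  abel

theorem dot_covBil_hessM (f : Coord n → ℝ) (v x : Coord n) :
    v ⬝ᵥ covBil g (hessM g f) v x *ᵥ v = cubicForm (fun i j k => third g f i j k x) v v v := by
  rw [dot_mulVec_eq_sum, cubicForm_eq_sum]
  refine Finset.sum_congr rfl fun i _ => Finset.sum_congr rfl fun j _ => ?_
  have h1 : covBil g (hessM g f) v x i j = ∑ k, v k * third g f i j k x := by
    simp only [covBil, Matrix.sub_apply, mdd, Matrix.of_apply, hessM, Matrix.mul_apply,
      Matrix.transpose_apply, conn, endForm, third, mul_sub, Finset.sum_sub_distrib,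
      Finset.sum_add_distrib, mul_add, Finset.mul_sum, Finset.sum_mul]
    rw [dd_eq_sum, sub_sub]
    congr 2
    · rw [Finset.sum_comm]
      exact Finset.sum_congr rfl fun k _ => Finset.sum_congr rfl fun m _ => by ring
    · rw [Finset.sum_comm]
      exact Finset.sum_congr rfl fun k _ => Finset.sum_congr rfl fun m _ => by ring
  rw [h1, Finset.sum_mul, Finset.sum_mul]
  exact Finset.sum_congr rfl fun k _ => by ring

/-- Differentiating Ω² contributes 2 dφ(v), and the change of connection contributes -4 dφ(v) and a
multiple of ⟨v, v⟩; the net coefficient is -2. -/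
theorem ConformalOn.dot_covBil (hc : ConformalOn g g' Ω U) (hg : IsMetricOn g U) (hU : IsOpen U)
    (hx : x ∈ U) (hh : SmoothMat h x) (hs : (h x).IsSymm) (v : Coord n) :
    v ⬝ᵥ covBil g' (fun y => (Ω y ^ 2) • h y) v x *ᵥ v =
      Ω x ^ 2 * (v ⬝ᵥ covBil g h v x *ᵥ v - 2 * (grad (logFactor Ω) x ⬝ᵥ v) * (v ⬝ᵥ h x *ᵥ v)
        + 2 * (v ⬝ᵥ g x *ᵥ v) * (((g x)⁻¹ *ᵥ grad (logFactor Ω) x) ⬝ᵥ h x *ᵥ v)) := by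
  have h1 : ∀ A : Matrix (Fin n) (Fin n) ℝ, ∀ w : Coord n, v ⬝ᵥ Aᵀ *ᵥ w = w ⬝ᵥ A *ᵥ v :=
    fun A w => transpose_dot A v w
  have h2 : ∀ w : Coord n, v ⬝ᵥ h x *ᵥ w = w ⬝ᵥ h x *ᵥ v := fun w => dot_mulVec_comm hs v w
  simp only [covBil, mdd_smul (hc.smooth_sq hx) hh, hc.dd_sq hx, hc.conn hg hU hx,
    Matrix.sub_mulVec, Matrix.add_mulVec, ← Matrix.mulVec_mulVec, dotProduct_sub, dotProduct_add,
    Matrix.smul_mulVec, dotProduct_smul, smul_eq_mul, h1, Matrix.mulVec_smul, Matrix.mulVec_add,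
    traceForm_mulVec (hg.symm x hx), Matrix.mulVec_sub, h2, dd_eq_sum v (logFactor Ω),
    dotProduct_comm v (grad _ _)]
  simp only [dotProduct_comm (h x *ᵥ v)]
  ring

end ThirdDerivative

/-! ### The structure tensors of conformally related metrics -/

section StructureTensors

variable {n : ℕ} {g g' : Coord n → Matrix (Fin n) (Fin n) ℝ} {U : Set (Coord n)}
  {T T' s s' : Coord n → Fin n → Fin n → Fin n → ℝ} {t t' : Coord n → Coord n}
  {Ω B B' : Coord n → ℝ} {x : Coord n}

/-- Hess φ - dφ ⊗ dφ vanishes on orthogonal pairs, hence is a multiple of the metric. Writing the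
factor as a normalised trace shows that it is smooth. -/
theorem ConformalOn.hess_log (hn : 3 ≤ n) (h : ConformalOn g g' Ω U) (hg : IsMetricOn g U)
    (hg' : IsMetricOn g' U) (hU : IsOpen U) (hκ : HasConstantCurvature g U)
    (hκ' : HasConstantCurvature g' U) : ∃ c : Coord n → ℝ, (∀ x ∈ U, ContDiffAt ℝ ∞ c x) ∧
      ∀ x ∈ U, hessM g (logFactor Ω) x =
        Matrix.vecMulVec (grad (logFactor Ω) x) (grad (logFactor Ω) x) + c x • g x := by
  let β : Coord n → Matrix (Fin n) (Fin n) ℝ := fun y => hessM g (logFactor Ω) y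
    - Matrix.vecMulVec (grad (logFactor Ω) y) (grad (logFactor Ω) y)
  refine ⟨fun y => (1 / (n : ℝ)) * ∑ i, ((g y)⁻¹ * β y) i i, fun x hx => ?_, fun x hx => ?_⟩
  · have hφ := h.smooth_log hx
    have h1 : SmoothMat β x := smoothMat_sub (smooth_hess hg hU hx hφ)
      (smoothMat_vecMulVec (smoothVec_grad hφ) (smoothVec_grad hφ))
    exact contDiffAt_const.mul
      (ContDiffAt.sum fun i _ => smoothMat_mul (hg.smoothMat_inv hU hx) h1 i i)
  · obtain ⟨r, hr⟩ := exists_smul_of_orthogonal (hg.nondeg x hx) (β := β x) (fun a k hak => by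
      simp only [β, Matrix.sub_mulVec, dotProduct_sub, dot_vecMulVec,
        h.hess_orthogonal hn hg hg' hU hκ hκ' hx hak, sub_self])
    have h2 : (1 / (n : ℝ)) * ∑ i, ((g x)⁻¹ * β x) i i = r := by
      have hn0 : (n : ℝ) ≠ 0 := by positivity
      rw [hr, Matrix.mul_smul, Matrix.nonsing_inv_mul _ (isUnit_iff_ne_zero.2 (hg.nondeg x hx))]
      simp
      field_simp
    simp only [h2, ← hr, β]
    abel

/-- Weight 2 is what makes this work: once Hess φ is replaced by dφ ⊗ dφ modulo the metric, the
terms in dφ · Hess B, dφ² · dB and B · dφ³ all cancel on the diagonal. -/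
theorem ConformalOn.third_cubic (hc : ConformalOn g g' Ω U) (hg : IsMetricOn g U)
    (hU : IsOpen U) {c : Coord n → ℝ} (hcs : ∀ x ∈ U, ContDiffAt ℝ ∞ c x)
    (hH : ∀ x ∈ U, hessM g (logFactor Ω) x =
        Matrix.vecMulVec (grad (logFactor Ω) x) (grad (logFactor Ω) x) + c x • g x)
    (hx : x ∈ U) (hB : ∀ y ∈ U, ContDiffAt ℝ ∞ B y)
    (hBB : ∀ y ∈ U, B' y = Ω y ^ 2 * B y) : ∃ l : Coord n, ∀ v : Coord n,
      cubicForm (fun i j k => third g' B' i j k x) v v v =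
        Ω x ^ 2 * cubicForm (fun i j k => third g B i j k x) v v v
          + (v ⬝ᵥ g x *ᵥ v) * (l ⬝ᵥ v) := by
  have hφ := hc.smooth_log hx
  have hτ := smoothVec_grad hφ
  have hdB := smoothVec_grad (hB x hx)
  have hgx := hg.smoothMat hU hx
  -- ρ is the total coefficient of the metric in Ω⁻² times the Hessian of B' for g'. It affects the
  -- result only through multiples of ⟨v, v⟩.
  let ρ : Coord n → ℝ := fun y => ((g y)⁻¹ *ᵥ grad (logFactor Ω) y) ⬝ᵥ
          (grad B y + (2 * B y) • grad (logFactor Ω) y) + 2 * B y * c y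
  have hB2 : ContDiffAt ℝ ∞ (fun y => 2 * B y) x := contDiffAt_const.mul (hB x hx)
  have hρ : ContDiffAt ℝ ∞ ρ x := (smooth_dot (smoothVec_mulVec (hg.smoothMat_inv hU hx) hτ)
    (smoothVec_add hdB (smoothVec_smul hB2 hτ))).add (hB2.mul (hcs x hx))
  let Q : Coord n → Matrix (Fin n) (Fin n) ℝ := fun y => hessM g B y
      + (Matrix.vecMulVec (grad (logFactor Ω) y) (grad B y)
        + Matrix.vecMulVec (grad B y) (grad (logFactor Ω) y))
      + (2 * B y) • Matrix.vecMulVec (grad (logFactor Ω) y) (grad (logFactor Ω) y)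
      + ρ y • g y
  have hQ : ∀ y ∈ U, hessM g' B' y = (Ω y ^ 2) • Q y := by
    intro y hy
    rw [hessM_congr ((hU.eventually_mem hy).mono hBB), hc.hessM_rescaled hg hU hy hB, hH y hy]
    simp only [Q, ρ]
    module
  have m1 := smooth_hess hg hU hx (hB x hx)
  have m2 := smoothMat_vecMulVec hτ hdB
  have m3 := smoothMat_vecMulVec hdB hτ
  have m4 := smoothMat_vecMulVec hτ hτ
  have m5 := smoothMat_smul hB2 m4
  have m6 := smoothMat_smul hρ hgx
  have mQ : SmoothMat Q x := smoothMat_add (smoothMat_add (smoothMat_add m1 (smoothMat_add m2 m3))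
    m5) m6
  have hQs : (Q x).IsSymm := by
    simp only [Q, Matrix.IsSymm, Matrix.transpose_add, Matrix.transpose_smul,
      Matrix.transpose_vecMulVec, (hessM_symm hg hU hx (hB x hx)).eq, (hg.symm x hx).eq]
    abel
  have hcov : ∀ v : Coord n, covBil g Q v x = covBil g (hessM g B) v x
      + (Matrix.vecMulVec (hessM g (logFactor Ω) x *ᵥ v) (grad B x)
        + Matrix.vecMulVec (grad (logFactor Ω) x) (hessM g B x *ᵥ v)
        + (Matrix.vecMulVec (hessM g B x *ᵥ v) (grad (logFactor Ω) x)
        + Matrix.vecMulVec (grad B x) (hessM g (logFactor Ω) x *ᵥ v)))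
      + ((2 * dd v B x) • Matrix.vecMulVec (grad (logFactor Ω) x) (grad (logFactor Ω) x)
        + (2 * B x) • (Matrix.vecMulVec (hessM g (logFactor Ω) x *ᵥ v) (grad (logFactor Ω) x)
          + Matrix.vecMulVec (grad (logFactor Ω) x) (hessM g (logFactor Ω) x *ᵥ v)))
      + dd v ρ x • g x := by
    intro v
    simp only [Q]
    rw [covBil_add (smoothMat_add (smoothMat_add m1 (smoothMat_add m2 m3)) m5) m6,
      covBil_add (smoothMat_add m1 (smoothMat_add m2 m3)) m5,
      covBil_add m1 (smoothMat_add m2 m3), covBil_add m2 m3, covBil_smul hB2 m4,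
      covBil_smul hρ hgx, covBil_metric hg hU hx, covBil_vecMulVec hτ hdB,
      covBil_vecMulVec hdB hτ, covBil_vecMulVec hτ hτ, dd_const_mul _ (hB x hx),
      vdd_grad_eq hg hU hx hφ, vdd_grad_eq hg hU hx (hB x hx), add_sub_cancel_right,
      add_sub_cancel_right, smul_zero, add_zero]
  refine ⟨(Ω x ^ 2) • ((2 * c x) • grad B x + (4 * B x * c x - 2 * ρ x) • grad (logFactor Ω) x
    + grad ρ x + (2 : ℝ) • (Q x *ᵥ ((g x)⁻¹ *ᵥ grad (logFactor Ω) x))), fun v => ?_⟩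
  have hHv : v ⬝ᵥ hessM g (logFactor Ω) x *ᵥ v =
      (grad (logFactor Ω) x ⬝ᵥ v) ^ 2 + c x * (v ⬝ᵥ g x *ᵥ v) := by
    rw [hH x hx, Matrix.add_mulVec, dotProduct_add, dot_vecMulVec, Matrix.smul_mulVec,
      dotProduct_smul, smul_eq_mul, sq]
  have hQv : v ⬝ᵥ Q x *ᵥ v = v ⬝ᵥ hessM g B x *ᵥ v
      + 2 * (grad (logFactor Ω) x ⬝ᵥ v) * (grad B x ⬝ᵥ v)
      + 2 * B x * (grad (logFactor Ω) x ⬝ᵥ v) ^ 2 + ρ x * (v ⬝ᵥ g x *ᵥ v) := by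
    simp only [Q, Matrix.add_mulVec, dotProduct_add, dot_vecMulVec, Matrix.smul_mulVec,
      dotProduct_smul, smul_eq_mul]
    ring
  rw [← dot_covBil_hessM, covBil_congr ((hU.eventually_mem hx).mono hQ),
    hc.dot_covBil hg hU hx mQ hQs, hcov, hQv]
  simp only [Matrix.add_mulVec, dotProduct_add, dot_vecMulVec, Matrix.smul_mulVec,
    dotProduct_smul, smul_eq_mul, dotProduct_comm (_ *ᵥ v) v, hHv, dot_covBil_hessM,
    dd_eq_sum, dotProduct_comm v (grad _ _), smul_dotProduct, add_dotProduct]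
  rw [dotProduct_comm (Q x *ᵥ _) v, dot_mulVec_comm hQs v]
  ring

theorem cubicForm_swap_diag₁ (A : Fin n → Fin n → Fin n → ℝ) (v : Coord n) :
    cubicForm (fun i j k => A j i k) v v v = cubicForm A v v v := by
  rw [cubicForm_eq_sum, cubicForm_eq_sum, Finset.sum_comm]
  exact Finset.sum_congr rfl fun i _ => Finset.sum_congr rfl fun j _ =>
    Finset.sum_congr rfl fun k _ => by ring

theorem cubicForm_swap_diag₂ (A : Fin n → Fin n → Fin n → ℝ) (v : Coord n) :
    cubicForm (fun i j k => A i k j) v v v = cubicForm A v v v := by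
  rw [cubicForm_eq_sum, cubicForm_eq_sum]
  refine Finset.sum_congr rfl fun i _ => ?_
  rw [Finset.sum_comm]
  exact Finset.sum_congr rfl fun j _ => Finset.sum_congr rfl fun k _ => by ring

theorem cubicForm_symmetrize (A : Fin n → Fin n → Fin n → ℝ) (v : Coord n) :
    cubicForm (symmetrize A) v v v = cubicForm A v v v := by
  have h1 := cubicForm_swap_diag₁ A v
  have h2 := cubicForm_swap_diag₂ A v
  have h3 := (cubicForm_swap_diag₁ (fun i j k => A i k j) v).trans h2
  have h4 := (cubicForm_swap_diag₂ (fun i j k => A j i k) v).trans h1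
  have h5 := (cubicForm_swap_diag₁ (fun i j k => A k i j) v).trans h4
  have h6 : cubicForm (symmetrize A) v v v = (1 / 6) * (cubicForm A v v v
      + cubicForm (fun i j k => A j k i) v v v + cubicForm (fun i j k => A k i j) v v v
      + cubicForm (fun i j k => A j i k) v v v + cubicForm (fun i j k => A i k j) v v v
      + cubicForm (fun i j k => A k j i) v v v) := by
    simp only [cubicForm_eq_sum, symmetrize, mul_assoc, add_mul, Finset.sum_add_distrib,
      ← Finset.mul_sum]
  rw [h6, h1, h2, h3, h4, h5]
  ring

theorem cubicForm_tracefree3 {G : Matrix (Fin n) (Fin n) ℝ} (A : Fin n → Fin n → Fin n → ℝ) :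
    ∃ l : Coord n, ∀ v : Coord n, cubicForm (tracefree3 G A) v v v =
      cubicForm A v v v + (v ⬝ᵥ G *ᵥ v) * (l ⬝ᵥ v) := by
  let a : Coord n := fun c => ∑ p, ∑ q, G⁻¹ p q * A p q c
  refine ⟨(-(3 / ((n : ℝ) + 2))) • a, fun v => ?_⟩
  have h1 : (v ⬝ᵥ G *ᵥ v) * (a ⬝ᵥ v) = cubicForm (fun i j k => G i j * a k) v v v := by
    rw [cubicForm_eq_sum, dot_mulVec_eq_sum, dotProduct, Finset.sum_mul]
    refine Finset.sum_congr rfl fun i _ => ?_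
    rw [Finset.sum_mul]
    refine Finset.sum_congr rfl fun j _ => ?_
    rw [Finset.mul_sum]
    exact Finset.sum_congr rfl fun k _ => by ring
  have h2 := (cubicForm_swap_diag₂ (fun i j k => G j i * a k) v).trans
    (cubicForm_swap_diag₁ (fun i j k => G i j * a k) v)
  have h3 := (cubicForm_swap_diag₁ (fun i j k => G i k * a j) v).trans
    (cubicForm_swap_diag₂ (fun i j k => G i j * a k) v)
  have h4 : cubicForm (tracefree3 G A) v v v = cubicForm A v v v - (1 / ((n : ℝ) + 2)) *
      (cubicForm (fun i j k => G i j * a k) v v v + cubicForm (fun i j k => G j k * a i) v v v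
        + cubicForm (fun i j k => G k i * a j) v v v) := by
    simp only [cubicForm_eq_sum, tracefree3, sub_mul, add_mul, mul_assoc, Finset.sum_add_distrib,
      Finset.sum_sub_distrib, ← Finset.mul_sum]
    rfl
  rw [h4, h3, h2, ← h1, smul_dotProduct, smul_eq_mul]
  ring

/-- A trace-free cubic form divisible by the metric vanishes. -/
theorem eq_zero_of_cubic_eq_metric_mul {G : Matrix (Fin n) (Fin n) ℝ} (hG : G.IsSymm)
    (hdet : G.det ≠ 0) {C : Coord n →ₗ[ℝ] Coord n →ₗ[ℝ] Coord n →ₗ[ℝ] ℝ}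
    (h12 : ∀ x y z, C x y z = C y x z) (h23 : ∀ x y z, C x y z = C x z y)
    (htr : ∀ z, ∑ b, C (Pi.single b 1) (G⁻¹ *ᵥ Pi.single b 1) z = 0) {l : Coord n}
    (h : ∀ v, C v v v = (v ⬝ᵥ G *ᵥ v) * (l ⬝ᵥ v)) (x y z : Coord n) : C x y z = 0 := by
  have hGi : G⁻¹.IsSymm := by rw [Matrix.IsSymm, Matrix.transpose_nonsing_inv, hG.eq]
  have h1 : ∀ x y z, 3 * C x y z = (x ⬝ᵥ G *ᵥ y) * (l ⬝ᵥ z) + (y ⬝ᵥ G *ᵥ z) * (l ⬝ᵥ x)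
      + (x ⬝ᵥ G *ᵥ z) * (l ⬝ᵥ y) := by
    intro x y z
    have e1 := h (x + y + z)
    have e2 := h (x + y)
    have e3 := h (x + z)
    have e4 := h (y + z)
    have e5 := h x
    have e6 := h y
    have e7 := h z
    simp only [map_add, LinearMap.add_apply, Matrix.mulVec_add, dotProduct_add, add_dotProduct]
      at e1 e2 e3 e4
    simp only [h12 y x, h12 z x, h12 z y, h23 x z x, h23 x y x, h23 x z y, h23 y z y,
      h23 y z x, h23 y y x, h23 z z x, h23 z z y,
      dot_mulVec_comm hG y x, dot_mulVec_comm hG z x, dot_mulVec_comm hG z y] at e1 e2 e3 e4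
    linear_combination (1 / 2) * (e1 - e2 - e3 - e4 + e5 + e6 + e7)
  have h2 : ∀ (z : Coord n) (b : Fin n), 3 * C (Pi.single b 1) (G⁻¹ *ᵥ Pi.single b 1) z =
      l ⬝ᵥ z + (l ⬝ᵥ Pi.single b 1) * (z ⬝ᵥ Pi.single b 1)
        + ((G *ᵥ z) ⬝ᵥ Pi.single b 1) * ((G⁻¹ *ᵥ l) ⬝ᵥ Pi.single b 1) := by
    intro z b
    have e1 : (G⁻¹ *ᵥ Pi.single b 1) ⬝ᵥ (G *ᵥ z) = z ⬝ᵥ Pi.single b 1 := by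
      rw [dotProduct_comm, dot_mulVec_comm hGi, inv_mulVec_mulVec hdet, dotProduct_comm]
    have e2 : l ⬝ᵥ (G⁻¹ *ᵥ Pi.single b 1) = (G⁻¹ *ᵥ l) ⬝ᵥ Pi.single b 1 := by
      rw [dot_mulVec_comm hGi, dotProduct_comm]
    have e3 : Pi.single b 1 ⬝ᵥ (Pi.single b (1 : ℝ) : Coord n) = 1 := by simp
    rw [h1, mulVec_inv_mulVec hdet, e1, e2, e3, dotProduct_comm (Pi.single b 1)]
    ring
  have hl : ∀ z, l ⬝ᵥ z = 0 := by
    intro z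
    have h3 := congrArg (3 * ·) (htr z)
    have e : (G *ᵥ z) ⬝ᵥ (G⁻¹ *ᵥ l) = l ⬝ᵥ z := by
      rw [dot_mulVec_comm hGi, inv_mulVec_mulVec hdet]
    simp only [Finset.mul_sum, h2, Finset.sum_add_distrib, sum_single_dot, e, Finset.sum_const,
      Finset.card_univ, Fintype.card_fin, nsmul_eq_mul, mul_zero] at h3
    have h4 : ((n : ℝ) + 2) * (l ⬝ᵥ z) = 0 := by linarith
    exact (mul_eq_zero.1 h4).resolve_left (by positivity)
  have := h1 x y z
  simp only [hl, mul_zero, add_zero] at this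
  linarith

/-- The determinant scales by (Ω²)ⁿ, so its power -1/n scales by Ω⁻². -/
theorem ConformalOn.eq_of_density (hn : 3 ≤ n) (hc : ConformalOn g g' Ω U) (hg : IsMetricOn g U)
    (hx : x ∈ U) (hb : density g B x = density g' B' x) : B' x = Ω x ^ 2 * B x := by
  have hp := pow_pos (hc.pos x hx) 2
  have hd := abs_pos.2 (hg.nondeg x hx)
  have hn0 : (n : ℝ) ≠ 0 := by positivity
  have h1 : |(g' x).det| ^ (-(1 / (n : ℝ))) =
      (Ω x ^ 2)⁻¹ * |(g x).det| ^ (-(1 / (n : ℝ))) := by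
    rw [hc.eq x hx, Matrix.det_smul, Fintype.card_fin, abs_mul, abs_of_pos (pow_pos hp n),
      Real.mul_rpow (pow_pos hp n).le (abs_nonneg _), ← Real.rpow_natCast (Ω x ^ 2) n,
      ← Real.rpow_mul hp.le, mul_neg, mul_one_div_cancel hn0, Real.rpow_neg_one]
  have h2 := Real.rpow_pos_of_pos hd (-(1 / (n : ℝ)))
  unfold density at hb
  rw [h1, ← mul_assoc] at hb
  have h3 := mul_right_cancel₀ h2.ne' hb
  rw [h3, mul_comm, mul_assoc, inv_mul_cancel₀ hp.ne', mul_one]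

theorem traceForm_smul_metric {G : Matrix (Fin n) (Fin n) ℝ} (hdet : G.det ≠ 0) {μ : ℝ}
    (hμ : μ ≠ 0) (r : ℝ) (t a : Coord n) : traceForm (μ • G) r t a = traceForm G r t a := by
  have hi : (μ • G)⁻¹ = μ⁻¹ • G⁻¹ := by
    refine Matrix.inv_eq_left_inv ?_
    rw [Matrix.smul_mul, Matrix.mul_smul, Matrix.nonsing_inv_mul _ (isUnit_iff_ne_zero.2 hdet),
      smul_smul, inv_mul_cancel₀ hμ, one_smul]
  simp only [traceForm, hi, Matrix.smul_mulVec, Matrix.smul_vecMulVec, Matrix.vecMulVec_smul,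
    smul_smul]
  rw [mul_inv_cancel₀ hμ, mul_one]

theorem traceForm_sub (G : Matrix (Fin n) (Fin n) ℝ) (r : ℝ) (t t' a : Coord n) :
    traceForm G r (t - t') a = traceForm G r t a - traceForm G r t' a := by
  simp only [traceForm, sub_dotProduct, sub_smul, Matrix.vecMulVec_sub, Matrix.mulVec_sub,
    Matrix.sub_vecMulVec, smul_sub]
  abel

/-- On the diagonal, the difference of the two sides is a multiple of ⟨v, v⟩ by
`ConformalOn.third_cubic`. It is also symmetric and trace-free, hence zero. -/
theorem ConformalOn.cubicForm_symmThird (hn : 3 ≤ n) (hc : ConformalOn g g' Ω U)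
    (hg : IsMetricOn g U) (hg' : IsMetricOn g' U) (hU : IsOpen U)
    (hκ : HasConstantCurvature g U) (hκ' : HasConstantCurvature g' U)
    (hT : IsStructureTensor g T U) (hT' : IsStructureTensor g' T' U)
    (hB : ∀ y ∈ U, ContDiffAt ℝ ∞ B y) (hBB : ∀ y ∈ U, B' y = Ω y ^ 2 * B y)
    (hD : HasDecomposition g T (symmThird g B) t U)
    (hD' : HasDecomposition g' T' (symmThird g' B') t' U) (hx : x ∈ U) (a b k : Coord n) :
    cubicForm (symmThird g' B' x) a b k = Ω x ^ 2 * cubicForm (symmThird g B x) a b k := by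
  have hp := (pow_pos (hc.pos x hx) 2).ne'
  obtain ⟨c, hcs, hH⟩ := hc.hess_log hn hg hg' hU hκ hκ'
  obtain ⟨l, hl⟩ := hc.third_cubic hg hU hcs hH hx hB hBB
  obtain ⟨m, hm⟩ := cubicForm_tracefree3 (G := g x) (symmetrize fun a b c => third g B a b c x)
  obtain ⟨m', hm'⟩ := cubicForm_tracefree3 (G := g' x) (symmetrize fun a b c => third g' B' a b c x)
  have key := eq_zero_of_cubic_eq_metric_mul (hg.symm x hx) (hg.nondeg x hx)
    (C := cubicForm (symmThird g' B' x) + (-(Ω x ^ 2)) • cubicForm (symmThird g B x))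
    (l := l + (Ω x ^ 2) • m' - (Ω x ^ 2) • m)
    (fun y z w => by
      simp only [LinearMap.add_apply, LinearMap.smul_apply]
      rw [hD.symm₁ x hx, hD'.symm₁ x hx])
    (fun y z w => by
      simp only [LinearMap.add_apply, LinearMap.smul_apply]
      rw [hD.symm₂ x hx, hD'.symm₂ x hx]) ?_ ?_ a b k
  · simp only [LinearMap.add_apply, LinearMap.smul_apply, smul_eq_mul] at key
    linarith
  · intro z
    have h1 := hD.trace hn hg hT hx z
    have h2 := hD'.trace hn hg' hT' hx z
    simp only [hc.inv_eq hg hx, Matrix.smul_mulVec, map_smul, LinearMap.smul_apply,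
      ← Finset.smul_sum] at h2
    have h3 := (smul_eq_zero.1 h2).resolve_left (inv_ne_zero hp)
    simp only [LinearMap.add_apply, LinearMap.smul_apply, Finset.sum_add_distrib, h3,
      ← Finset.smul_sum, h1, smul_zero, add_zero]
  · intro v
    simp only [LinearMap.add_apply, LinearMap.smul_apply, smul_eq_mul]
    simp only [symmThird, hm, hm', cubicForm_symmetrize, hl]
    simp only [hc.eq x hx, Matrix.smul_mulVec, dotProduct_smul, smul_eq_mul, add_dotProduct,
      sub_dotProduct, smul_dotProduct]
    ring

/-- Structure tensors of conformally related metrics whose structure functions define the same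
density differ by a trace part only. -/
theorem ConformalOn.endForm_eq (hn : 3 ≤ n) (hc : ConformalOn g g' Ω U)
    (hg : IsMetricOn g U) (hg' : IsMetricOn g' U) (hU : IsOpen U)
    (hκ : HasConstantCurvature g U) (hκ' : HasConstantCurvature g' U)
    (hT : IsStructureTensor g T U) (hT' : IsStructureTensor g' T' U)
    (hB : ∀ y ∈ U, ContDiffAt ℝ ∞ B y) (hBB : ∀ y ∈ U, B' y = Ω y ^ 2 * B y)
    (hD : HasDecomposition g T (symmThird g B) t U)
    (hD' : HasDecomposition g' T' (symmThird g' B') t' U) (hx : x ∈ U) (a : Coord n) :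
    endForm (T' x) a = endForm (T x) a + traceForm (g x) (2 / n) (t' x - t x) a := by
  have hp := (pow_pos (hc.pos x hx) 2).ne'
  refine eq_of_dot fun k b => ?_
  have h1 := hD.lower x hx a b ((g x)⁻¹ *ᵥ k)
  have h2 := hD'.lower x hx a b ((g x)⁻¹ *ᵥ k)
  rw [hc.cubicForm_symmThird hn hg hg' hU hκ hκ' hT hT' hB hBB hD hD' hx, hc.eq x hx,
    traceForm_smul_metric (hg.nondeg x hx) hp] at h2
  rw [Matrix.smul_mulVec, smul_dotProduct, smul_dotProduct, mulVec_inv_mulVec (hg.nondeg x hx),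
    smul_eq_mul, smul_eq_mul, ← mul_add] at h2
  rw [mulVec_inv_mulVec (hg.nondeg x hx)] at h1
  rw [mul_left_cancel₀ hp h2, Matrix.add_mulVec, dotProduct_add, h1, traceForm_sub,
    Matrix.sub_mulVec, dotProduct_sub]
  ring

end StructureTensors

/-! ### Comparison of the integrability conditions -/

section Comparison

variable {n : ℕ} {g g' : Coord n → Matrix (Fin n) (Fin n) ℝ} {U : Set (Coord n)}
  {T T' s : Coord n → Fin n → Fin n → Fin n → ℝ} {t t' d : Coord n → Coord n}
  {Ω : Coord n → ℝ} {x : Coord n}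

theorem ConformalOn.covEnd_eq (hc : ConformalOn g g' Ω U) (hg : IsMetricOn g U) (hU : IsOpen U)
    (hT : IsStructureTensor g T U) (hd : ∀ x ∈ U, SmoothVec d x) {r : ℝ}
    (hTT : ∀ x ∈ U, ∀ a, endForm (T' x) a = endForm (T x) a + traceForm (g x) r (d x) a)
    (hx : x ∈ U) (c a : Coord n) :
    covEnd g' (fun y => endForm (T' y)) c a x = covEnd g (fun y => endForm (T y)) c a x
      + traceForm (g x) r (vdd c d x - (Superintegrable.conn g x c)ᵀ *ᵥ d x) a
      + traceForm (g x) 1 (grad (logFactor Ω) x) c * endForm (T' x) a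
      - endForm (T' x) a * traceForm (g x) 1 (grad (logFactor Ω) x) c
      - endForm (T' x) (traceForm (g x) 1 (grad (logFactor Ω) x) c *ᵥ a) := by
  have h1 : mdd c (fun y => endForm (T' y) a) x = mdd c (fun y => endForm (T y) a) x
      + mdd c (fun y => traceForm (g y) r (d y) a) x := by
    rw [mdd_congr ((hU.eventually_mem hx).mono fun y hy => hTT y hy a),
      mdd_add (hT.smoothMat hU hx a) (smoothMat_traceForm hg hU hx (hd x hx) r a)]
  have h2 := covEnd_traceForm hg hU hx (hd x hx) r c a
  rw [← h2]
  simp only [covEnd, h1, hc.conn hg hU hx, Matrix.add_mulVec, endForm_add]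
  rw [hTT x hx a, hTT x hx (Superintegrable.conn g x c *ᵥ a)]
  noncomm_ring

theorem vdd_vadd (a b : Coord n) : vdd (a + b) d x = vdd a d x + vdd b d x :=
  funext fun _ => dd_vadd a b

theorem vdd_vsmul (r : ℝ) (a : Coord n) : vdd (r • a) d x = r • vdd a d x :=
  funext fun _ => dd_vsmul r a

/-- Subtracting the two integrability identities, modulo ⟨v, v⟩: replacing T by T' contributes 3
e(v) S(z,v,v) + e(z) S(v,v,v) with e = t' - t. The change of connection contributes the same
expression with 3 dφ in place of e, so only the combination e + 3 dφ appears. -/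
theorem ConformalOn.cubic_identity (hc : ConformalOn g g' Ω U) (hg : IsMetricOn g U)
    (hU : IsOpen U) (hT : IsStructureTensor g T U) (hd : ∀ x ∈ U, SmoothVec (t' - t) x)
    (hTT : ∀ x ∈ U, ∀ a,
      endForm (T' x) a = endForm (T x) a + traceForm (g x) (2 / n) ((t' - t) x) a)
    (hD : HasDecomposition g T s t U) (hx : x ∈ U)
    (hK : ∀ z v : Coord n, z ⬝ᵥ g x *ᵥ v = 0 →
      3 * ((g x *ᵥ v) ⬝ᵥ covEnd g (fun y => endForm (T y)) v v x *ᵥ z)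
      - (g x *ᵥ v) ⬝ᵥ endForm (T x) v *ᵥ (endForm (T x) v *ᵥ z)
      - (1 + 2 / (n : ℝ)) * (t x ⬝ᵥ v) * ((g x *ᵥ v) ⬝ᵥ endForm (T x) v *ᵥ z) = 0)
    (hK' : ∀ z v : Coord n, z ⬝ᵥ g' x *ᵥ v = 0 →
      3 * ((g' x *ᵥ v) ⬝ᵥ covEnd g' (fun y => endForm (T' y)) v v x *ᵥ z)
      - (g' x *ᵥ v) ⬝ᵥ endForm (T' x) v *ᵥ (endForm (T' x) v *ᵥ z)
      - (1 + 2 / (n : ℝ)) * (t' x ⬝ᵥ v) * ((g' x *ᵥ v) ⬝ᵥ endForm (T' x) v *ᵥ z) = 0) :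
    ∃ f : Coord n →ₗ[ℝ] Coord n →ₗ[ℝ] ℝ, ∀ z v : Coord n, z ⬝ᵥ g x *ᵥ v = 0 →
      3 * (((t' - t) x + (3 : ℝ) • grad (logFactor Ω) x) ⬝ᵥ v) * cubicForm (s x) z v v
        + (((t' - t) x + (3 : ℝ) • grad (logFactor Ω) x) ⬝ᵥ z) * cubicForm (s x) v v v
        + (v ⬝ᵥ g x *ᵥ v) * f z v = 0 := by
  have hG := hg.symm x hx
  have hdet := hg.nondeg x hx
  have hp := (pow_pos (hc.pos x hx) 2).ne'
  set τ := grad (logFactor Ω) x with hτ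
  set e := (t' - t) x with he
  have ht' : t' x = t x + e := by rw [he]; simp
  -- This collects every coefficient of ⟨v, v⟩. Only its bilinearity in (z, v) is used later.
  refine ⟨LinearMap.mk₂ ℝ (fun z v => -(3 * (z ⬝ᵥ (vdd v (t' - t) x
      - (Superintegrable.conn g x v)ᵀ *ᵥ e))
    + 3 * (τ ⬝ᵥ endForm (T x) v *ᵥ z + (e ⬝ᵥ v) * (τ ⬝ᵥ z) + (e ⬝ᵥ z) * (τ ⬝ᵥ v))
    - 9 * (τ ⬝ᵥ v) * (t x ⬝ᵥ z + e ⬝ᵥ z)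
    - 3 * (2 - 2 / (n : ℝ)) * (τ ⬝ᵥ z) * (t x ⬝ᵥ v + e ⬝ᵥ v)
    + 3 * ((g x *ᵥ v) ⬝ᵥ endForm (T x) z *ᵥ ((g x)⁻¹ *ᵥ τ)
      + (e ⬝ᵥ z) * (τ ⬝ᵥ v) - 2 / (n : ℝ) * (τ ⬝ᵥ z) * (e ⬝ᵥ v))
    - (e ⬝ᵥ v) * (t x ⬝ᵥ z) - (2 - 2 / (n : ℝ)) * (e ⬝ᵥ z) * (t x ⬝ᵥ v)
    - (1 - 2 / (n : ℝ)) * (e ⬝ᵥ v) * (t x ⬝ᵥ z) - e ⬝ᵥ endForm (T x) v *ᵥ z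
    - (3 - 2 / (n : ℝ)) * (e ⬝ᵥ v) * (e ⬝ᵥ z)
    - (1 + 2 / (n : ℝ)) * ((t x ⬝ᵥ v) * (e ⬝ᵥ z) + (e ⬝ᵥ v) * (t x ⬝ᵥ z)
      + (e ⬝ᵥ v) * (e ⬝ᵥ z)))) ?_ ?_ ?_ ?_, fun z v hzv => ?_⟩
  · intro z z' v
    simp only [add_dotProduct, dotProduct_add, endForm_add, Matrix.add_mulVec, Matrix.mulVec_add]
    ring
  · intro c z v
    simp only [smul_dotProduct, dotProduct_smul, endForm_smul, Matrix.smul_mulVec,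
      Matrix.mulVec_smul, smul_eq_mul]
    ring
  · intro z v v'
    simp only [add_dotProduct, dotProduct_add, endForm_add, Matrix.add_mulVec, Matrix.mulVec_add,
      vdd_vadd, conn_add, Matrix.transpose_add, dotProduct_sub]
    ring
  · intro c z v
    have h1 : Superintegrable.conn g x (c • v) = c • Superintegrable.conn g x v := endForm_smul _ _ _
    simp only [smul_dotProduct, dotProduct_smul, endForm_smul, Matrix.smul_mulVec,
      Matrix.mulVec_smul, smul_eq_mul, vdd_vsmul, h1, Matrix.transpose_smul, dotProduct_sub]
    ring
  have h := hK z v hzv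
  have h' := hK' z v (hc.orthogonal hx hzv)
  have hvz : v ⬝ᵥ g x *ᵥ z = 0 := by rw [dot_mulVec_comm hG, hzv]
  have hpz : (g x *ᵥ v) ⬝ᵥ z = 0 := by rw [dotProduct_comm, hzv]
  obtain ⟨q, hq⟩ : ∃ q, v ⬝ᵥ g x *ᵥ v = q := ⟨_, rfl⟩
  have hpv : (g x *ᵥ v) ⬝ᵥ v = q := (dotProduct_comm _ _).trans hq
  have hps : ∀ w : Coord n, (g x *ᵥ v) ⬝ᵥ ((g x)⁻¹ *ᵥ w) = w ⬝ᵥ v := fun w => by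
    rw [dotProduct_comm, dot_mulVec_comm hG, mulVec_inv_mulVec hdet, dotProduct_comm]
  have hpw : ∀ w : Coord n, v ⬝ᵥ g x *ᵥ w = (g x *ᵥ v) ⬝ᵥ w := fun w => by
    rw [dot_mulVec_comm hG, dotProduct_comm]
  have e1 : (g x *ᵥ v) ⬝ᵥ endForm (T x) v *ᵥ z =
      cubicForm (s x) z v v + q * (t x ⬝ᵥ z) := by
    rw [hD.lower x hx, dot_traceForm_mulVec hG hdet, hzv, hvz, hq, hD.symm₁ x hx]
    ring
  have e2 : (g x *ᵥ v) ⬝ᵥ endForm (T x) v *ᵥ v =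
      cubicForm (s x) v v v + (2 - 2 / (n : ℝ)) * q * (t x ⬝ᵥ v) := by
    rw [hD.lower x hx, dot_traceForm_mulVec hG hdet, hq]
    ring
  have e3 : (g x *ᵥ v) ⬝ᵥ endForm (T x) ((g x)⁻¹ *ᵥ τ) *ᵥ z =
      (g x *ᵥ v) ⬝ᵥ endForm (T x) z *ᵥ ((g x)⁻¹ *ᵥ τ) := by rw [hT.endForm_comm hx]
  have e4 : ((g x)⁻¹ *ᵥ τ) ⬝ᵥ g x *ᵥ z = τ ⬝ᵥ z := by
    rw [dot_mulVec_comm hG, mulVec_inv_mulVec hdet, dotProduct_comm]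
  have e5 : e ⬝ᵥ ((g x)⁻¹ *ᵥ τ) = τ ⬝ᵥ ((g x)⁻¹ *ᵥ e) := by
    have hGi : (g x)⁻¹.IsSymm := by rw [Matrix.IsSymm, Matrix.transpose_nonsing_inv, hG.eq]
    rw [dot_mulVec_comm hGi]
  rw [hc.eq x hx, Matrix.smul_mulVec] at h'
  simp only [smul_dotProduct, smul_eq_mul] at h'
  rw [hc.covEnd_eq hg hU hT hd hTT hx] at h'
  have h2 : Ω x ^ 2 * (3 * ((g x *ᵥ v) ⬝ᵥ (covEnd g (fun y => endForm (T y)) v v x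
      + traceForm (g x) (2 / n) (vdd v (t' - t) x - (Superintegrable.conn g x v)ᵀ *ᵥ e) v
      + traceForm (g x) 1 τ v * endForm (T' x) v
      - endForm (T' x) v * traceForm (g x) 1 τ v
      - endForm (T' x) (traceForm (g x) 1 τ v *ᵥ v)) *ᵥ z)
      - (g x *ᵥ v) ⬝ᵥ endForm (T' x) v *ᵥ (endForm (T' x) v *ᵥ z)
      - (1 + 2 / (n : ℝ)) * (t' x ⬝ᵥ v) * ((g x *ᵥ v) ⬝ᵥ endForm (T' x) v *ᵥ z)) = 0 := by
    rw [← h']; ring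
  have h3 := (mul_eq_zero.1 h2).resolve_left hp
  simp only [hTT x hx, ← he, Matrix.add_mulVec, Matrix.sub_mulVec, ← Matrix.mulVec_mulVec,
    traceForm_mulVec hG, Matrix.mulVec_add, Matrix.mulVec_sub, Matrix.mulVec_smul, hvz, hpw, hpz,
    endForm_add, endForm_sub, endForm_smul, Matrix.smul_mulVec, dotProduct_add, dotProduct_sub,
    dotProduct_smul, smul_eq_mul, add_dotProduct, sub_dotProduct, smul_dotProduct, e1, e2, e3, e4,
    e5, hps, mul_zero, zero_smul, sub_zero, add_zero, zero_add, ht', hpv] at h3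
  simp only [LinearMap.mk₂_apply, hq, add_dotProduct, smul_dotProduct, smul_eq_mul, dotProduct_sub,
    dotProduct_comm z]
  rw [e1] at h
  linear_combination h - h3

/-- Subtracting the commutator condition for F from that for F', the terms with the dual vector of e
cancel by symmetry. What remains is β(a, k) c = β(c, k) a with β(a, k) = e(F_a k) + e(a) e(k). -/
theorem orthogonal_of_commutators {G : Matrix (Fin n) (Fin n) ℝ} (hn : 3 ≤ n) (hG : G.IsSymm)
    {F F' : Coord n → Matrix (Fin n) (Fin n) ℝ} {e : Coord n} {r : ℝ}
    (hFs : ∀ a b, F a *ᵥ b = F b *ᵥ a) (hF0 : F 0 = 0)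
    (hFF : ∀ a, F' a = F a + traceForm G r e a)
    (hsk : ∀ a c k : Coord n, a ⬝ᵥ G *ᵥ k = 0 → c ⬝ᵥ G *ᵥ k = 0 →
      a ⬝ᵥ G *ᵥ (F c *ᵥ k) = c ⬝ᵥ G *ᵥ (F a *ᵥ k))
    (hF : ∀ a c k : Coord n, a ⬝ᵥ G *ᵥ k = 0 → c ⬝ᵥ G *ᵥ k = 0 →
      F a *ᵥ (F c *ᵥ k) = F c *ᵥ (F a *ᵥ k))
    (hF' : ∀ a c k : Coord n, a ⬝ᵥ G *ᵥ k = 0 → c ⬝ᵥ G *ᵥ k = 0 →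
      F' a *ᵥ (F' c *ᵥ k) = F' c *ᵥ (F' a *ᵥ k)) {a k : Coord n} (hak : a ⬝ᵥ G *ᵥ k = 0) :
    e ⬝ᵥ F a *ᵥ k + (e ⬝ᵥ a) * (e ⬝ᵥ k) = 0 := by
  refine orthogonal_of_smul_eq hn (G := G) (β := fun a k => e ⬝ᵥ F a *ᵥ k + (e ⬝ᵥ a) * (e ⬝ᵥ k))
    ?_ (by simp [hF0]) hak
  intro k a c hak hck
  have h := hF' a c k hak hck
  simp only [hFF, Matrix.add_mulVec, traceForm_mulVec hG, hak, hck, Matrix.mulVec_add,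
    Matrix.mulVec_smul, mul_zero, zero_smul, sub_zero, hsk a c k hak hck, hF a c k hak hck, hFs a c, dot_mulVec_comm hG a c] at h
  have h2 := sub_eq_zero.2 h
  rw [← sub_eq_zero, ← neg_eq_zero]
  refine Eq.trans ?_ h2
  module

/-- The form e ⊗ e would be a multiple of the metric, but it has a nonzero kernel vector, so the
multiple is zero. -/
theorem eq_zero_of_orthogonal_mul_eq_zero {G : Matrix (Fin n) (Fin n) ℝ} (hn : 3 ≤ n)
    (hdet : G.det ≠ 0) {e : Coord n}
    (h : ∀ a k : Coord n, a ⬝ᵥ G *ᵥ k = 0 → (e ⬝ᵥ a) * (e ⬝ᵥ k) = 0) : e = 0 := by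
  obtain ⟨r, hr⟩ := exists_smul_of_orthogonal hdet (β := Matrix.vecMulVec e e) fun a k hak => by
    rw [dot_vecMulVec, h a k hak]
  obtain ⟨k, hk0, hk, -⟩ := exists_ne_zero_orthogonal hn e e
  have h1 : r • (G *ᵥ k) = 0 := by
    rw [← Matrix.smul_mulVec, ← hr, vecMulVec_mulVec', hk, zero_smul]
  have hr0 : r = 0 := (smul_eq_zero.1 h1).resolve_right fun h2 =>
    hk0 (eq_zero_of_mulVec_eq_zero hdet h2)
  ext i
  have h2 := congrFun (congrFun hr i) i
  rw [hr0, zero_smul, Matrix.vecMulVec_apply] at h2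
  simpa using h2

/-- If the totally symmetric part of the structure tensor of an abundant system vanishes at a
point, then so does the structure tensor. -/
theorem System.IsAbundant.endForm_eq_zero (hn : 3 ≤ n) (hU : IsOpen U)
    (hUc : IsConnected U) {S : System n U} (hS : S.IsAbundant T)
    (hκ : HasConstantCurvature S.g U) (hD : HasDecomposition S.g T s t U) (hx : x ∈ U)
    (hs : ∀ a b k, cubicForm (s x) a b k = 0) (a : Coord n) : endForm (T x) a = 0 := by
  have hg := S.isMetric
  have hG := hg.symm x hx
  have hdet := hg.nondeg x hx
  have h1 : ∀ a, endForm (T x) a = traceForm (S.g x) (2 / n) (t x) a := fun a => by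
    refine eq_of_dot fun k b => ?_
    have := hD.lower x hx a b ((S.g x)⁻¹ *ᵥ k)
    rwa [hs, zero_add, mulVec_inv_mulVec hdet] at this
  have ht : t x = 0 := by
    refine eq_zero_of_orthogonal_mul_eq_zero hn hdet fun a k hak => ?_
    -- With the cubic part gone, T is a pure trace term in t. Comparison with the zero tensor gives
    -- t(a) t(k) = 0 for a ⊥ k.
    have := orthogonal_of_commutators hn hG (F := fun _ => 0) (F' := endForm (T x)) (e := t x)
      (r := 2 / n) (by simp) rfl (by simpa using h1) (by simp) (by simp)
      (fun a c k hak hck => hS.commutator_eq_zero hn hU hUc hκ (hD.hasSkewPart hg) hD.smooth hx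
        hak hck) hak
    simpa using this
  rw [h1, ht]
  simp [traceForm]

theorem endForm_eq_zero_iff {C : Fin n → Fin n → Fin n → ℝ} :
    (∀ a, endForm C a = 0) ↔ ∀ i j k, C i j k = 0 := by
  refine ⟨fun h i j k => ?_, fun h a => ?_⟩
  · have := congrFun (congrFun (h (Pi.single i 1)) k) j
    simpa [endForm, Pi.single_apply] using this
  · ext k j
    simp [endForm, h]

theorem HasSkewPart.orthogonal (hskew : HasSkewPart g T t U) (hg : IsMetricOn g U) (hx : x ∈ U)
    {a c k : Coord n} (hak : a ⬝ᵥ g x *ᵥ k = 0) (hck : c ⬝ᵥ g x *ᵥ k = 0) :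
    a ⬝ᵥ g x *ᵥ (endForm (T x) c *ᵥ k) = c ⬝ᵥ g x *ᵥ (endForm (T x) a *ᵥ k) := by
  have h := congrArg (k ⬝ᵥ ·) (hskew x hx a c)
  simp only [dotProduct_sub, dotProduct_smul, transpose_dot, dot_mulVec_comm (hg.symm x hx) k, hak,
    hck, smul_zero, sub_zero] at h
  rw [dot_mulVec_comm (hg.symm x hx) a, dot_mulVec_comm (hg.symm x hx) c, dotProduct_comm,
    dotProduct_comm _ (g x *ᵥ c)]
  linarith

end Comparison

/-! ### Unique continuation for parallel Killing tensors of flat metrics -/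

section UniqueContinuation

variable {n : ℕ} {g K : Coord n → Matrix (Fin n) (Fin n) ℝ} {U : Set (Coord n)}
  {T s : Coord n → Fin n → Fin n → Fin n → ℝ} {t : Coord n → Coord n} {x : Coord n}

/-- The functions that on `U` are combinations of the functions `f i` with smooth coefficients. -/
def smoothSpan {ι : Type*} [Fintype ι] (U : Set (Coord n)) (f : ι → Coord n → ℝ) :
    Submodule ℝ (Coord n → ℝ) where
  carrier := {h | ∃ C : ι → Coord n → ℝ, (∀ i, ∀ x ∈ U, ContDiffAt ℝ ∞ (C i) x) ∧
    ∀ x ∈ U, h x = ∑ i, C i x * f i x}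
  zero_mem' := ⟨fun _ _ => 0, fun _ _ _ => contDiffAt_const, fun x _ => by simp⟩
  add_mem' := by
    rintro h k ⟨C, hC, hh⟩ ⟨D, hD, hk⟩
    refine ⟨fun i x => C i x + D i x, fun i x hx => (hC i x hx).add (hD i x hx), fun x hx => ?_⟩
    simp only [Pi.add_apply, hh x hx, hk x hx, add_mul, Finset.sum_add_distrib]
  smul_mem' := by
    rintro r h ⟨C, hC, hh⟩
    refine ⟨fun i x => r * C i x, fun i x hx => contDiffAt_const.mul (hC i x hx), fun x hx => ?_⟩
    simp only [Pi.smul_apply, hh x hx, smul_eq_mul, Finset.mul_sum, mul_assoc]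

/-! ### Calculus modulo smooth combinations of given functions -/

section smoothSpan

variable {ι : Type*} [Fintype ι] {f : ι → Coord n → ℝ} {h k c : Coord n → ℝ}

theorem smoothSpan_congr (hh : h ∈ smoothSpan U f) (hk : ∀ x ∈ U, k x = h x) :
    k ∈ smoothSpan U f := by
  obtain ⟨C, hC, hh⟩ := hh
  exact ⟨C, hC, fun x hx => (hk x hx).trans (hh x hx)⟩

theorem smoothSpan_mul (hc : ∀ x ∈ U, ContDiffAt ℝ ∞ c x) (hh : h ∈ smoothSpan U f) :
    (fun x => c x * h x) ∈ smoothSpan U f := by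
  obtain ⟨C, hC, hh⟩ := hh
  refine ⟨fun i x => c x * C i x, fun i x hx => (hc x hx).mul (hC i x hx), fun x hx => ?_⟩
  simp only [hh x hx, Finset.mul_sum, mul_assoc]

theorem smoothSpan_self (i : ι) : f i ∈ smoothSpan U f := by
  classical
  refine ⟨fun j _ => if j = i then 1 else 0, fun _ _ _ => contDiffAt_const, fun x _ => ?_⟩
  simp

theorem smoothSpan_sum {κ : Type*} (F : Finset κ) {H : κ → Coord n → ℝ}
    (hH : ∀ m ∈ F, H m ∈ smoothSpan U f) : (fun x => ∑ m ∈ F, H m x) ∈ smoothSpan U f := by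
  have := Submodule.sum_mem _ hH
  refine smoothSpan_congr this fun x _ => ?_
  simp

/-- The functions `f i` and their first partial derivatives. -/
def firstJet (f : ι → Coord n → ℝ) : ι ⊕ (Fin n × ι) → Coord n → ℝ :=
  Sum.elim f fun p => pd p.1 (f p.2)

theorem pd_mem_smoothSpan (hU : IsOpen U) (hf : ∀ i, ∀ x ∈ U, ContDiffAt ℝ ∞ (f i) x)
    (hh : h ∈ smoothSpan U f) (a : Fin n) : pd a h ∈ smoothSpan U (firstJet f) := by
  obtain ⟨C, hC, hh⟩ := hh
  have h1 : ∀ x ∈ U, pd a h x = ∑ i, (pd a (C i) x * f i x + C i x * pd a (f i) x) := by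
    intro x hx
    have e : pd a h x = pd a (fun y => ∑ i, C i y * f i y) x :=
      dd_congr ((hU.eventually_mem hx).mono hh)
    rw [e, pd_eq_dd, dd_sum _ fun i _ => (hC i x hx).mul (hf i x hx)]
    refine Finset.sum_congr rfl fun i _ => ?_
    rw [dd_mul (hC i x hx) (hf i x hx), pd_eq_dd, pd_eq_dd]
  refine smoothSpan_congr (smoothSpan_sum Finset.univ fun i _ => Submodule.add_mem _
    (smoothSpan_mul (fun x hx => smooth_dd (hC i x hx)) (smoothSpan_self (f := firstJet f) (Sum.inl i)))
    (smoothSpan_mul (hC i) (smoothSpan_self (f := firstJet f) (Sum.inr (a, i))))) h1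

theorem eq_zero_of_smoothSpan (hU : IsOpen U) (hUc : IsConnected U)
    (hf : ∀ i, ∀ x ∈ U, ContDiffAt ℝ ∞ (f i) x)
    (hd : ∀ a i, pd a (f i) ∈ smoothSpan U f) (hx : x ∈ U) (h0 : ∀ i, f i x = 0) :
    ∀ y ∈ U, ∀ i, f i y = 0 := by
  choose M hM hM' using hd
  exact eq_zero_of_linear_system hU hUc (fun i y hy => smooth_differentiableAt (hf i y hy)) M
    (fun a i j y hy => (hM a i j y hy).continuousAt) (fun y hy a i => hM' a i y hy) hx h0

end smoothSpan

/-- A tensor symmetric in its first two and in its last three indices vanishes if its cyclic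
sums do. -/
theorem eq_zero_of_cyclic {ι M : Type*} [AddCommGroup M] [Module ℝ M] {φ : ι → ι → ι → ι → ι → M}
    (h1 : ∀ i j a b c, φ i j a b c = φ j i a b c) (h2 : ∀ i j a b c, φ i j a b c = φ i j b a c)
    (h3 : ∀ i j a b c, φ i j a b c = φ i j a c b)
    (h : ∀ i j a b c, φ i j a b c + φ j a i b c + φ a i j b c = 0) (i j a b c : ι) :
    φ i j a b c = 0 := by
  have e1 := h i j a b c
  have e2 := h i j b a c
  have e3 := h i j c a b
  have e4 := h i a b j c
  have e5 := h i a c j b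
  have e6 := h i b c j a
  have e7 := h j a b i c
  have e8 := h j a c i b
  have e9 := h j b c i a
  have e10 := h a b c i j
  simp only [h1, h2, h3] at e1 e2 e3 e4 e5 e6 e7 e8 e9 e10 ⊢
  -- By symmetry φ depends only on which two of the five indices form the first pair. The relations
  -- are weighted according to whether their triple contains both, one or none of i, j, and only the
  -- term with the pair {i, j} survives.
  linear_combination (norm := module) (1 / 3 : ℝ) • (e1 + e2 + e3) -
    (1 / 6 : ℝ) • (e4 + e5 + e6 + e7 + e8 + e9) + (1 / 3 : ℝ) • e10

/-- Components of the covariant derivative of a contravariant tensor, with lowered indices. -/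
def covDown (g K : Coord n → Matrix (Fin n) (Fin n) ℝ) (p : Fin n × Fin n × Fin n) (x : Coord n) :
    ℝ :=
  (g x *ᵥ Pi.single p.2.1 1) ⬝ᵥ covUp g K (Pi.single p.1 1) x *ᵥ (g x *ᵥ Pi.single p.2.2 1)

theorem smooth_covDown (hg : IsMetricOn g U) (hU : IsOpen U) (hK : ∀ x ∈ U, SmoothMat K x)
    (p : Fin n × Fin n × Fin n) : ∀ x ∈ U, ContDiffAt ℝ ∞ (covDown g K p) x := fun x hx =>
  smooth_dot (smoothVec_mulVec (hg.smoothMat hU hx) (smoothVec_const _))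
    (smoothVec_mulVec (smoothMat_covUp hg hU (hK x hx) hx _)
      (smoothVec_mulVec (hg.smoothMat hU hx) (smoothVec_const _)))

theorem covUp_eq_zero_of_covDown (hg : IsMetricOn g U) (hx : x ∈ U)
    (h : ∀ p, covDown g K p x = 0) (a : Coord n) : covUp g K a x = 0 := by
  let L : Coord n →ₗ[ℝ] Matrix (Fin n) (Fin n) ℝ :=
    { toFun := fun a => covUp g K a x
      map_add' := covUp_vadd
      map_smul' := fun r a => by
        have h1 : mdd (r • a) K x = r • mdd a K x := by
          ext i j
          exact dd_vsmul r a
        have h2 : conn g x (r • a) = r • conn g x a := endForm_smul _ _ _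
        simp only [covUp, h1, h2, Matrix.transpose_smul, Matrix.smul_mul, Matrix.mul_smul, smul_add,
          RingHom.id_apply] }
  have hL : L = 0 := by
    refine (Pi.basisFun ℝ (Fin n)).ext fun a => ?_
    rw [Pi.basisFun_apply]
    have hu : IsUnit (g x) := (Matrix.isUnit_iff_isUnit_det _).2 (hg.nondeg x hx).isUnit
    have h1 : (g x)ᵀ * covUp g K (Pi.single a 1) x * g x = 0 := by
      ext i j
      have : Pi.single i 1 ⬝ᵥ ((g x)ᵀ * covUp g K (Pi.single a 1) x * g x) *ᵥ Pi.single j 1 = 0 := by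
        rw [← Matrix.mulVec_mulVec, ← Matrix.mulVec_mulVec, transpose_dot, dotProduct_comm]
        exact h (a, i, j)
      simp only [Matrix.mulVec_single_one, single_one_dotProduct] at this
      exact this
    have hu' : IsUnit (g x)ᵀ := (hg.symm x hx).symm ▸ hu
    exact hu'.mul_right_eq_zero.1 (hu.mul_left_eq_zero.1 h1)
  exact LinearMap.congr_fun hL a

theorem pd_covDown (hg : IsMetricOn g U) (hU : IsOpen U) (hK : ∀ x ∈ U, SmoothMat K x)
    (hx : x ∈ U) (b a i j : Fin n) :
    pd b (covDown g K (a, i, j)) x =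
      (g x *ᵥ Pi.single i 1) ⬝ᵥ (mdd (Pi.single b 1) (covUp g K (Pi.single a 1)) x
        + conn g x (Pi.single b 1) * covUp g K (Pi.single a 1) x
        + covUp g K (Pi.single a 1) x * (conn g x (Pi.single b 1))ᵀ) *ᵥ (g x *ᵥ Pi.single j 1)
      + (∑ m, christoffel g m b i x * covDown g K (a, m, j) x
        + ∑ m, christoffel g m b j x * covDown g K (a, i, m) x) := by
  have hgx := hg.smoothMat hU hx
  have hN := smoothMat_covUp hg hU (hK x hx) hx (Pi.single a 1)
  have hc : ∀ i : Fin n, g x *ᵥ (conn g x (Pi.single b 1) *ᵥ Pi.single i 1) =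
      ∑ m, christoffel g m b i x • (g x *ᵥ Pi.single m 1) := by
    intro i
    have : conn g x (Pi.single b 1) *ᵥ Pi.single i 1 =
        ∑ m, christoffel g m b i x • (Pi.single m 1 : Coord n) := by
      ext m
      simp [conn, endForm, Pi.single_apply, Finset.sum_apply]
    rw [this, Matrix.mulVec_sum]
    simp only [Matrix.mulVec_smul]
  have hv : ∀ i : Fin n, vdd (Pi.single b 1) (fun y => g y *ᵥ Pi.single i 1) x =
      (conn g x (Pi.single b 1))ᵀ *ᵥ (g x *ᵥ Pi.single i 1)
        + ∑ m, christoffel g m b i x • (g x *ᵥ Pi.single m 1) := by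
    intro i
    rw [vdd_mulVec hgx (smoothVec_const _), vdd_const, hg.mdd_metric hU hx, Matrix.mulVec_zero,
      add_zero, Matrix.add_mulVec, ← Matrix.mulVec_mulVec, ← Matrix.mulVec_mulVec, hc]
  unfold covDown
  rw [pd_eq_dd, dd_dot (smoothVec_mulVec hgx (smoothVec_const _))
    (smoothVec_mulVec hN (smoothVec_mulVec hgx (smoothVec_const _))),
    vdd_mulVec hN (smoothVec_mulVec hgx (smoothVec_const _)), hv, hv]
  simp only [Matrix.mulVec_add, Matrix.add_mulVec, dotProduct_add, add_dotProduct,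
    ← Matrix.mulVec_mulVec, Matrix.mulVec_sum, dotProduct_sum, sum_dotProduct, smul_dotProduct,
    Matrix.mulVec_smul, dotProduct_smul, smul_eq_mul]
  rw [dotProduct_comm ((conn g x (Pi.single b 1))ᵀ *ᵥ _), transpose_dot]
  ring

/-- For a flat metric covariant derivatives commute; the Christoffel terms left over in coordinates
are of lower order. -/
theorem pd_covDown_sub_mem (hg : IsMetricOn g U) (hU : IsOpen U) (hK : ∀ x ∈ U, SmoothMat K x)
    (hflat : ∀ x ∈ U, ∀ c a, curvature (conn g) c a x = 0) (b a i j : Fin n) :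
    pd b (covDown g K (a, i, j)) - pd a (covDown g K (b, i, j)) ∈ smoothSpan U (covDown g K) := by
  have hm : ∀ b a i j : Fin n, (fun x => ∑ m, christoffel g m b i x * covDown g K (a, m, j) x)
      + (fun x => ∑ m, christoffel g m b j x * covDown g K (a, i, m) x)
      ∈ smoothSpan U (covDown g K) := fun b a i j => Submodule.add_mem _
    (smoothSpan_sum _ fun m _ => smoothSpan_mul (fun x hx => hg.smooth_christoffel hU hx _ _ _)
      (smoothSpan_self _))
    (smoothSpan_sum _ fun m _ => smoothSpan_mul (fun x hx => hg.smooth_christoffel hU hx _ _ _)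
      (smoothSpan_self _))
  refine smoothSpan_congr (Submodule.sub_mem _ (hm b a i j) (hm a b i j)) fun x hx => ?_
  have h := covUp_commutator hg hU (hK x hx) hx (Pi.single b 1) (Pi.single a 1)
  rw [hflat x hx] at h
  simp only [Matrix.zero_mul, Matrix.transpose_zero, Matrix.mul_zero, add_zero, sub_eq_zero] at h
  simp only [Pi.sub_apply, Pi.add_apply, pd_covDown hg hU hK hx, h]
  ring

/-- In flat space a Killing tensor of rank two is a quadratic polynomial: its third derivatives are
symmetric in the derivative indices and satisfy the cyclic condition, so they vanish. In general
coordinates this holds modulo the components of ∇K and their first derivatives, which therefore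
satisfy a closed linear system. -/
theorem covUp_eq_zero_of_flat (hg : IsMetricOn g U) (hU : IsOpen U) (hUc : IsConnected U)
    (hK : ∀ x ∈ U, SmoothMat K x) (hKs : ∀ x ∈ U, (K x).IsSymm)
    (hcyc : ∀ x ∈ U, ∀ a i j : Coord n, (g x *ᵥ i) ⬝ᵥ covUp g K a x *ᵥ (g x *ᵥ j)
      + (g x *ᵥ a) ⬝ᵥ covUp g K i x *ᵥ (g x *ᵥ j) + (g x *ᵥ a) ⬝ᵥ covUp g K j x *ᵥ (g x *ᵥ i) = 0)
    (hflat : ∀ x ∈ U, ∀ c a, curvature (conn g) c a x = 0)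
    (hx : x ∈ U) (h0 : ∀ᶠ y in 𝓝 x, ∀ a, covUp g K a y = 0) :
    ∀ y ∈ U, ∀ a, covUp g K a y = 0 := by
  have hs := smooth_covDown hg hU hK
  have hs1 : ∀ i, ∀ y ∈ U, ContDiffAt ℝ ∞ (firstJet (covDown g K) i) y := by
    rintro (p | ⟨a, p⟩) y hy
    · exact hs p y hy
    · exact smooth_dd (hs p y hy)
  -- The symmetries hold only up to terms in the first jet of ∇K, so the algebra is carried out in
  -- the quotient by these terms.
  let Q := smoothSpan U (firstJet (covDown g K))
  have hdiff : ∀ {h k : Coord n → ℝ}, (∀ y ∈ U, h y = k y) → Q.mkQ h = Q.mkQ k := by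
    intro h k hhk
    rw [← sub_eq_zero, ← map_sub, Submodule.mkQ_apply, Submodule.Quotient.mk_eq_zero]
    exact smoothSpan_congr Q.zero_mem fun y hy => by simp [hhk y hy]
  have hsym : ∀ a i j, ∀ y ∈ U, covDown g K (a, i, j) y = covDown g K (a, j, i) y :=
    fun a i j y hy => dot_mulVec_comm (covUp_symm hU hy hKs _) _ _
  have hpd : ∀ {h k : Coord n → ℝ} (c), (∀ y ∈ U, h y = k y) → ∀ y ∈ U, pd c h y = pd c k y :=
    fun c hhk y hy => dd_congr ((hU.eventually_mem hy).mono hhk)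
  have hzero : ∀ i j a b c, Q.mkQ (pd c (pd b (covDown g K (a, i, j)))) = 0 := by
    refine eq_zero_of_cyclic (φ := fun i j a b c => Q.mkQ (pd c (pd b (covDown g K (a, i, j)))))
      ?_ ?_ ?_ ?_
    · exact fun i j a b c => hdiff (hpd c (hpd b (hsym a i j)))
    · intro i j a b c
      rw [← sub_eq_zero, ← map_sub, Submodule.mkQ_apply, Submodule.Quotient.mk_eq_zero]
      refine smoothSpan_congr (pd_mem_smoothSpan hU hs
        (pd_covDown_sub_mem hg hU hK hflat b a i j) c) fun y hy => ?_
      exact (dd_sub (smooth_dd (hs _ y hy)) (smooth_dd (hs _ y hy))).symm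
    · exact fun i j a b c => hdiff fun y hy => dd_comm (hs _ y hy) _ _
    · intro i j a b c
      rw [← map_add, ← map_add, ← map_zero Q.mkQ]
      refine hdiff fun y hy => ?_
      have h1 : ∀ y ∈ U, covDown g K (a, i, j) y + covDown g K (i, j, a) y
          + covDown g K (j, a, i) y = 0 := fun y hy => by
        rw [hsym i j a y hy]
        exact hcyc y hy _ _ _
      have h2 := hpd c (hpd b h1) y hy
      have hadd : ∀ (c : Fin n) {F G H : Coord n → ℝ}, (∀ y ∈ U, ContDiffAt ℝ ∞ F y) →
          (∀ y ∈ U, ContDiffAt ℝ ∞ G y) → (∀ y ∈ U, ContDiffAt ℝ ∞ H y) → ∀ y ∈ U,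
          pd c (fun y => F y + G y + H y) y = pd c F y + pd c G y + pd c H y := by
        intro c F G H hF hG hH y hy
        rw [pd_eq_dd, dd_add ((hF y hy).add (hG y hy)) (hH y hy), dd_add (hF y hy) (hG y hy)]
        rfl
      have h3 := hadd b (hs (a, i, j)) (hs (i, j, a)) (hs (j, a, i))
      have h4 := hadd c (fun y hy => smooth_dd (v := Pi.single b 1) (hs (a, i, j) y hy))
        (fun y hy => smooth_dd (v := Pi.single b 1) (hs (i, j, a) y hy))
        (fun y hy => smooth_dd (v := Pi.single b 1) (hs (j, a, i) y hy)) y hy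
      have h5 : pd c (pd b fun _ => 0) y = 0 :=
        (hpd c (fun z _ => dd_const 0) y hy).trans (dd_const 0)
      exact h4.symm.trans ((hpd c h3 y hy).symm.trans (h2.trans h5))
  have hd : ∀ a i, pd a (firstJet (covDown g K) i) ∈ Q := by
    rintro a (p | ⟨b, p⟩)
    · exact smoothSpan_self (f := firstJet (covDown g K)) (Sum.inr (a, p))
    · have := hzero p.2.1 p.2.2 p.1 b a
      rwa [Submodule.mkQ_apply, Submodule.Quotient.mk_eq_zero] at this
  have hx0 : ∀ᶠ y in 𝓝 x, ∀ p, covDown g K p y = 0 := h0.mono fun y hy p => by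
    simp [covDown, hy]
  have hall := eq_zero_of_smoothSpan hU hUc hs1 hd hx (by
    rintro (p | ⟨b, p⟩)
    · exact hx0.self_of_nhds p
    · have : pd b (covDown g K p) x = pd b (fun _ => 0) x := dd_congr (hx0.mono fun y hy => hy p)
      exact this.trans (dd_const _))
  exact fun y hy a => covUp_eq_zero_of_covDown hg hy (fun p => hall y hy (Sum.inl p)) a

theorem sum_inv_mul_self {G : Matrix (Fin n) (Fin n) ℝ} (hG : G.IsSymm) (hdet : G.det ≠ 0) :
    ∑ i, ∑ j, G⁻¹ i j * G i j = (n : ℝ) := by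
  have h : ∑ i, (G⁻¹ * G) i i = (n : ℝ) := by
    rw [Matrix.nonsing_inv_mul _ hdet.isUnit]
    simp
  rw [← h]
  simp only [Matrix.mul_apply, hG.apply]

/-- If the structure tensor of an abundant system on a constant curvature space vanishes near one
point, then it vanishes identically. -/
theorem System.IsAbundant.eq_zero_of_eventually (hn : 3 ≤ n) (hU : IsOpen U)
    (hUc : IsConnected U) {S : System n U} (hS : S.IsAbundant T)
    (hκ : HasConstantCurvature S.g U) (hskew : HasSkewPart S.g T t U)
    (ht : ∀ x ∈ U, SmoothVec t x) (hx : x ∈ U)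
    (h0 : ∀ᶠ y in 𝓝 x, ∀ a, endForm (T y) a = 0) : ∀ y ∈ U, ∀ i j k, T y i j k = 0 := by
  have hg := S.isMetric
  have hT := hS.nondegenerate.tensor
  obtain ⟨κ, hκ⟩ := hκ
  have hex : ∀ y ∈ U, ∀ k : Coord n, ∃ K ∈ S.killing, K y = Matrix.vecMulVec k k := fun y hy k =>
    hS.exists_killing hn hU hUc hskew ht hy (by rw [Matrix.IsSymm, Matrix.transpose_vecMulVec])
  have hsm : ∀ K ∈ S.killing, ∀ y ∈ U, SmoothMat K y := fun K hK y hy i j =>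
    (S.killing_smooth K hK i j).contDiffAt (hU.mem_nhds hy)
  have hke : ∀ K ∈ S.killing, KillingEq S.g T K U := fun K hK =>
    hS.nondegenerate.killingEq hn hU hUc hskew ht (hsm K hK) (S.killing_symm K hK)
      fun V hV => S.integral V hV K hK
  -- Where T = 0 the Killing system reads ∇K = 0. Parallel tensors with arbitrary rank-one value at
  -- `x` then force the curvature to vanish there.
  have hnear : ∀ K ∈ S.killing, ∀ᶠ y in 𝓝 x, ∀ a, covUp S.g K a y = 0 := by
    intro K hK
    filter_upwards [h0, hU.eventually_mem hx] with y hy hyU a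
    have := hke K hK y hyU a
    simpa [hy] using this
  have hR : ∀ c a k : Coord n, curvature (conn S.g) c a x *ᵥ k = 0 := by
    intro c a k
    by_cases hk : k = 0
    · rw [hk, Matrix.mulVec_zero]
    obtain ⟨K, hK, hKk⟩ := hex x hx k
    have h := covUp_commutator hg hU (hsm K hK x hx) hx c a
    have hd : ∀ c a : Coord n, mdd c (covUp S.g K a) x = 0 := fun c a =>
      (mdd_congr ((hnear K hK).mono fun y hy => hy a)).trans (mdd_const 0)
    have hz := (hnear K hK).self_of_nhds
    simp only [hd, hz, hKk, Matrix.mul_zero, Matrix.zero_mul, add_zero, sub_zero] at h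
    rw [Matrix.mul_vecMulVec, Matrix.vecMulVec_mul, Matrix.vecMul_transpose] at h
    exact eq_zero_of_symm_vecMulVec hk h.symm
  have hκ0 : κ = 0 := by
    obtain ⟨k, hk, -⟩ := exists_ne_zero_orthogonal hn 0 0
    have hGk : S.g x *ᵥ k ≠ 0 := fun h => hk (eq_zero_of_mulVec_eq_zero (hg.nondeg x hx) h)
    obtain ⟨c, hc, hck, -⟩ := exists_ne_zero_orthogonal hn (S.g x *ᵥ k) 0
    -- The second vector has the components of the covector g k, so its product with k is a
    -- Euclidean square and nonzero in any signature. With 0 ≠ c ⊥ k, this yields κ = 0.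
    have h := hR c (S.g x *ᵥ k) k
    rw [curvature_of_constant hg hU hx (hκ x hx), dotProduct_comm c, hck, zero_smul, sub_zero,
      smul_smul] at h
    have h2 : (S.g x *ᵥ k) ⬝ᵥ (S.g x *ᵥ k) ≠ 0 := fun h3 => hGk (dotProduct_self_eq_zero.1 h3)
    exact (mul_eq_zero.1 ((smul_eq_zero.1 h).resolve_right hc)).resolve_right h2
  have hflat : ∀ y ∈ U, ∀ c a, curvature (conn S.g) c a y = 0 := by
    intro y hy c a
    refine Matrix.ext_of_mulVec_single fun i => ?_
    rw [curvature_of_constant hg hU hy (hκ y hy), hκ0, zero_smul, Matrix.zero_mulVec]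
  have hpar : ∀ K ∈ S.killing, ∀ y ∈ U, ∀ a, covUp S.g K a y = 0 := by
    intro K hK
    have hpot : (0 : Coord n → ℝ) ∈ S.potentials := Submodule.zero_mem _
    have hkill := ((admitsIntegral_iff hg hU (hsm K hK) (S.killing_symm K hK)
      fun y _ => contDiffAt_const).1 (S.integral 0 hpot K hK)).1
    exact covUp_eq_zero_of_flat hg hU hUc (hsm K hK) (S.killing_symm K hK)
      (fun y hy => killing_cyclic hg hU hy (S.killing_symm K hK) (hkill y hy)) hflat hx (hnear K hK)
  intro y hy
  -- Now all Killing tensors are parallel on `U`, and the Killing system for the value k ⊗ k leaves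
  -- T_a k ⊗ k + k ⊗ T_a k = 0. Each component of T is thus a multiple of the metric, and it is
  -- trace-free.
  have hTk : ∀ a k : Coord n, a ⬝ᵥ S.g y *ᵥ k = 0 → endForm (T y) a *ᵥ k = 0 := by
    intro a k hak
    by_cases hk : k = 0
    · rw [hk, Matrix.mulVec_zero]
    obtain ⟨K, hK, hKk⟩ := hex y hy k
    have h := covUp_of_orthogonal (hke K hK) hy (a := a) (by
      rw [hKk, vecMulVec_mulVec', dot_mulVec_comm (hg.symm y hy), hak, zero_smul])
    rw [hpar K hK y hy, smul_zero, hKk, Matrix.mul_vecMulVec, Matrix.vecMulVec_mul,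
      Matrix.vecMul_transpose] at h
    refine eq_zero_of_symm_vecMulVec hk ?_
    rw [← neg_eq_zero, neg_add, ← sub_eq_add_neg]
    exact h.symm
  intro i j l
  obtain ⟨r, hr⟩ := exists_smul_of_orthogonal (hg.nondeg y hy)
    (β := Matrix.of fun i j => T y i j l) fun a k hak => by
      refine Eq.trans ?_ (congrFun (hTk a k hak) l)
      simp only [endForm, Matrix.mulVec, dotProduct, Matrix.of_apply, Finset.mul_sum, Finset.sum_mul]
      rw [Finset.sum_comm]
      exact Finset.sum_congr rfl fun _ _ => Finset.sum_congr rfl fun _ _ => by ring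
  have hT' : ∀ i j, T y i j l = r * S.g y i j := fun i j => congrFun (congrFun hr i) j
  have htr := hT.tracefree y hy l
  have hn0 : (n : ℝ) ≠ 0 := by positivity
  have h1 : ∑ i, ∑ j, (S.g y)⁻¹ i j * T y i j l = r * n := by
    rw [← sum_inv_mul_self (hg.symm y hy) (hg.nondeg y hy)]
    simp only [hT', Finset.mul_sum]
    exact Finset.sum_congr rfl fun i _ => Finset.sum_congr rfl fun j _ => by ring
  rw [h1, mul_eq_zero, or_iff_left hn0] at htr
  rw [hT', htr, zero_mul]

end UniqueContinuation

/-! ### Comparison of two conformally related abundant systems -/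

section ConformalPair

variable {n : ℕ} {U : Set (Coord n)} {S S' : System n U}
  {T T' s s' : Coord n → Fin n → Fin n → Fin n → ℝ} {t t' : Coord n → Coord n}
  {Ω : Coord n → ℝ} {x : Coord n}

/-- Two abundant systems on conformally related spaces of constant curvature, for which the totally
symmetric parts of the structure tensors correspond. -/
structure ConformalPair (S S' : System n U) (T T' s s' : Coord n → Fin n → Fin n → Fin n → ℝ)
    (t t' : Coord n → Coord n) (Ω : Coord n → ℝ) : Prop where
  conformal : ConformalOn S.g S'.g Ω U
  abundant : S.IsAbundant T
  abundant' : S'.IsAbundant T'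
  curv : HasConstantCurvature S.g U
  curv' : HasConstantCurvature S'.g U
  decomp : HasDecomposition S.g T s t U
  decomp' : HasDecomposition S'.g T' s' t' U
  cubic : ∀ x ∈ U, ∀ a b k, cubicForm (s' x) a b k = Ω x ^ 2 * cubicForm (s x) a b k
  endForm_eq : ∀ x ∈ U, ∀ a,
    endForm (T' x) a = endForm (T x) a + traceForm (S.g x) (2 / n) ((t' - t) x) a

/-- For a ⊥ k, applying d to the image of k under the form gives 2 d(a) d(k) = 0. -/
theorem eq_zero_of_traceForm_eq_zero {G : Matrix (Fin n) (Fin n) ℝ} (hn : 3 ≤ n) (hG : G.IsSymm)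
    (hdet : G.det ≠ 0) {r : ℝ} {d : Coord n} (h : ∀ a, traceForm G r d a = 0) : d = 0 := by
  refine eq_zero_of_orthogonal_mul_eq_zero hn hdet fun a k hak => ?_
  have h1 := congrArg (d ⬝ᵥ ·) (traceForm_mulVec hG r d a k)
  simp only [h, Matrix.zero_mulVec, hak, mul_zero, zero_smul, sub_zero, dotProduct_add,
    dotProduct_smul, smul_eq_mul, dotProduct_zero] at h1
  linarith

theorem ConformalOn.grad_logFactor_eq_zero {g g' : Coord n → Matrix (Fin n) (Fin n) ℝ} (hn : 3 ≤ n)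
    (hc : ConformalOn g g' Ω U) (hg : IsMetricOn g U) (hU : IsOpen U) {c : ℝ}
    (h : ∀ x ∈ U, g' x = c • g x) (hx : x ∈ U) : grad (logFactor Ω) x = 0 := by
  have h1 : ∀ y ∈ U, Ω y ^ 2 = c := by
    intro y hy
    have hne : g y ≠ 0 := fun h0 => hg.nondeg y hy (by
      have : Nonempty (Fin n) := ⟨⟨0, by omega⟩⟩
      rw [h0, Matrix.det_zero])
    have h2 := hc.eq y hy
    rw [h y hy, ← sub_eq_zero, ← sub_smul] at h2
    exact (sub_eq_zero.1 ((smul_eq_zero.1 h2).resolve_right hne)).symm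
  ext i
  have h2 := hc.dd_sq hx (Pi.single i 1)
  rw [dd_congr ((hU.eventually_mem hx).mono h1), dd_const] at h2
  exact (mul_eq_zero.1 h2.symm).resolve_left
    (mul_ne_zero two_ne_zero (pow_pos (hc.pos x hx) 2).ne')

/-- If u = t' - t + 3 dφ is nonzero at a point, it is so nearby. There the cubic identity kills the
cubic parts, hence both structure tensors, which then vanish on all of `U`. The excluded case gives
dφ = 0, and T = T' = 0 gives t' = t, so u = 0 after all. -/
theorem ConformalPair.add_grad_eq_zero (hn : 3 ≤ n) (hU : IsOpen U) (hUc : IsConnected U)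
    (h : ConformalPair S S' T T' s s' t t' Ω)
    (htrivial : (∀ x ∈ U, ∀ i j k, T x i j k = 0) → (∀ x ∈ U, ∀ i j k, T' x i j k = 0) →
      ∃ c : ℝ, ∀ x ∈ U, S'.g x = c • S.g x) (hx : x ∈ U) :
    (t' - t) x + (3 : ℝ) • grad (logFactor Ω) x = 0 := by
  have hg := S.isMetric
  have hg' := S'.isMetric
  have hT := h.abundant.nondegenerate.tensor
  have hd : ∀ y ∈ U, SmoothVec (t' - t) y := fun y hy =>
    smoothVec_sub (h.decomp'.smooth y hy) (h.decomp.smooth y hy)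
  by_contra hu
  have hus : SmoothVec (fun y => (t' - t) y + (3 : ℝ) • grad (logFactor Ω) y) x :=
    smoothVec_add (hd x hx) (smoothVec_smul contDiffAt_const
      (smoothVec_grad (h.conformal.smooth_log hx)))
  have hev : ∀ᶠ y in 𝓝 x, (t' - t) y + (3 : ℝ) • grad (logFactor Ω) y ≠ 0 :=
    (continuousAt_pi.2 fun i => (hus i).continuousAt).eventually_ne hu
  have hs : ∀ᶠ y in 𝓝 x, y ∈ U ∧ ∀ a b k, cubicForm (s y) a b k = 0 := by
    filter_upwards [hev, hU.eventually_mem hx] with y hy hyU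
    refine ⟨hyU, ?_⟩
    obtain ⟨f, hf⟩ := h.conformal.cubic_identity hg hU hT hd h.endForm_eq h.decomp hyU
      (fun z v hzv => h.abundant.covEnd_identity hn hU hUc (h.decomp.hasSkewPart hg)
        h.decomp.smooth hyU hzv)
      (fun z v hzv => h.abundant'.covEnd_identity hn hU hUc (h.decomp'.hasSkewPart hg')
        h.decomp'.smooth hyU hzv)
    refine cubic_eq_zero_of_orthogonal hn (hg.symm y hyU) (hg.nondeg y hyU) (h.decomp.symm₁ y hyU)
      (h.decomp.symm₂ y hyU) (h.decomp.trace hn hg hT hyU)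
      (u := dotProductBilin ℝ ℝ ((t' - t) y + (3 : ℝ) • grad (logFactor Ω) y)) ?_ hf
    intro h0
    exact hy (dotProduct_eq_zero _ fun w => LinearMap.congr_fun h0 w)
  have hT0 := h.abundant.eq_zero_of_eventually hn hU hUc h.curv (h.decomp.hasSkewPart hg)
    h.decomp.smooth hx (hs.mono fun y hy =>
      h.abundant.endForm_eq_zero hn hU hUc h.curv h.decomp hy.1 hy.2)
  have hT0' := h.abundant'.eq_zero_of_eventually hn hU hUc h.curv' (h.decomp'.hasSkewPart hg')
    h.decomp'.smooth hx (hs.mono fun y hy =>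
      h.abundant'.endForm_eq_zero hn hU hUc h.curv' h.decomp' hy.1 fun a b k => by
        rw [h.cubic y hy.1, hy.2, mul_zero])
  obtain ⟨c, hc⟩ := htrivial hT0 hT0'
  refine hu ?_
  rw [h.conformal.grad_logFactor_eq_zero hn hg hU hc hx, smul_zero, add_zero]
  refine eq_zero_of_traceForm_eq_zero hn (hg.symm x hx) (hg.nondeg x hx) (r := 2 / n) fun a => ?_
  have := h.endForm_eq x hx a
  rwa [endForm_eq_zero_iff.2 (hT0 x hx), endForm_eq_zero_iff.2 (hT0' x hx), zero_add, eq_comm]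
    at this

/-- Both families of endomorphisms satisfy the commutator condition and differ by the trace form of
e = -3 dφ, so e(T_a k) + e(a) e(k) = 0. -/
theorem ConformalPair.grad_orthogonal (hn : 3 ≤ n) (hU : IsOpen U) (hUc : IsConnected U)
    (h : ConformalPair S S' T T' s s' t t' Ω)
    (htrivial : (∀ x ∈ U, ∀ i j k, T x i j k = 0) → (∀ x ∈ U, ∀ i j k, T' x i j k = 0) →
      ∃ c : ℝ, ∀ x ∈ U, S'.g x = c • S.g x) (hx : x ∈ U) {a k : Coord n}
    (hak : a ⬝ᵥ S.g x *ᵥ k = 0) :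
    grad (logFactor Ω) x ⬝ᵥ endForm (T x) a *ᵥ k =
      3 * (grad (logFactor Ω) x ⬝ᵥ a) * (grad (logFactor Ω) x ⬝ᵥ k) := by
  have hg := S.isMetric
  have hT := h.abundant.nondegenerate.tensor
  have hd : (t' - t) x = (-3 : ℝ) • grad (logFactor Ω) x := by
    rw [eq_neg_of_add_eq_zero_left (h.add_grad_eq_zero hn hU hUc htrivial hx), neg_smul]
  have h1 := orthogonal_of_commutators hn (hg.symm x hx) (F := endForm (T x))
    (F' := endForm (T' x)) (fun a b => hT.endForm_comm hx a b)
    (by simpa using endForm_smul (T x) 0 0) (h.endForm_eq x hx)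
    (fun a c k hak hck => (h.decomp.hasSkewPart hg).orthogonal hg hx hak hck)
    (fun a c k hak hck => h.abundant.commutator_eq_zero hn hU hUc h.curv (h.decomp.hasSkewPart hg)
      h.decomp.smooth hx hak hck)
    (fun a c k hak hck => h.abundant'.commutator_eq_zero hn hU hUc h.curv'
      (h.decomp'.hasSkewPart S'.isMetric) h.decomp'.smooth hx (h.conformal.orthogonal hx hak)
      (h.conformal.orthogonal hx hck)) hak
  rw [hd] at h1
  simp only [smul_dotProduct, smul_eq_mul] at h1
  linarith

end ConformalPair

/-! ### The potentials of conformally related systems -/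

section Potentials

variable {n : ℕ} {U : Set (Coord n)} {S S' : System n U}
  {T T' s s' : Coord n → Fin n → Fin n → Fin n → ℝ} {t t' : Coord n → Coord n}
  {Ω : Coord n → ℝ} {x : Coord n} {g : Coord n → Matrix (Fin n) (Fin n) ℝ} {f V : Coord n → ℝ}

/-- The Wilczynski equation only concerns orthogonal pairs of vectors. -/
theorem wilczynski_iff (hn : n ≠ 0) (hg : IsMetricOn g U) (hT : IsStructureTensor g T U) :
    Wilczynski g T U V ↔ ∀ x ∈ U, ∀ a k : Coord n, a ⬝ᵥ g x *ᵥ k = 0 →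
      a ⬝ᵥ hessM g V x *ᵥ k = grad V x ⬝ᵥ endForm (T x) a *ᵥ k := by
  refine ⟨fun hV x hx a k hak => ?_, fun hV x hx => ?_⟩
  · rw [hV.hessM_mulVec hT hx, dotProduct_add, transpose_dot, dotProduct_smul, hak, smul_zero,
      add_zero, hT.endForm_comm hx]
  have h1 : ∀ a k : Coord n, a ⬝ᵥ (Matrix.of fun i j => ∑ l, T x i j l * pd l V x) *ᵥ k =
      grad V x ⬝ᵥ endForm (T x) a *ᵥ k := by
    intro a k
    rw [dot_endForm_mulVec, dot_mulVec_eq_sum]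
    simp only [Matrix.of_apply, Finset.sum_mul, grad]
    exact Finset.sum_congr rfl fun i _ => Finset.sum_congr rfl fun j _ =>
      Finset.sum_congr rfl fun l _ => by ring
  obtain ⟨r, hr⟩ := exists_smul_of_orthogonal (hg.nondeg x hx)
    (β := hessM g V x - Matrix.of fun i j => ∑ l, T x i j l * pd l V x) fun a k hak => by
      rw [Matrix.sub_mulVec, dotProduct_sub, hV x hx a k hak, h1, sub_self]
  have h2 : ∀ i j, hess g V i j x = (∑ l, T x i j l * pd l V x) + r * g x i j := fun i j =>
    sub_eq_iff_eq_add'.1 (congrFun (congrFun hr i) j)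
  have h3 : lap g V x = r * n := by
    have h4 : ∑ i, ∑ j, (g x)⁻¹ i j * ∑ l, T x i j l * pd l V x = 0 := by
      have : ∑ l, pd l V x * ∑ i, ∑ j, (g x)⁻¹ i j * T x i j l = 0 :=
        Finset.sum_eq_zero fun l _ => by rw [hT.tracefree x hx l, mul_zero]
      rw [← this]
      simp only [Finset.mul_sum]
      refine Eq.trans (Finset.sum_congr rfl fun i _ => ?_) Finset.sum_comm
      rw [Finset.sum_comm]
      exact Finset.sum_congr rfl fun l _ => Finset.sum_congr rfl fun j _ => by ring
    simp only [lap, h2, mul_add, Finset.sum_add_distrib, h4, zero_add]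
    rw [← sum_inv_mul_self (hg.symm x hx) (hg.nondeg x hx)]
    simp only [Finset.mul_sum]
    exact Finset.sum_congr rfl fun i _ => Finset.sum_congr rfl fun j _ => by ring
  intro i j
  have hn0 : (n : ℝ) ≠ 0 := by exact_mod_cast hn
  rw [h2, h3]
  field_simp

theorem Wilczynski.congr (hU : IsOpen U) (hf : Wilczynski g T U f) (hfV : ∀ x ∈ U, f x = V x) :
    Wilczynski g T U V := by
  intro x hx i j
  have he : f =ᶠ[𝓝 x] V := (hU.eventually_mem hx).mono hfV
  have h1 : ∀ i j, hess g f i j x = hess g V i j x := fun i j =>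
    congrFun (congrFun (hessM_congr he) i) j
  have h2 : ∀ k, pd k f x = pd k V x := fun k => dd_congr he
  have h3 := hf x hx i j
  simp only [lap, h1, h2] at h3 ⊢
  exact h3

/-- On a pair a ⊥ k, Hess (Ω² f) contains 6 Ω² f dφ(a) dφ(k), which matches 2 Ω² f dφ(T_a k) by the
identity for dφ. The remaining terms in dφ and df agree with those from the change of the Hessian
and from t' - t = -3 dφ. Multiples of the metric play no role. -/
theorem ConformalPair.wilczynski_iff (hn : 3 ≤ n) (hU : IsOpen U) (hUc : IsConnected U)
    (h : ConformalPair S S' T T' s s' t t' Ω)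
    (htrivial : (∀ x ∈ U, ∀ i j k, T x i j k = 0) → (∀ x ∈ U, ∀ i j k, T' x i j k = 0) →
      ∃ c : ℝ, ∀ x ∈ U, S'.g x = c • S.g x) (hf : ∀ x ∈ U, ContDiffAt ℝ ∞ f x) :
    Wilczynski S.g T U (fun y => Ω y ^ 2 * f y) ↔ Wilczynski S'.g T' U f := by
  have hg := S.isMetric
  have hc := h.conformal
  have hn0 : n ≠ 0 := by omega
  obtain ⟨c, -, hφ⟩ := hc.hess_log hn hg S'.isMetric hU h.curv h.curv'
  rw [Superintegrable.wilczynski_iff hn0 hg h.abundant.nondegenerate.tensor,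
    Superintegrable.wilczynski_iff hn0 S'.isMetric h.abundant'.nondegenerate.tensor]
  refine forall₂_congr fun x hx => forall₂_congr fun a k => ?_
  have hp := (pow_pos (hc.pos x hx) 2).ne'
  rw [show (a ⬝ᵥ S'.g x *ᵥ k = 0 ↔ a ⬝ᵥ S.g x *ᵥ k = 0) by
    rw [hc.eq x hx, Matrix.smul_mulVec, dotProduct_smul, smul_eq_mul, mul_eq_zero,
      or_iff_right hp]]
  refine imp_congr_right fun hak => ?_
  have hτ := h.grad_orthogonal hn hU hUc htrivial hx hak
  have hd : (t' - t) x = (-3 : ℝ) • grad (logFactor Ω) x := by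
    rw [eq_neg_of_add_eq_zero_left (h.add_grad_eq_zero hn hU hUc htrivial hx), neg_smul]
  rw [hc.hessM_sq_mul hU hx hf, hc.hessM_eq hg hU hx (hf x hx), hφ x hx,
    hc.grad_sq_mul hx (hf x hx), h.endForm_eq x hx, hd]
  simp only [Matrix.add_mulVec, Matrix.sub_mulVec, Matrix.smul_mulVec, dotProduct_add,
    dotProduct_sub, dotProduct_smul, smul_dotProduct, add_dotProduct, smul_eq_mul, dot_vecMulVec,
    traceForm_mulVec (hg.symm x hx), hak, hτ, mul_zero, add_zero, zero_smul, sub_zero]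
  rw [mul_right_inj' hp]
  constructor <;> intro h1 <;> linarith

theorem System.IsNondegenerate.mem_potentials (hS : S.IsNondegenerate T) :
    V ∈ S.potentials ↔ ContDiffOn ℝ ∞ V U ∧ (∀ x ∉ U, V x = 0) ∧ Wilczynski S.g T U V := by
  rw [← SetLike.mem_coe, hS.potentials_eq]
  rfl

theorem System.IsNondegenerate.indicator_mem (hU : IsOpen U) (hS : S.IsNondegenerate T)
    (hV : ContDiffOn ℝ ∞ V U) (hW : Wilczynski S.g T U V) : U.indicator V ∈ S.potentials :=
  hS.mem_potentials.2 ⟨hV.congr fun _ hx => Set.indicator_of_mem hx V,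
    fun _ hx => Set.indicator_of_notMem hx V,
    hW.congr hU fun _ hx => (Set.indicator_of_mem hx V).symm⟩

theorem System.IsNondegenerate.indicator_one_mem (hU : IsOpen U) (hS : S.IsNondegenerate T) :
    U.indicator (fun _ => 1) ∈ S.potentials := by
  refine hS.indicator_mem hU contDiffOn_const fun x _ i j => ?_
  have h1 : ∀ i, pd i (fun _ : Coord n => (1 : ℝ)) = fun _ => 0 := fun i => funext fun y => dd_const 1
  have h2 : ∀ i j y, hess S.g (fun _ => 1) i j y = 0 := fun i j y => by
    simp only [hess, h1, mul_zero, Finset.sum_const_zero, sub_zero]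
    exact dd_const 0
  simp [lap, h2, h1]

theorem ConformalPair.mul_mem_potentials (hn : 3 ≤ n) (hU : IsOpen U) (hUc : IsConnected U)
    (h : ConformalPair S S' T T' s s' t t' Ω)
    (htrivial : (∀ x ∈ U, ∀ i j k, T x i j k = 0) → (∀ x ∈ U, ∀ i j k, T' x i j k = 0) →
      ∃ c : ℝ, ∀ x ∈ U, S'.g x = c • S.g x) (hf : f ∈ S'.potentials) :
    U.indicator (fun y => Ω y ^ 2 * f y) ∈ S.potentials := by
  obtain ⟨h1, -, h2⟩ := h.abundant'.nondegenerate.mem_potentials.1 hf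
  refine h.abundant.nondegenerate.indicator_mem hU (ContDiffOn.mul (fun x hx =>
    (h.conformal.smooth_sq hx).contDiffWithinAt) h1) ?_
  exact (h.wilczynski_iff hn hU hUc htrivial fun x hx => h1.contDiffAt (hU.mem_nhds hx)).2 h2

theorem ConformalPair.inv_mul_mem_potentials (hn : 3 ≤ n) (hU : IsOpen U) (hUc : IsConnected U)
    (h : ConformalPair S S' T T' s s' t t' Ω)
    (htrivial : (∀ x ∈ U, ∀ i j k, T x i j k = 0) → (∀ x ∈ U, ∀ i j k, T' x i j k = 0) →
      ∃ c : ℝ, ∀ x ∈ U, S'.g x = c • S.g x) (hf : f ∈ S.potentials) :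
    U.indicator (fun y => (Ω y)⁻¹ ^ 2 * f y) ∈ S'.potentials := by
  obtain ⟨h1, -, h2⟩ := h.abundant.nondegenerate.mem_potentials.1 hf
  have h3 : ContDiffOn ℝ ∞ (fun y => (Ω y)⁻¹ ^ 2 * f y) U := ContDiffOn.mul (fun x hx =>
    (((h.conformal.smooth x hx).inv (h.conformal.pos x hx).ne').pow 2).contDiffWithinAt) h1
  refine h.abundant'.nondegenerate.indicator_mem hU h3 ?_
  refine (h.wilczynski_iff hn hU hUc htrivial fun x hx => h3.contDiffAt (hU.mem_nhds hx)).1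
    (h2.congr hU fun x hx => ?_)
  have := (h.conformal.pos x hx).ne'
  field_simp

end Potentials

/-! ### The Stäckel transform -/

section Staeckel

variable {n : ℕ} {U : Set (Coord n)} {S S' : System n U}
  {T T' s s' : Coord n → Fin n → Fin n → Fin n → ℝ} {t t' : Coord n → Coord n}
  {Ω : Coord n → ℝ} {x : Coord n} {g g' K K' : Coord n → Matrix (Fin n) (Fin n) ℝ}
  {f V W Z : Coord n → ℝ}

theorem mdd_vsub (a b : Coord n) : mdd (a - b) K x = mdd a K x - mdd b K x := by
  ext i j
  exact dd_vsub a b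

theorem mdd_vsmul (r : ℝ) (a : Coord n) : mdd (r • a) K x = r • mdd a K x := by
  ext i j
  exact dd_vsmul r a

theorem ConformalOn.symm (hc : ConformalOn g g' Ω U) : ConformalOn g' g (fun x => (Ω x)⁻¹) U where
  smooth x hx := (hc.smooth x hx).inv (hc.pos x hx).ne'
  pos x hx := inv_pos.2 (hc.pos x hx)
  eq x hx := by
    have := (hc.pos x hx).ne'
    rw [hc.eq x hx, smul_smul, ← mul_pow, inv_mul_cancel₀ this, one_pow, one_smul]

/-- The Stäckel transform of an integral. -/
theorem AdmitsIntegral.staeckel (hc : ConformalOn g g' Ω U) (hg : IsMetricOn g U)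
    (hg' : IsMetricOn g' U) (hU : IsOpen U) (hK : ∀ x ∈ U, SmoothMat K x)
    (hKs : ∀ x ∈ U, (K x).IsSymm) (hZ : ContDiffOn ℝ ∞ Z U)
    (hZK : ∀ x ∈ U, grad Z x = g x *ᵥ (K x *ᵥ grad (fun y => Ω y ^ 2) x))
    (hK' : ∀ x ∈ U, K' x = K x - (Z x / Ω x ^ 2) • (g x)⁻¹) (hV : ∀ x ∈ U, ContDiffAt ℝ ∞ V x)
    (hint : AdmitsIntegral U g (fun y => Ω y ^ 2 * V y) K) : AdmitsIntegral U g' V K' := by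
  have hZs : ∀ y ∈ U, ContDiffAt ℝ ∞ Z y := fun y hy => hZ.contDiffAt (hU.mem_nhds hy)
  have hp : ∀ y ∈ U, Ω y ^ 2 ≠ 0 := fun y hy => (pow_pos (hc.pos y hy) 2).ne'
  have hls : ∀ y ∈ U, ContDiffAt ℝ ∞ (fun z => Z z / Ω z ^ 2) y := fun y hy =>
    (hZs y hy).div (hc.smooth_sq hy) (hp y hy)
  have hgi : ∀ y ∈ U, ((g y)⁻¹).IsSymm := fun y hy => by
    rw [Matrix.IsSymm, Matrix.transpose_nonsing_inv, (hg.symm y hy).eq]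
  have hK's : ∀ y ∈ U, (K' y).IsSymm := fun y hy => by
    rw [hK' y hy]
    exact (hKs y hy).sub ((hgi y hy).smul _)
  have hK'm : ∀ y ∈ U, SmoothMat K' y := fun y hy i j => by
    refine ContDiffAt.congr_of_eventuallyEq (smoothMat_sub (hK y hy)
      (smoothMat_smul (hls y hy) (hg.smoothMat_inv hU hy)) i j) ?_
    filter_upwards [hU.eventually_mem hy] with z hz
    rw [hK' z hz]
  have hgr : ∀ y ∈ U, grad (fun y => Ω y ^ 2) y = (2 * Ω y ^ 2) • grad (logFactor Ω) y :=
    fun y hy => funext fun i => hc.dd_sq hy _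
  -- Since dZ = g K d(Ω²), the gradient of Z/Ω² involves only dφ. This is what makes K' a Killing
  -- tensor of g'.
  have hdl : ∀ y ∈ U, ∀ v : Coord n, dd v (fun z => Z z / Ω z ^ 2) y =
      2 * ((K y *ᵥ (g y *ᵥ v)) ⬝ᵥ grad (logFactor Ω) y)
        - 2 * (Z y / Ω y ^ 2) * (v ⬝ᵥ grad (logFactor Ω) y) := by
    intro y hy v
    have h1 : dd v Z y = dd v (fun z => Ω z ^ 2 * (Z z / Ω z ^ 2)) y :=
      dd_congr ((hU.eventually_mem hy).mono fun z hz => by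
        have := (hc.pos z hz).ne'
        field_simp)
    have h2 : dd v Z y = 2 * Ω y ^ 2 * ((K y *ᵥ (g y *ᵥ v)) ⬝ᵥ grad (logFactor Ω) y) := by
      rw [dd_eq_sum, hZK y hy, hgr y hy, dot_mulVec_comm (hg.symm y hy), dotProduct_comm,
        dot_mulVec_comm (hKs y hy), smul_dotProduct, smul_eq_mul, dotProduct_comm (grad _ _)]
    rw [h2, dd_mul (hc.smooth_sq hy) (hls y hy), hc.dd_sq hy, dd_eq_sum v (logFactor Ω)] at h1
    refine mul_left_cancel₀ (hp y hy) ?_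
    linear_combination -h1
  rw [admitsIntegral_iff hg hU hK hKs fun y hy => (hc.smooth_sq hy).mul (hV y hy)] at hint
  rw [admitsIntegral_iff hg' hU hK'm hK's hV]
  obtain ⟨hkill, W, hW, hWK⟩ := hint
  have hWs : ∀ y ∈ U, ContDiffAt ℝ ∞ W y := fun y hy => hW.contDiffAt (hU.mem_nhds hy)
  -- On phase space the new integral is K p p + W - Z H', where H' = Ω⁻² g⁻¹ p p + V is the new
  -- Hamiltonian. Its scalar part is W - Z V.
  refine ⟨fun x hx p => ?_, fun y => W y - Z y * V y, fun x hx =>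
    ((hWs x hx).sub ((hZs x hx).mul (hV x hx))).contDiffWithinAt, fun x hx => ?_⟩
  · have hgi' : SmoothMat (fun y => (g' y)⁻¹) x := hg'.smoothMat_inv hU hx
    have hgis : SmoothMat (fun y => (g y)⁻¹) x := hg.smoothMat_inv hU hx
    have h1 : ∀ v : Coord n, mdd v (fun y => (g y)⁻¹) x =
        (2 * (v ⬝ᵥ grad (logFactor Ω) x)) • (g x)⁻¹ + Ω x ^ 2 • mdd v (fun y => (g' y)⁻¹) x := by
      intro v
      rw [mdd_congr (B := fun y => Ω y ^ 2 • (g' y)⁻¹) ((hU.eventually_mem hx).mono fun y hy => by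
        simp only [hc.inv_eq hg hy, smul_smul, mul_inv_cancel₀ (hp y hy), one_smul]),
        mdd_smul (hc.smooth_sq hx) hgi', hc.dd_sq hx, hc.inv_eq hg hx, smul_smul, dd_eq_sum]
      congr 2
      have := (hc.pos x hx).ne'
      field_simp
    have h2 : ∀ v : Coord n, mdd v K' x = mdd v K x - (dd v (fun z => Z z / Ω z ^ 2) x • (g x)⁻¹
        + (Z x / Ω x ^ 2) • mdd v (fun y => (g y)⁻¹) x) := by
      intro v
      rw [mdd_congr ((hU.eventually_mem hx).mono hK'), mdd_sub (hK x hx)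
        (smoothMat_smul (hls x hx) hgis), mdd_smul (hls x hx) hgis]
    have h3 : ∀ v : Coord n, Ω x ^ 2 * (p ⬝ᵥ mdd v (fun y => (g' y)⁻¹) x *ᵥ p) =
        p ⬝ᵥ mdd v (fun y => (g y)⁻¹) x *ᵥ p
          - 2 * (v ⬝ᵥ grad (logFactor Ω) x) * (p ⬝ᵥ (g x)⁻¹ *ᵥ p) := by
      intro v
      rw [h1, Matrix.add_mulVec, Matrix.smul_mulVec, Matrix.smul_mulVec, dotProduct_add,
        dotProduct_smul, dotProduct_smul, smul_eq_mul, smul_eq_mul]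
      ring
    have h4 : (K x - (Z x / Ω x ^ 2) • (g x)⁻¹) *ᵥ p =
        K x *ᵥ p - (Z x / Ω x ^ 2) • ((g x)⁻¹ *ᵥ p) := by
      rw [Matrix.sub_mulVec, Matrix.smul_mulVec]
    refine mul_left_cancel₀ (hp x hx) ?_
    rw [h3, hc.inv_eq hg hx, Matrix.smul_mulVec, mdd_vsmul, Matrix.smul_mulVec, dotProduct_smul,
      smul_eq_mul, mul_inv_cancel_left₀ (hp x hx), h2, hdl x hx, mulVec_inv_mulVec (hg.nondeg x hx),
      hK' x hx, h4, mdd_vsub, mdd_vsmul]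
    simp only [Matrix.sub_mulVec, Matrix.add_mulVec, Matrix.smul_mulVec, dotProduct_sub,
      dotProduct_add, dotProduct_smul, smul_eq_mul, sub_dotProduct, smul_dotProduct, hkill x hx p]
    ring
  · have h1 : grad (fun y => W y - Z y * V y) x = grad W x - (V x • grad Z x + Z x • grad V x) := by
      ext i
      refine (dd_sub (hWs x hx) ((hZs x hx).mul (hV x hx))).trans ?_
      rw [dd_mul (hZs x hx) (hV x hx)]
      simp only [grad, pd_eq_dd, Pi.sub_apply, Pi.add_apply, Pi.smul_apply, smul_eq_mul]
      ring
    obtain ⟨l, hl, hlZ⟩ : ∃ l, Z x / Ω x ^ 2 = l ∧ Z x = Ω x ^ 2 * l :=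
      ⟨_, rfl, by have := (hc.pos x hx).ne'; field_simp⟩
    rw [h1, hWK x hx, hZK x hx, hgr x hx, hc.grad_sq_mul hx (hV x hx), hc.eq x hx,
      hK' x hx, hl, hlZ]
    simp only [Matrix.sub_mulVec, Matrix.smul_mulVec, Matrix.mulVec_sub, Matrix.mulVec_add,
      Matrix.mulVec_smul, mulVec_inv_mulVec (hg.nondeg x hx), smul_add, smul_smul]
    module

/-- With upper indices the trace-free part depends only on the conformal class, and adding a
multiple of the inverse metric does not change it. -/
theorem tracefreePart_rescaled (hn : n ≠ 0) (hc : ConformalOn g g' Ω U) (hg : IsMetricOn g U)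
    (hx : x ∈ U) {r : ℝ} (hK : K' x = K x - r • (g x)⁻¹) :
    tracefreePart g' K' x = tracefreePart g K x := by
  have hp := (hc.pos x hx).ne'
  have hn0 : (n : ℝ) ≠ 0 := by exact_mod_cast hn
  have h1 : ∑ a, ∑ b, g' x a b * K' x a b = Ω x ^ 2 * (∑ a, ∑ b, g x a b * K x a b - r * n) := by
    rw [← sum_inv_mul_self (hg.symm x hx) (hg.nondeg x hx)]
    simp only [hc.eq x hx, hK, Matrix.smul_apply, Matrix.sub_apply, smul_eq_mul, mul_sub,
      Finset.mul_sum, ← Finset.sum_sub_distrib]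
    exact Finset.sum_congr rfl fun i _ => Finset.sum_congr rfl fun j _ => by ring
  rw [tracefreePart, tracefreePart, h1, hK, hc.inv_eq hg hx, smul_smul, sub_sub, ← add_smul]
  congr 2
  field_simp
  ring

theorem admitsIntegral_congr (hU : IsOpen U) (hfV : ∀ x ∈ U, f x = V x)
    (h : AdmitsIntegral U g f K) : AdmitsIntegral U g V K := by
  obtain ⟨W, hW, h⟩ := h
  refine ⟨W, hW, fun q hq p => ?_⟩
  have h1 : ∀ y ∈ U, hamiltonian g f y = hamiltonian g V y := fun y hy => by
    funext p
    simp only [hamiltonian, quadraticObservable, hfV y hy]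
  have h2 : ∀ i, pd i (fun y => hamiltonian g f y p) q = pd i (fun y => hamiltonian g V y p) q :=
    fun i => dd_congr ((hU.eventually_mem hq).mono fun y hy => congrFun (h1 y hy) p)
  have h3 := h q hq p
  simp only [poisson, h1 q hq, h2] at h3
  exact h3

/-- The witness is the Stäckel transform of K, extended by zero. It admits integrals for all
potentials of the second system, and `System.IsAbundant.mem_killing` shows that such a tensor
already belongs to its Killing space. -/
theorem System.IsAbundant.exists_tracefreePart_eq (hn : 3 ≤ n) (hU : IsOpen U)
    (hUc : IsConnected U) (hS' : S'.IsAbundant T') (hskew : HasSkewPart S'.g T' t' U)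
    (ht : ∀ x ∈ U, SmoothVec t' x) (hc : ConformalOn S.g S'.g Ω U)
    (hΩ : U.indicator (fun x => Ω x ^ 2) ∈ S.potentials)
    (hmul : ∀ V ∈ S'.potentials, U.indicator (fun x => Ω x ^ 2 * V x) ∈ S.potentials)
    (hK : K ∈ S.killing) : ∃ K' ∈ S'.killing, tracefreePart S'.g K' = tracefreePart S.g K := by
  have hg := S.isMetric
  have hsm : ∀ y ∈ U, SmoothMat K y := fun y hy i j =>
    (S.killing_smooth K hK i j).contDiffAt (hU.mem_nhds hy)
  have hKs := S.killing_symm K hK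
  have hint : ∀ {V : Coord n → ℝ}, U.indicator V ∈ S.potentials → AdmitsIntegral U S.g V K :=
    fun {V} hV => admitsIntegral_congr hU (fun x hx => Set.indicator_of_mem hx V)
      (S.integral _ hV K hK)
  obtain ⟨-, Z, hZ, hZK⟩ := (admitsIntegral_iff hg hU hsm hKs fun x hx =>
    hc.smooth_sq hx).1 (hint hΩ)
  classical
  let K' : Coord n → Matrix (Fin n) (Fin n) ℝ := fun x =>
    if x ∈ U then K x - (Z x / Ω x ^ 2) • (S.g x)⁻¹ else 0
  have hK' : ∀ x ∈ U, K' x = K x - (Z x / Ω x ^ 2) • (S.g x)⁻¹ := fun x hx => if_pos hx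
  refine ⟨K', hS'.mem_killing hn hU hUc hskew ht (fun x hx => ?_) (fun x hx => ?_)
    (fun x hx => if_neg hx) fun V hV => ?_, funext fun x => ?_⟩
  · have h1 : SmoothMat (fun x => K x - (Z x / Ω x ^ 2) • (S.g x)⁻¹) x :=
      smoothMat_sub (hsm x hx) (smoothMat_smul ((hZ.contDiffAt (hU.mem_nhds hx)).div
        (hc.smooth_sq hx) (pow_pos (hc.pos x hx) 2).ne') (hg.smoothMat_inv hU hx))
    exact fun i j => (h1 i j).congr_of_eventuallyEq
      ((hU.eventually_mem hx).mono fun y hy => congrFun (congrFun (hK' y hy) i) j)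
  · rw [hK' x hx]
    have : ((S.g x)⁻¹).IsSymm := by
      rw [Matrix.IsSymm, Matrix.transpose_nonsing_inv, (hg.symm x hx).eq]
    exact (hKs x hx).sub (this.smul _)
  · exact AdmitsIntegral.staeckel hc hg S'.isMetric hU hsm hKs hZ hZK hK'
      (fun x hx => (S'.potentials_smooth V hV).contDiffAt (hU.mem_nhds hx)) (hint (hmul V hV))
  · by_cases hx : x ∈ U
    · exact tracefreePart_rescaled (by omega) hc hg hx (hK' x hx)
    · have h1 : K' x = 0 := if_neg hx
      simp [tracefreePart, h1, S.killing_zero K hK x hx]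

theorem ConformalPair.staeckelEquivalent (hn : 3 ≤ n) (hU : IsOpen U) (hUc : IsConnected U)
    (h : ConformalPair S S' T T' s s' t t' Ω)
    (htrivial : (∀ x ∈ U, ∀ i j k, T x i j k = 0) → (∀ x ∈ U, ∀ i j k, T' x i j k = 0) →
      ∃ c : ℝ, ∀ x ∈ U, S'.g x = c • S.g x) : StackelEquivalent S S' := by
  have hc := h.conformal
  have hg := S.isMetric
  have hp : ∀ x ∈ U, Ω x ^ 2 ≠ 0 := fun x hx => (pow_pos (hc.pos x hx) 2).ne'
  have hmul : ∀ V ∈ S'.potentials, U.indicator (fun x => Ω x ^ 2 * V x) ∈ S.potentials :=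
    fun V hV => h.mul_mem_potentials hn hU hUc htrivial hV
  have hinv : ∀ V ∈ S.potentials, U.indicator (fun x => (Ω x)⁻¹ ^ 2 * V x) ∈ S'.potentials :=
    fun V hV => h.inv_mul_mem_potentials hn hU hUc htrivial hV
  have hone : ∀ F : Coord n → ℝ, U.indicator (fun x => F x * U.indicator (fun _ => 1) x) =
      U.indicator F := fun F => Set.indicator_congr fun x hx => by
    rw [Set.indicator_of_mem hx, mul_one]
  -- Constants solve every Wilczynski equation, and Ω² = Ω² · 1 corresponds to the constant
  -- potential of the second system.
  have hΩ : U.indicator (fun x => Ω x ^ 2) ∈ S.potentials := by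
    have := hmul _ (h.abundant'.nondegenerate.indicator_one_mem hU)
    rwa [hone] at this
  have hΩ' : U.indicator (fun x => (Ω x)⁻¹ ^ 2) ∈ S'.potentials := by
    have := hinv _ (h.abundant.nondegenerate.indicator_one_mem hU)
    rwa [hone] at this
  have hham : ∀ V V' : Coord n → ℝ, ∀ q ∈ U, V' q = (Ω q ^ 2)⁻¹ * V q → ∀ p,
      hamiltonian S'.g V' q p = (Ω q ^ 2)⁻¹ * hamiltonian S.g V q p := by
    intro V V' q hq hV p
    simp only [hamiltonian, quadraticObservable, hV, hc.inv_eq hg hq, Matrix.smul_apply,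
      smul_eq_mul, mul_add, Finset.mul_sum, mul_assoc]
  refine ⟨Ω, ⟨fun x hx => (hc.smooth x hx).contDiffWithinAt, hc.pos, fun V hV =>
    ⟨_, hinv V hV, fun q hq => hham V _ q hq ?_⟩, fun V' hV' =>
    ⟨_, hmul V' hV', fun q hq => hham _ V' q hq ?_⟩, ?_⟩, hΩ, fun K hK =>
    admitsIntegral_congr hU (fun x hx => Set.indicator_of_mem hx _) (S.integral _ hΩ K hK)⟩
  · rw [Set.indicator_of_mem hq, inv_pow]
  · rw [Set.indicator_of_mem hq, inv_mul_cancel_left₀ (hp q hq)]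
  · congr 1
    refine Set.Subset.antisymm ?_ ?_
    · rintro _ ⟨K, hK, rfl⟩
      exact h.abundant'.exists_tracefreePart_eq hn hU hUc (h.decomp'.hasSkewPart S'.isMetric)
        h.decomp'.smooth hc hΩ hmul hK
    -- The same transform backwards, with conformal factor Ω⁻¹ and the potential Ω⁻² of the second
    -- system.
    · rintro _ ⟨K, hK, rfl⟩
      exact h.abundant.exists_tracefreePart_eq hn hU hUc (h.decomp.hasSkewPart hg)
        h.decomp.smooth hc.symm hΩ' hinv hK

end Staeckel

end Superintegrable

end

/-! ### The main theorem -/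

theorem mainTheorem8 (n : ℕ) (hn : 3 ≤ n)
    (U : Set (Superintegrable.Coord n)) (hU : IsOpen U) (hUc : IsConnected U)
    (S S' : Superintegrable.System n U)
    (T T' : Superintegrable.Coord n → Fin n → Fin n → Fin n → ℝ)
    (hS : S.IsAbundant T) (hS' : S'.IsAbundant T')
    (hcurv : Superintegrable.HasConstantCurvature S.g U)
    (hcurv' : Superintegrable.HasConstantCurvature S'.g U)
    (hconf : Superintegrable.SameConformalClass U S.g S'.g)
    (B B' : Superintegrable.Coord n → ℝ)
    (hB : Superintegrable.IsStructureFunction S.g T U B)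
    (hB' : Superintegrable.IsStructureFunction S'.g T' U B')
    (hb : ∀ x ∈ U, Superintegrable.density S.g B x = Superintegrable.density S'.g B' x)
    (htrivial : (∀ x ∈ U, ∀ i j k, T x i j k = 0) → (∀ x ∈ U, ∀ i j k, T' x i j k = 0) →
      ∃ c : ℝ, ∀ x ∈ U, S'.g x = c • S.g x) :
    Superintegrable.StackelEquivalent S S' := by
  obtain ⟨Ω, hΩs, hΩ, hgg⟩ := hconf
  have hc : Superintegrable.ConformalOn S.g S'.g Ω U := ⟨fun x hx => hΩs.contDiffAt (hU.mem_nhds hx), hΩ, hgg⟩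
  have hg := S.isMetric
  have hg' := S'.isMetric
  have hT := hS.nondegenerate.tensor
  have hT' := hS'.nondegenerate.tensor
  have hD := hB.hasDecomposition hg hU
  have hD' := hB'.hasDecomposition hg' hU
  have hBs : ∀ y ∈ U, ContDiffAt ℝ ∞ B y := fun y hy => hB.1.contDiffAt (hU.mem_nhds hy)
  -- Equal densities enter only through this relation, which makes the cubic parts correspond.
  have hBB : ∀ y ∈ U, B' y = Ω y ^ 2 * B y := fun y hy => hc.eq_of_density hn hg hy (hb y hy)
  exact Superintegrable.ConformalPair.staeckelEquivalent hn hU hUc ⟨hc, hS, hS', hcurv, hcurv', hD, hD',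
    fun x hx => hc.cubicForm_symmThird hn hg hg' hU hcurv hcurv' hT hT' hBs hBB hD hD' hx,
    fun x hx => hc.endForm_eq hn hg hg' hU hcurv hcurv' hT hT' hBs hBB hD hD' hx⟩ htrivial
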